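/- Let $(X,\mathsf d)$ be a complete metric space and let $\sigma$ be a Hausdorff topology on $X$ such that $\mathsf d$ is sequentially lower semicontinuous with respect to $\sigma\times\sigma$ and, for every $\sigma$-open $U$ and $x\in U$, there are a $\sigma$-open neighbourhood $V$ of $x$ and $\delta>0$ with $\mathsf d(y,V)<\delta\Rightarrow y\in U$. Let $\phi:X\to(-\infty,\infty]$, $\phi\not\equiv\infty$, satisfy the following. - Lower semicontinuity: if $(u_n)$ is $\mathsf d$-bounded and $u_n\to u$ in $\sigma$, then $\phi(u)\le\liminf_n\phi(u_n)$. - Compactness: every $\mathsf d$-bounded sequence $(u_n)$ with $\sup_n\phi(u_n)<\infty$ has a $\sigma$-convergent subsequence. - Coercivity: there are $u_*\in X$ and $\mathsf A,\mathsf B\ge0$ with $\phi(u)\ge-\mathsf B\,\mathsf d^2(u,v)-\mathsf B\,\mathsf d^2(v,u_*)-\mathsf A$ for all $u,v\in X$. Let $\lambda<0$ and let $\phi$ be $\lambda$-geodesically convex: any $v_0,v_1$ with $\phi(v_0),\phi(v_1)<\infty$ are joined by a curve $\gamma:[0,1]\to X$ with $\gamma(0)=v_0$, $\gamma(1)=v_1$,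 $\mathsf d(\gamma(s),\gamma(t))=|t-s|\,\mathsf d(v_0,v_1)$ and $\phi(\gamma(t))\le(1-t)\phi(v_0)+t\phi(v_1)-\frac\lambda2t(1-t)\mathsf d^2(v_0,v_1)$ for all $s,t\in[0,1]$. For $\varepsilon>0$ put $\mathrm d\mu_\varepsilon(t)=\varepsilon^{-1}e^{-t/\varepsilon}\,\mathrm dt$ on $(0,\infty)$. For $\bar u\in X$ let $\mathcal M_\varepsilon(\bar u)$ be the (possibly empty) set of curves $u$ that minimize, with finite minimum value, $$\mathcal I_\varepsilon[u]=\int_0^\infty\Big(\frac\varepsilon2|u'|^2(t)+\phi(u(t))\Big)\,\mathrm d\mu_\varepsilon(t)$$ among all $u\in\mathrm{AC}^2_{\mathrm{loc}}([0,\infty);X)$ with $u(0)=\bar u$ and $\int_0^\infty|u'|^2\,\mathrm d\mu_\varepsilon<\infty$. Here $|u'|(t)=\lim_{s\to t}\mathsf d(u(s),u(t))/|t-s|$ is the metric derivative, which exists for a.e. $t$. Then for every $\varepsilon>0$, $\bar u\in X$ and $u_\varepsilon\in\mathcal M_\varepsilon(\bar u)$: 1. $t\mapsto\phi(u_\varepsilon(t))$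 is finite and locally Lipschitz on $(0,\infty)$, and right-continuous at $t=0$ (as a function with values in $(-\infty,\infty]$); 2. $t\mapsto\frac12|u_\varepsilon'|^2(t)$ has a locally Lipschitz representative on $(0,\infty)$; 3. in the sense of distributions on $(0,\infty)$, $$-\varepsilon\frac{\mathrm d^2}{\mathrm dt^2}\Big(\frac12|u_\varepsilon'|^2\Big)+\frac{\mathrm d}{\mathrm dt}\frac12|u_\varepsilon'|^2=-\frac{\mathrm d^2}{\mathrm dt^2}\phi(u_\varepsilon)-\frac{\mathrm d}{\mathrm dt}\frac12|u_\varepsilon'|^2\le-\lambda|u_\varepsilon'|^2;$$ 4. if $\varepsilon$ is small, namely $8\varepsilon|\lambda|\le1$, then $t\mapsto\phi(u_\varepsilon(t))$ is nonincreasing on $[0,\infty)$; 5. for all $0<a<b$ there is $C_{a,b}>0$ such that, with $\mathcal U_\varepsilon(t)=\int_0^t\frac12|u_\varepsilon'|^2(s)\,\mathrm ds$, the function $f=\phi\circ u_\varepsilon+\mathcal U_\varepsilon$ is $\lambda C_{a,b}$-convex on $[a,b]$, that is, $f((1-\theta)s+\theta t)\le(1-\theta)f(s)+\theta f(t)-\frac{\lambda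 C_{a,b}}2\theta(1-\theta)(s-t)^2$ for all $s,t\in[a,b]$, $\theta\in[0,1]$. Moreover: 6. for every $\lambda'<\lambda$ there is $\varepsilon'>0$ such that for all $0<\varepsilon<\varepsilon'$, all $\bar u\in X$ and all $u_\varepsilon\in\mathcal M_\varepsilon(\bar u)$, the function $t\mapsto e^{2\lambda't}|u_\varepsilon'|^2(t)$ (for the locally Lipschitz representative of $|u_\varepsilon'|^2$) is nonincreasing on $(0,\infty)$. -/

import Mathlib

open Set Filter Topology MeasureTheory
open scoped ENNReal ContDiff

noncomputable section

namespace WED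

/-! ### Curves in a metric space -/

/-- The metric derivative `|u'|(t) = lim_{s → t} d(u(s), u(t)) / |t - s|`
(meaningful only at those `t` at which the limit exists). -/
def metricDeriv {X : Type*} [MetricSpace X] (u : ℝ → X) (t : ℝ) : ℝ :=
  limUnder (𝓝[≠] t) (fun s => dist (u s) (u t) / |t - s|)

/-- `u ∈ AC^p(I; X)`: there is `m ∈ L^p(I)` with `d(u(s), u(t)) ≤ ∫_s^t m` for all `s ≤ t` in the
interval `I`. Only the values of `u` on `I` matter. -/
def IsAC {X : Type*} [MetricSpace X] (p : ℝ≥0∞) (I : Set ℝ) (u : ℝ → X) : Prop :=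
  ∃ m : ℝ → ℝ, MemLp m p (volume.restrict I) ∧
    ∀ s ∈ I, ∀ t ∈ I, s ≤ t → dist (u s) (u t) ≤ ∫ r in s..t, m r

/-- `u ∈ AC^p_loc(I; X)`: `u ∈ AC^p(J; X)` for every compact interval `J ⊆ I`. -/
def IsACLoc {X : Type*} [MetricSpace X] (p : ℝ≥0∞) (I : Set ℝ) (u : ℝ → X) : Prop :=
  ∀ a b : ℝ, a ≤ b → Icc a b ⊆ I → IsAC p (Icc a b) u

/-- `γ : [0,1] → X` is a (minimal, constant-speed) geodesic. -/
def IsGeodesic {X : Type*} [MetricSpace X] (γ : ℝ → X) : Prop :=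
  ∀ s ∈ Icc (0 : ℝ) 1, ∀ t ∈ Icc (0 : ℝ) 1,
    dist (γ s) (γ t) = |t - s| * dist (γ 0) (γ 1)

/-! ### Functionals `φ : X → (-∞, ∞]`, modelled as `EReal`-valued functions avoiding `⊥` -/

/-- `φ` is `lam`-geodesically convex. The endpoints have finite energy, so `toReal` is exact. -/
def GeodConvex {X : Type*} [MetricSpace X] (lam : ℝ) (φ : X → EReal) : Prop :=
  ∀ v₀ v₁ : X, φ v₀ < ⊤ → φ v₁ < ⊤ →
    ∃ γ : ℝ → X, IsGeodesic γ ∧ γ 0 = v₀ ∧ γ 1 = v₁ ∧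
      ∀ t ∈ Icc (0 : ℝ) 1,
        φ (γ t) ≤ (((1 - t) * (φ v₀).toReal + t * (φ v₁).toReal
          - lam / 2 * t * (1 - t) * dist v₀ v₁ ^ 2 : ℝ) : EReal)

/-- `(X, d, σ)` is a compatible metric-topological space. -/
structure Compatible {X : Type*} [MetricSpace X] (σ : TopologicalSpace X) : Prop where
  hausdorff : @T2Space X σ
  /-- `d` is sequentially lower semicontinuous for `σ × σ`. -/
  dist_lsc : ∀ (u v : ℕ → X) (x y : X),
    Tendsto u atTop (@nhds X σ x) → Tendsto v atTop (@nhds X σ y) →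
      edist x y ≤ liminf (fun n => edist (u n) (v n)) atTop
  thickening : ∀ U : Set X, IsOpen[σ] U → ∀ x ∈ U,
    ∃ V : Set X, IsOpen[σ] V ∧ x ∈ V ∧
      ∃ δ : ℝ, 0 < δ ∧ ∀ y : X, Metric.infDist y V < δ → y ∈ U

/-- The standard lower semicontinuity-coercivity-compactness assumptions on a proper functional
`φ : X → (-∞, ∞]`. -/
structure LSCC {X : Type*} [MetricSpace X] (σ : TopologicalSpace X) (φ : X → EReal) : Prop where
  ne_bot : ∀ x, φ x ≠ ⊥
  proper : ∃ x, φ x < ⊤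
  lsc : ∀ (u : ℕ → X) (x : X), (∃ C : ℝ, ∀ n m, dist (u n) (u m) ≤ C) →
    Tendsto u atTop (@nhds X σ x) → φ x ≤ liminf (fun n => φ (u n)) atTop
  compactness : ∀ u : ℕ → X, (∃ c : ℝ, ∀ n, φ (u n) ≤ (c : EReal)) →
    (∃ C : ℝ, ∀ n m, dist (u n) (u m) ≤ C) →
      ∃ (x : X) (k : ℕ → ℕ), StrictMono k ∧ Tendsto (u ∘ k) atTop (@nhds X σ x)
  coercivity : ∃ (x₀ : X) (A B : ℝ), 0 ≤ A ∧ 0 ≤ B ∧ ∀ u v : X,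
    ((-(B * dist u v ^ 2) - (B * dist v x₀ ^ 2 + A) : ℝ) : EReal) ≤ φ u

/-! ### The WED functional and its minimizers -/

/-- The measure `μ_ε = ε⁻¹ e^{-t/ε} dt` on `(0, ∞)`. -/
def expWeight (ε : ℝ) : Measure ℝ :=
  (volume.restrict (Ioi 0)).withDensity (fun t => ENNReal.ofReal (Real.exp (-t / ε) / ε))

/-- The integral `∫ f⁺ dμ - ∫ f⁻ dμ` of an extended real valued function. -/
def extIntegral (μ : Measure ℝ) (f : ℝ → EReal) : EReal :=
  ((∫⁻ t, (f t).toENNReal ∂μ : ℝ≥0∞) : EReal) - ((∫⁻ t, (-f t).toENNReal ∂μ : ℝ≥0∞) : EReal)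

/-- The weighted energy-dissipation functional
`I_ε[u] = ∫_0^∞ (ε/2 |u'|²(t) + φ(u(t))) dμ_ε(t)`. -/
def wedFunctional {X : Type*} [MetricSpace X] (φ : X → EReal) (ε : ℝ) (u : ℝ → X) : EReal :=
  extIntegral (expWeight ε)
    (fun t => ((ε / 2 * metricDeriv u t ^ 2 : ℝ) : EReal) + φ (u t))

/-- Admissible curves: `u ∈ AC²_loc([0,∞); X)`, `u(0) = x`, `∫ |u'|² dμ_ε < ∞`. -/
def admissible {X : Type*} [MetricSpace X] (ε : ℝ) (x : X) : Set (ℝ → X) :=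
  {u | IsACLoc 2 (Ici 0) u ∧ u 0 = x ∧
    ∫⁻ t, ENNReal.ofReal (metricDeriv u t ^ 2) ∂(expWeight ε) < ⊤}

/-- The (possibly empty) set of minimizers of the WED functional starting from `x`; it is empty
when every admissible curve has infinite energy. -/
def minimizers {X : Type*} [MetricSpace X] (φ : X → EReal) (ε : ℝ) (x : X) : Set (ℝ → X) :=
  {u | u ∈ admissible ε x ∧ wedFunctional φ ε u < ⊤ ∧
    ∀ v ∈ admissible ε x, wedFunctional φ ε u ≤ wedFunctional φ ε v}

/-- `w_ε = ½ |u'|²`. -/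
def halfSpeedSq {X : Type*} [MetricSpace X] (u : ℝ → X) (t : ℝ) : ℝ :=
  1 / 2 * metricDeriv u t ^ 2

/-- `𝒰_ε(t) = ∫_0^t ½ |u'|²(s) ds`. -/
def accumulated {X : Type*} [MetricSpace X] (u : ℝ → X) (t : ℝ) : ℝ :=
  ∫ s in (0 : ℝ)..t, halfSpeedSq u s

/-! ### Functions and distributions on `(0, ∞)` -/

/-- `w` is a locally Lipschitz representative of `g` on `(0, ∞)`. -/
def IsLocLipRep (w g : ℝ → ℝ) : Prop :=
  LocallyLipschitzOn (Ioi 0) w ∧ ∀ᵐ t ∂(volume.restrict (Ioi (0 : ℝ))), w t = g t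

/-- `ξ ∈ C_c^∞(0, ∞)`. -/
def IsTest (ξ : ℝ → ℝ) : Prop :=
  ContDiff ℝ ∞ ξ ∧ HasCompactSupport ξ ∧ tsupport ξ ⊆ Ioi 0

/-- The pairing of (the distribution defined by) `f` with a test function on `(0, ∞)`. -/
def pairing (f ξ : ℝ → ℝ) : ℝ := ∫ t in Ioi (0 : ℝ), f t * ξ t

/-- The pairing of the distributional derivative `f'` with a test function. -/
def pairingDeriv (f ξ : ℝ → ℝ) : ℝ := -pairing f (deriv ξ)

/-- The pairing of the second distributional derivative `f''` with a test function. -/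
def pairingDeriv2 (f ξ : ℝ → ℝ) : ℝ := pairing f (deriv (deriv ξ))

end WED

end

namespace WED

/-! ### Metric derivatives of absolutely continuous curves -/

/-! Write `y` for the speed |u'|, l for the arc length, A for ∫|u'|² and F for φ∘u. Minimality is
exploited through two kinds of competitors.

Outer competitors replace u on [a,b] by a geodesic from u(a) to u(b) along which φ is λ-convex. Run
proportionally to l, the geodesic is nowhere faster than u, so F can make no excursion above the
corresponding chord (`energy_le_chord`). Hence F - (λ/2)l² is convex as a function of l
(`three_point`), which gives finiteness for t > 0 and, with lower semicontinuity, continuity. Run at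
constant speed, the geodesic saves kinetic energy, and an integration by parts against the
exponential weight turns this saving into A/2: F + A/2 is λM²-convex in time wherever y ≤ M
(`energy_add_le_chord`). Localizing M gives (F + A/2)'' ≥ λy² as distributions.

Inner variations u∘(id + τξ)⁻¹ give the first integral F - (ε/2)y² + A = c
(`exists_first_integral`). So y has a continuous representative, y² inherits Lipschitz bounds from
F, and the distributional identity is the derivative of this conservation law.

Monotonicity comes from the infinite horizon. Let σ be a slope of F - (λ/2)l² with respect to l over
an interval ending at t₀. Later slopes are at least σ, so by the first integral, formally, εy' ≥ y +
σ + λl. If r ≥ 0, 2εr ≤ 1, -λ ≤ r - εr² and R = 1/ε - r, then Q = (1 - εr)y + σ + λl satisfies Q' ≥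
RQ. Were Q(t₀) > 0, y would grow at least like exp(Rt) with 2R ≥ 1/ε, against the finiteness of ∫ y²
dμ_ε. Thus Q(t₀) ≤ 0 (`slope_le`), which amounts to F' ≤ -(1 - εr)y² and (y²)' ≤ 2ry². These
inequalities are handled through one-sided touching functions. The choices r = 2|λ| and r = -λ' give
the two monotonicity claims. -/

theorem absolutelyContinuousOnInterval_of_dist_le {X Y : Type*} [PseudoMetricSpace X]
    [PseudoMetricSpace Y] {f : ℝ → X} {g : ℝ → Y} {a b : ℝ}
    (hg : AbsolutelyContinuousOnInterval g a b)
    (h : ∀ s ∈ uIcc a b, ∀ t ∈ uIcc a b, dist (f s) (f t) ≤ dist (g s) (g t)) :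
    AbsolutelyContinuousOnInterval f a b := by
  rw [absolutelyContinuousOnInterval_iff] at hg ⊢
  intro ε hε
  obtain ⟨δ, hδ, H⟩ := hg ε hε
  refine ⟨δ, hδ, fun E hE hlen => lt_of_le_of_lt (Finset.sum_le_sum fun i hi => ?_) (H E hE hlen)⟩
  obtain ⟨hE1, -⟩ := hE
  have := hE1 i (by simpa using hi)
  exact h _ this.1 _ this.2

variable {X : Type*} [MetricSpace X]

theorem dist_le_dist_integral {u : ℝ → X} {a b : ℝ} {m : ℝ → ℝ}
    (hm : IntervalIntegrable m volume a b) (hab : a ≤ b)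
    (h : ∀ s ∈ Icc a b, ∀ t ∈ Icc a b, s ≤ t → dist (u s) (u t) ≤ ∫ r in s..t, m r) :
    ∀ s ∈ Icc a b, ∀ t ∈ Icc a b,
      dist (u s) (u t) ≤ dist (∫ r in a..s, m r) (∫ r in a..t, m r) := by
  have sub : ∀ s ∈ Icc a b, ∀ t ∈ Icc a b, IntervalIntegrable m volume s t := fun s hs t ht =>
    hm.mono_set (by rw [uIcc_of_le hab]; exact uIcc_subset_Icc hs ht)
  have key : ∀ s ∈ Icc a b, ∀ t ∈ Icc a b, s ≤ t →
      dist (u s) (u t) ≤ dist (∫ r in a..s, m r) (∫ r in a..t, m r) := by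
    intro s hs t ht hst
    have h1 := intervalIntegral.integral_add_adjacent_intervals
      (sub a (left_mem_Icc.2 hab) s hs) (sub s hs t ht)
    rw [dist_comm (∫ r in a..s, m r), Real.dist_eq, ← h1, add_sub_cancel_left]
    exact (h s hs t ht hst).trans (le_abs_self _)
  intro s hs t ht
  rcases le_total s t with hst | hst
  · exact key s hs t ht hst
  · rw [dist_comm, dist_comm (∫ r in a..s, m r)]; exact key t ht s hs hst

theorem continuousOn_of_dist_le_integral {u : ℝ → X} {a b : ℝ} {m : ℝ → ℝ}
    (hm : IntervalIntegrable m volume a b) (hab : a ≤ b)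
    (h : ∀ s ∈ Icc a b, ∀ t ∈ Icc a b, s ≤ t → dist (u s) (u t) ≤ ∫ r in s..t, m r) :
    ContinuousOn u (Icc a b) := by
  have h1 := (hm.absolutelyContinuousOnInterval_intervalIntegral (c := a) left_mem_uIcc).continuousOn
  rw [uIcc_of_le hab] at h1
  intro s hs
  have h2 := tendsto_iff_dist_tendsto_zero.1 (h1 s hs)
  refine tendsto_iff_dist_tendsto_zero.2 (squeeze_zero' (Eventually.of_forall fun _ => dist_nonneg)
    ?_ h2)
  filter_upwards [self_mem_nhdsWithin] with t ht
  exact dist_le_dist_integral hm hab h t ht s hs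

/-- The metric derivative of an absolutely continuous curve is bounded by every bound `m`. -/
theorem ae_limit_le {u : ℝ → X} {a b : ℝ} {m : ℝ → ℝ}
    (hm : IntervalIntegrable m volume a b) (hab : a ≤ b)
    (h : ∀ s ∈ Icc a b, ∀ t ∈ Icc a b, s ≤ t → dist (u s) (u t) ≤ ∫ r in s..t, m r) :
    ∀ᵐ t, t ∈ Ioo a b → 0 ≤ m t ∧
      (∀ L, Tendsto (fun s => dist (u s) (u t) / |t - s|) (𝓝[≠] t) (𝓝 L) → 0 ≤ L ∧ L ≤ m t) ∧
      ∀ f : ℝ → ℝ, (∀ s ∈ Icc a b, |f s - f t| ≤ dist (u s) (u t)) →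
        DifferentiableAt ℝ f t → |deriv f t| ≤ m t := by
  filter_upwards [hm.ae_hasDerivAt_integral] with t ht htab
  rw [uIcc_of_le hab] at ht
  have htI : t ∈ Icc a b := Ioo_subset_Icc_self htab
  have hd := (ht htI t htI)
  have hslope := (hasDerivAt_iff_tendsto_slope.1 hd).mono_left
    (nhdsWithin_mono t (show Ioi t ⊆ {t}ᶜ from fun s hs => ne_of_gt hs))
  have hmem : ∀ᶠ s in 𝓝[>] t, s ∈ Ioo t b := Ioo_mem_nhdsGT htab.2
  have hle : ∀ᶠ s in 𝓝[>] t, dist (u s) (u t) / |t - s| ≤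
      slope (fun x => ∫ r in t..x, m r) t s := by
    filter_upwards [hmem] with s hs
    have h0 : 0 < s - t := by linarith [hs.1]
    rw [slope_def_field, intervalIntegral.integral_same, sub_zero, abs_sub_comm, abs_of_pos h0,
      dist_comm]
    gcongr
    exact h t htI s ⟨htI.1.trans hs.1.le, hs.2.le⟩ hs.1.le
  have hpos : ∀ s, 0 ≤ dist (u s) (u t) / |t - s| := fun s => by positivity
  refine ⟨ge_of_tendsto hslope (hle.mono fun s hs => (hpos s).trans hs), fun L hL => ?_,
    fun f hf hdf => ?_⟩
  · have hL' := hL.mono_left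
      (nhdsWithin_mono t (show Ioi t ⊆ {t}ᶜ from fun s hs => ne_of_gt hs))
    exact ⟨ge_of_tendsto' hL' hpos, le_of_tendsto_of_tendsto hL' hslope hle⟩
  · have h1 := (hasDerivAt_iff_tendsto_slope.1 hdf.hasDerivAt).abs.mono_left
      (nhdsWithin_mono t (show Ioi t ⊆ {t}ᶜ from fun s hs => ne_of_gt hs))
    refine le_of_tendsto_of_tendsto h1 hslope ?_
    filter_upwards [hle, hmem] with s hs hs'
    refine le_trans ?_ hs
    rw [slope_def_field, abs_div, abs_sub_comm t s]
    gcongr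
    exact hf s ⟨htI.1.trans hs'.1.le, hs'.2.le⟩

/-- Existence of the metric derivative almost everywhere. -/
theorem exists_speed_Icc {u : ℝ → X} {a b : ℝ} {m : ℝ → ℝ}
    (hm : IntervalIntegrable m volume a b) (hab : a < b)
    (h : ∀ s ∈ Icc a b, ∀ t ∈ Icc a b, s ≤ t → dist (u s) (u t) ≤ ∫ r in s..t, m r) :
    ∃ S : ℝ → ℝ, Measurable S ∧ IntervalIntegrable S volume a b ∧
      (∀ᵐ t, t ∈ Ioo a b →
        Tendsto (fun s => dist (u s) (u t) / |t - s|) (𝓝[≠] t) (𝓝 (S t))) ∧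
      ∀ s ∈ Icc a b, ∀ t ∈ Icc a b, s ≤ t → dist (u s) (u t) ≤ ∫ r in s..t, S r := by
  have hcont := continuousOn_of_dist_le_integral hm hab.le h
  have : Nonempty (Icc a b) := ⟨⟨a, left_mem_Icc.2 hab.le⟩⟩
  -- The distances to countably many points of the curve are real absolutely continuous functions;
  -- the supremum of their |derivatives| is the speed.
  let q : ℕ → Icc a b := TopologicalSpace.denseSeq (Icc a b)
  let g : ℕ → ℝ → ℝ := fun n t => dist (u t) (u (q n))
  have hgl : ∀ n s t, |g n s - g n t| ≤ dist (u s) (u t) := fun n s t =>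
    abs_dist_sub_le _ _ _
  have hgac : ∀ n, AbsolutelyContinuousOnInterval (g n) a b := fun n =>
    absolutelyContinuousOnInterval_of_dist_le
      (hm.absolutelyContinuousOnInterval_intervalIntegral (c := a) left_mem_uIcc)
      (by
        rw [uIcc_of_le hab.le]
        intro s hs t ht
        rw [Real.dist_eq]
        exact (hgl n s t).trans (dist_le_dist_integral hm hab.le h s hs t ht))
  let S : ℝ → ℝ := fun t => ⨆ n, |deriv (g n) t|
  have hSm : Measurable S := Measurable.iSup fun n => (measurable_deriv (g n)).norm
  have hbd : ∀ᵐ t, t ∈ Ioo a b → 0 ≤ m t ∧ ∀ n, |deriv (g n) t| ≤ m t := by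
    have h1 : ∀ᵐ t, ∀ n, t ∈ uIcc a b → DifferentiableAt ℝ (g n) t :=
      ae_all_iff.2 fun n => (hgac n).ae_differentiableAt
    filter_upwards [h1, ae_limit_le hm hab.le h] with t ht1 ht2 htab
    obtain ⟨hm0, -, h3⟩ := ht2 htab
    refine ⟨hm0, fun n => h3 _ (fun s _ => hgl n s t) (ht1 n ?_)⟩
    rw [uIcc_of_le hab.le]; exact Ioo_subset_Icc_self htab
  have hS0 : ∀ t, 0 ≤ S t := fun t => Real.iSup_nonneg fun n => abs_nonneg _
  have hSi : IntervalIntegrable S volume a b := by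
    refine hm.mono_fun hSm.aestronglyMeasurable ?_
    rw [uIoc_of_le hab.le, ← restrict_Ioo_eq_restrict_Ioc]
    refine (ae_restrict_iff' measurableSet_Ioo).2 ?_
    filter_upwards [hbd] with t ht htab
    rw [Real.norm_of_nonneg (hS0 t), Real.norm_of_nonneg (ht htab).1]
    exact ciSup_le (ht htab).2
  have sub : ∀ {f : ℝ → ℝ}, IntervalIntegrable f volume a b → ∀ s ∈ Icc a b, ∀ t ∈ Icc a b,
      IntervalIntegrable f volume s t := fun hf s hs t ht =>
    hf.mono_set (by rw [uIcc_of_le hab.le]; exact uIcc_subset_Icc hs ht)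
  have hgS : ∀ n, ∀ s ∈ Icc a b, ∀ t ∈ Icc a b, s ≤ t → |g n t - g n s| ≤ ∫ r in s..t, S r := by
    intro n s hs t ht hst
    have hac : AbsolutelyContinuousOnInterval (g n) s t :=
      (hgac n).mono (by rw [uIcc_of_le hab.le]; exact uIcc_subset_Icc hs ht)
    rw [← hac.integral_deriv_eq_sub]
    refine (intervalIntegral.abs_integral_le_integral_abs hst).trans ?_
    refine intervalIntegral.integral_mono_ae_restrict hst hac.intervalIntegrable_deriv.abs
      (sub hSi s hs t ht) ?_
    rw [← restrict_Ioo_eq_restrict_Icc]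
    refine (ae_restrict_iff' measurableSet_Ioo).2 ?_
    filter_upwards [hbd] with r hr hrst
    exact le_ciSup (f := fun n => |deriv (g n) r|)
      ⟨m r, forall_mem_range.2 (hr ⟨hs.1.trans_lt hrst.1, hrst.2.trans_le ht.2⟩).2⟩ n
  have hdist : ∀ s ∈ Icc a b, ∀ t ∈ Icc a b, s ≤ t → dist (u s) (u t) ≤ ∫ r in s..t, S r := by
    intro s hs t ht hst
    refine le_of_forall_pos_le_add fun ε hε => ?_
    have hc : ContinuousWithinAt u (Icc a b) s := hcont s hs
    -- With `q n` close to `s`, `g n` is small at `s` and nearly `dist (u s) (u t)` at `t`, so its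
    -- increment recovers the distance.
    obtain ⟨δ, hδ, hδ'⟩ := Metric.continuousWithinAt_iff.1 hc (ε / 2) (by positivity)
    obtain ⟨n, hn⟩ := (TopologicalSpace.denseRange_denseSeq (Icc a b)).exists_dist_lt ⟨s, hs⟩ hδ
    have h2 : dist (u (q n)) (u s) < ε / 2 := hδ' (q n).2 (by rw [dist_comm]; exact hn)
    have h3 := hgS n s hs t ht hst
    have h4 : dist (u s) (u t) ≤ dist (u (q n)) (u s) + dist (u t) (u (q n)) := by
      rw [dist_comm (u (q n)) (u s), dist_comm (u t)]; exact dist_triangle _ _ _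
    have h5 := (abs_le.1 h3).2
    have h6 : g n s = dist (u (q n)) (u s) := dist_comm _ _
    have h7 : g n t = dist (u t) (u (q n)) := rfl
    linarith
  refine ⟨S, hSm, hSi, ?_, hdist⟩
  have h1 : ∀ᵐ t, ∀ n, t ∈ uIcc a b → DifferentiableAt ℝ (g n) t :=
      ae_all_iff.2 fun n => (hgac n).ae_differentiableAt
  filter_upwards [h1, hSi.ae_hasDerivAt_integral] with t ht1 ht2 htab
  rw [uIcc_of_le hab.le] at ht1 ht2
  have htI := Ioo_subset_Icc_self htab
  have hmem : ∀ᶠ s in 𝓝[≠] t, s ∈ Icc a b := nhdsWithin_le_nhds (Icc_mem_nhds htab.1 htab.2)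
  have hne : ∀ᶠ s in 𝓝[≠] t, s ≠ t := self_mem_nhdsWithin
  -- The quotient is bounded below by those of each `g n`, and above by those of the primitive of
  -- `S`, at a Lebesgue point of `S`.
  refine tendsto_order.2 ⟨fun c hc => ?_, fun c hc => ?_⟩
  · obtain ⟨n, hn⟩ := exists_lt_of_lt_ciSup hc
    have h2 := (hasDerivAt_iff_tendsto_slope.1 (ht1 n htI).hasDerivAt).abs
    filter_upwards [(tendsto_order.1 h2).1 c hn] with s hs
    refine hs.trans_le ?_
    rw [slope_def_field, abs_div, abs_sub_comm t s]
    gcongr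
    exact hgl n s t
  · have h2 := (hasDerivAt_iff_tendsto_slope.1 (ht2 htI a (left_mem_Icc.2 hab.le))).abs
    rw [abs_of_nonneg (hS0 t)] at h2
    filter_upwards [(tendsto_order.1 h2).2 c hc, hmem] with s hs hsI
    refine lt_of_le_of_lt ?_ hs
    rw [slope_def_field, abs_div, abs_sub_comm t s]
    gcongr
    exact dist_le_dist_integral hSi hab.le hdist s hsI t htI

/-- The speed of a curve in `AC²_loc([0,∞); X)`. -/
theorem exists_speed {u : ℝ → X} (hu : IsACLoc 2 (Ici 0) u) :
    ∃ y : ℝ → ℝ, Measurable y ∧ (∀ t, 0 ≤ y t) ∧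
      (∀ᵐ t ∂(volume.restrict (Ioi (0 : ℝ))), metricDeriv u t = y t) ∧
      (∀ T, MemLp y 2 (volume.restrict (Icc 0 T))) ∧
      ∀ s t, 0 ≤ s → s ≤ t → dist (u s) (u t) ≤ ∫ r in s..t, y r := by
  have hN : ∀ n : ℕ, ∃ m S : ℝ → ℝ, MemLp m 2 (volume.restrict (Icc 0 (n + 1 : ℝ))) ∧
      IntervalIntegrable m volume 0 (n + 1 : ℝ) ∧
      (∀ s ∈ Icc (0 : ℝ) (n + 1 : ℝ), ∀ t ∈ Icc (0 : ℝ) (n + 1 : ℝ), s ≤ t →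
        dist (u s) (u t) ≤ ∫ r in s..t, m r) ∧ Measurable S ∧
      IntervalIntegrable S volume 0 (n + 1 : ℝ) ∧
      (∀ᵐ t, t ∈ Ioo 0 (n + 1 : ℝ) →
        Tendsto (fun s => dist (u s) (u t) / |t - s|) (𝓝[≠] t) (𝓝 (S t))) ∧
      ∀ s ∈ Icc (0 : ℝ) (n + 1 : ℝ), ∀ t ∈ Icc (0 : ℝ) (n + 1 : ℝ), s ≤ t →
        dist (u s) (u t) ≤ ∫ r in s..t, S r := by
    intro n
    have hn : (0 : ℝ) < n + 1 := by positivity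
    obtain ⟨m, hm, h⟩ := hu 0 (n + 1) hn.le Icc_subset_Ici_self
    have hmi : IntervalIntegrable m volume 0 (n + 1 : ℝ) := by
      rw [intervalIntegrable_iff_integrableOn_Icc_of_le hn.le]
      exact hm.integrable (by norm_num)
    obtain ⟨S, h1, h2, h3, h4⟩ := exists_speed_Icc hmi hn h
    exact ⟨m, S, hm, hmi, h, h1, h2, h3, h4⟩
  choose m S hm hmi hmd hSm hSi hSt hSd using hN
  have hcover : Ioi (0 : ℝ) = ⋃ n : ℕ, Ioo (0 : ℝ) (n + 1 : ℝ) := by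
    ext t
    simp only [mem_Ioi, mem_iUnion, mem_Ioo, exists_and_left, iff_self_and]
    intro _
    obtain ⟨n, hn⟩ := exists_nat_gt t
    exact ⟨n, by linarith⟩
  have hmeas : AEMeasurable (metricDeriv u) (volume.restrict (Ioi 0)) := by
    rw [hcover, aemeasurable_iUnion_iff]
    intro n
    refine ⟨S n, hSm n, ?_⟩
    refine (ae_restrict_iff' measurableSet_Ioo).2 ?_
    filter_upwards [hSt n] with t ht htab
    exact (ht htab).limUnder_eq
  -- `metricDeriv` is arbitrary where the limit fails to exist, hence a Borel representative,
  -- truncated so as to be nonnegative everywhere.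
  set y : ℝ → ℝ := fun t => max 0 (hmeas.mk _ t) with hy
  have hym : Measurable y := measurable_const.max hmeas.measurable_mk
  have hyS : ∀ n : ℕ, ∀ᵐ t ∂(volume.restrict (Ioo 0 (n + 1 : ℝ))),
      y t = S n t ∧ metricDeriv u t = S n t ∧ S n t ≤ m n t := by
    intro n
    have h1 : ∀ᵐ t ∂(volume.restrict (Ioo 0 (n + 1 : ℝ))), metricDeriv u t = hmeas.mk _ t :=
      ae_restrict_of_ae_restrict_of_subset Ioo_subset_Ioi_self hmeas.ae_eq_mk
    refine (ae_restrict_iff' measurableSet_Ioo).2 ?_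
    filter_upwards [(ae_restrict_iff' measurableSet_Ioo).1 h1, hSt n,
      ae_limit_le (hmi n) (by positivity) (hmd n)] with t ht1 ht2 ht3 htab
    have h2 : metricDeriv u t = S n t := (ht2 htab).limUnder_eq
    obtain ⟨h3, h4⟩ := (ht3 htab).2.1 _ (ht2 htab)
    refine ⟨?_, h2, h4⟩
    rw [hy]
    simp only
    rw [← ht1 htab, h2, max_eq_right h3]
  refine ⟨y, hym, fun t => le_max_left _ _, ?_, fun T => ?_, fun s t hs hst => ?_⟩
  · rw [hcover, ae_restrict_iUnion_iff]
    intro n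
    filter_upwards [hyS n] with t ht
    rw [ht.1, ht.2.1]
  · obtain ⟨n, hn⟩ := exists_nat_gt T
    have h1 : MemLp y 2 (volume.restrict (Icc 0 (n + 1 : ℝ))) := by
      refine (hm n).mono hym.aestronglyMeasurable ?_
      rw [← restrict_Ioo_eq_restrict_Icc]
      filter_upwards [hyS n] with t ht
      rw [Real.norm_of_nonneg (le_max_left _ _)]
      exact (ht.1.le.trans ht.2.2).trans (le_abs_self _)
    exact h1.mono_measure (Measure.restrict_mono (Icc_subset_Icc_right (by linarith)) le_rfl)
  · obtain ⟨n, hn⟩ := exists_nat_gt t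
    refine (hSd n s ⟨hs, by linarith⟩ t ⟨hs.trans hst, by linarith⟩ hst).trans_eq ?_
    refine intervalIntegral.integral_congr_ae_restrict ?_
    rw [uIoc_of_le hst, ← restrict_Ioo_eq_restrict_Ioc]
    refine ae_restrict_of_ae_restrict_of_subset (t := Ioo 0 (n + 1 : ℝ))
      (Ioo_subset_Ioo hs (by linarith)) ?_
    filter_upwards [hyS n] with t ht
    exact ht.1.symm

theorem intervalIntegrable_of_memLp_two {M : ℝ → ℝ}
    (hM : ∀ T, MemLp M 2 (volume.restrict (Icc 0 T))) {s t : ℝ} (hs : 0 ≤ s) (ht : 0 ≤ t) :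
    IntervalIntegrable M volume s t := by
  have h1 : IntegrableOn M (Icc 0 (max s t)) := (hM (max s t)).integrable (by norm_num)
  refine IntegrableOn.intervalIntegrable (h1.mono_set ?_)
  exact uIcc_subset_Icc ⟨hs, le_max_left _ _⟩ ⟨ht, le_max_right _ _⟩

/-- A curve with a locally square integrable bound on its increments is in `AC²_loc`, and its
metric derivative is controlled by that bound. -/
theorem isACLoc_of_dist_le {v : ℝ → X} {M : ℝ → ℝ}
    (hM : ∀ T, MemLp M 2 (volume.restrict (Icc 0 T)))
    (h : ∀ s t, 0 ≤ s → s ≤ t → dist (v s) (v t) ≤ ∫ r in s..t, M r) :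
    IsACLoc 2 (Ici 0) v ∧
      ∀ᵐ t ∂(volume.restrict (Ioi (0 : ℝ))), 0 ≤ metricDeriv v t ∧ metricDeriv v t ≤ M t := by
  constructor
  · intro a b hab hsub
    have ha : (0 : ℝ) ≤ a := hsub (left_mem_Icc.2 hab)
    exact ⟨M, (hM b).mono_measure (Measure.restrict_mono (Icc_subset_Icc_left ha) le_rfl),
      fun s hs t _ hst => h s t (ha.trans hs.1) hst⟩
  · have hcover : Ioi (0 : ℝ) = ⋃ n : ℕ, Ioo (0 : ℝ) (n + 1 : ℝ) := by
      ext t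
      simp only [mem_Ioi, mem_iUnion, mem_Ioo, exists_and_left, iff_self_and]
      intro _
      obtain ⟨n, hn⟩ := exists_nat_gt t
      exact ⟨n, by linarith⟩
    rw [hcover, ae_restrict_iUnion_iff]
    intro n
    have hn : (0 : ℝ) < n + 1 := by positivity
    have hi : IntervalIntegrable M volume 0 (n + 1) :=
      intervalIntegrable_of_memLp_two hM le_rfl hn.le
    have h' : ∀ s ∈ Icc (0 : ℝ) (n + 1), ∀ t ∈ Icc (0 : ℝ) (n + 1), s ≤ t →
      dist (v s) (v t) ≤ ∫ r in s..t, M r := fun s hs t _ hst => h s t hs.1 hst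
    obtain ⟨S, -, -, hS, -⟩ := exists_speed_Icc hi hn h'
    refine (ae_restrict_iff' measurableSet_Ioo).2 ?_
    filter_upwards [hS, ae_limit_le hi hn.le h'] with t ht1 ht2 htab
    have h2 : metricDeriv v t = S t := (ht1 htab).limUnder_eq
    rw [h2]
    exact (ht2 htab).2.1 _ (ht1 htab)

end WED

namespace WED

/-! ### Extended integrals and the exponential weight -/

theorem extIntegral_mono_ae {μ : Measure ℝ} {f g : ℝ → EReal} (h : ∀ᵐ t ∂μ, f t ≤ g t) :
    extIntegral μ f ≤ extIntegral μ g := by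
  refine EReal.sub_le_sub ?_ ?_
  · refine EReal.coe_ennreal_le_coe_ennreal_iff.2 (lintegral_mono_ae ?_)
    filter_upwards [h] with t ht using EReal.toENNReal_le_toENNReal ht
  · refine EReal.coe_ennreal_le_coe_ennreal_iff.2 (lintegral_mono_ae ?_)
    filter_upwards [h] with t ht using EReal.toENNReal_le_toENNReal (EReal.neg_le_neg_iff.2 ht)

theorem extIntegral_congr_ae {μ : Measure ℝ} {f g : ℝ → EReal} (h : ∀ᵐ t ∂μ, f t = g t) :
    extIntegral μ f = extIntegral μ g :=
  le_antisymm (extIntegral_mono_ae (h.mono fun _ ht => ht.le))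
    (extIntegral_mono_ae (h.mono fun _ ht => ht.ge))

theorem extIntegral_coe {μ : Measure ℝ} {g : ℝ → ℝ} (hg : Integrable g μ) :
    extIntegral μ (fun t => (g t : EReal)) = ((∫ t, g t ∂μ : ℝ) : EReal) := by
  have h1 : ∫⁻ t, ENNReal.ofReal (g t) ∂μ ≠ ⊤ := by
    refine ((lintegral_mono fun t => ?_).trans_lt hg.2).ne
    exact Real.ofReal_le_enorm _
  have h2 : ∫⁻ t, ENNReal.ofReal (-g t) ∂μ ≠ ⊤ := by
    refine ((lintegral_mono fun t => ?_).trans_lt hg.neg.2).ne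
    exact Real.ofReal_le_enorm _
  rw [integral_eq_lintegral_pos_part_sub_lintegral_neg_part hg, EReal.coe_sub]
  unfold extIntegral
  rw [EReal.coe_ennreal_toReal h1, EReal.coe_ennreal_toReal h2]
  rfl

theorem measurable_expDensity (ε : ℝ) :
    Measurable fun t : ℝ => ENNReal.ofReal (Real.exp (-t / ε) / ε) := by
  fun_prop

theorem integrable_expWeight_iff {ε : ℝ} (hε : 0 < ε) {g : ℝ → ℝ} :
    Integrable g (expWeight ε) ↔ IntegrableOn (fun t => g t * Real.exp (-t / ε)) (Ioi 0) := by
  unfold expWeight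
  rw [integrable_withDensity_iff_integrable_smul' (measurable_expDensity ε)
    (Eventually.of_forall fun _ => ENNReal.ofReal_lt_top)]
  have h : ∀ t, (ENNReal.ofReal (Real.exp (-t / ε) / ε)).toReal • g t =
      ε⁻¹ * (g t * Real.exp (-t / ε)) := fun t => by
    rw [ENNReal.toReal_ofReal (by positivity), smul_eq_mul]; ring
  simp_rw [h]
  exact integrable_const_mul_iff (IsUnit.mk0 _ (inv_pos.2 hε).ne') _

theorem integral_expWeight {ε : ℝ} (hε : 0 < ε) (g : ℝ → ℝ) :
    ∫ t, g t ∂(expWeight ε) = ε⁻¹ * ∫ t in Ioi 0, g t * Real.exp (-t / ε) := by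
  unfold expWeight
  rw [integral_withDensity_eq_integral_toReal_smul (measurable_expDensity ε)
    (Eventually.of_forall fun _ => ENNReal.ofReal_lt_top), ← integral_const_mul]
  congr 1
  ext t
  rw [ENNReal.toReal_ofReal (by positivity), smul_eq_mul]; ring

theorem ae_expWeight_iff {ε : ℝ} (hε : 0 < ε) {P : ℝ → Prop} :
    (∀ᵐ t ∂(expWeight ε), P t) ↔ ∀ᵐ t ∂(volume.restrict (Ioi (0 : ℝ))), P t := by
  unfold expWeight
  constructor
  · refine fun h => (withDensity_absolutelyContinuous' (measurable_expDensity ε).aemeasurable ?_) h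
    refine Eventually.of_forall fun t => ?_
    simp only [ne_eq, ENNReal.ofReal_eq_zero, not_le]
    positivity
  · exact fun h => (withDensity_absolutelyContinuous _ _) h

theorem integrableOn_exp_neg_div {ε : ℝ} (hε : 0 < ε) :
    IntegrableOn (fun t : ℝ => Real.exp (-t / ε)) (Ioi 0) := by
  have := exp_neg_integrableOn_Ioi 0 (inv_pos.2 hε)
  refine this.congr_fun (fun t _ => ?_) measurableSet_Ioi
  simp only
  congr 1
  field_simp

/-! ### A weighted Hardy inequality -/

/-- Integrate the derivative of l² exp(-t/ε) over [0,T]: the result is nonnegative because l(0) = 0,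
and Young's inequality absorbs the cross term 2ly. This bounds ∫ l² exp(-t/ε) by 4ε² ∫ y² exp(-t/ε),
uniformly in T. It serves to integrate the quadratic lower bound on φ along the curve. -/
theorem integrableOn_sq_integral_mul_exp {ε : ℝ} (hε : 0 < ε) {y : ℝ → ℝ}
    (hy : ∀ T, MemLp y 2 (volume.restrict (Icc 0 T)))
    (hyi : IntegrableOn (fun t => y t ^ 2 * Real.exp (-t / ε)) (Ioi 0)) :
    IntegrableOn (fun t => (∫ r in (0 : ℝ)..t, y r) ^ 2 * Real.exp (-t / ε)) (Ioi 0) := by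
  set l : ℝ → ℝ := fun t => ∫ r in (0 : ℝ)..t, y r with hl
  have hyI : ∀ T, 0 ≤ T → IntervalIntegrable y volume 0 T := fun T hT =>
    intervalIntegrable_of_memLp_two hy le_rfl hT
  have hlc : ∀ T, 0 ≤ T → AbsolutelyContinuousOnInterval l 0 T := fun T hT =>
    (hyI T hT).absolutelyContinuousOnInterval_intervalIntegral left_mem_uIcc
  have hpd : ∀ t, HasDerivAt (fun t : ℝ => Real.exp (-t / ε)) (Real.exp (-t / ε) * (-1 / ε)) t :=
    fun t => ((hasDerivAt_id t).neg.div_const ε).exp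
  have hpc : Continuous fun t : ℝ => Real.exp (-t / ε) := by fun_prop
  have hpac : ∀ T, AbsolutelyContinuousOnInterval (fun t : ℝ => Real.exp (-t / ε)) 0 T := fun T =>
    ContDiffOn.absolutelyContinuousOnInterval (by
      have : ContDiff ℝ 1 fun t : ℝ => Real.exp (-t / ε) := by fun_prop
      exact this.contDiffOn)
  have hfi : ∀ T, 0 ≤ T → IntervalIntegrable (fun t => l t ^ 2 * Real.exp (-t / ε)) volume 0 T :=
    fun T hT => (((hlc T hT).continuousOn.pow 2).mul hpc.continuousOn).intervalIntegrable
  have hgi : ∀ T, 0 ≤ T → IntervalIntegrable (fun t => y t ^ 2 * Real.exp (-t / ε)) volume 0 T :=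
    fun T hT => (intervalIntegrable_iff_integrableOn_Ioc_of_le hT).2
      (hyi.mono_set Ioc_subset_Ioi_self)
  have key : ∀ T, 0 ≤ T → ∫ t in (0 : ℝ)..T, l t ^ 2 * Real.exp (-t / ε) ≤
      4 * ε ^ 2 * ∫ t in Ioi (0 : ℝ), y t ^ 2 * Real.exp (-t / ε) := by
    intro T hT
    have hac : AbsolutelyContinuousOnInterval (fun t => l t ^ 2 * Real.exp (-t / ε)) 0 T := by
      have := ((hlc T hT).mul (hlc T hT)).mul (hpac T)
      convert! this using 1
      ext t; simp [sq]
    have h1 := hac.integral_deriv_eq_sub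
    have h0 : l 0 = 0 := by simp [hl]
    have h2 : 0 ≤ ∫ t in (0 : ℝ)..T, deriv (fun t => l t ^ 2 * Real.exp (-t / ε)) t := by
      rw [h1, h0]
      have : 0 ≤ l T ^ 2 * Real.exp (-T / ε) := by positivity
      simpa using this
    have h3 : ∫ t in (0 : ℝ)..T, deriv (fun t => l t ^ 2 * Real.exp (-t / ε)) t ≤
        ∫ t in (0 : ℝ)..T, (2 * ε * (y t ^ 2 * Real.exp (-t / ε)) -
          1 / (2 * ε) * (l t ^ 2 * Real.exp (-t / ε))) := by
      refine intervalIntegral.integral_mono_ae_restrict hT hac.intervalIntegrable_deriv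
        (((hgi T hT).const_mul _).sub ((hfi T hT).const_mul _)) ?_
      refine (ae_restrict_iff' measurableSet_Icc).2 ?_
      filter_upwards [(hyI T hT).ae_hasDerivAt_integral] with t ht htI
      rw [uIcc_of_le hT] at ht
      have hd : HasDerivAt l (y t) t := ht htI 0 (left_mem_Icc.2 hT)
      have hd2 := (hd.pow 2).mul (hpd t)
      have h4 : deriv (fun t => l t ^ 2 * Real.exp (-t / ε)) t =
          (2 * l t * y t - l t ^ 2 / ε) * Real.exp (-t / ε) := by
        refine hd2.deriv.trans ?_
        simp
        ring
      rw [h4]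
      -- The Young weight is chosen so that exactly half of the good term l²/ε survives.
      have h5 : 2 * l t * y t - l t ^ 2 / ε ≤ 2 * ε * y t ^ 2 - 1 / (2 * ε) * l t ^ 2 := by
        have h6 : 2 * ε * y t ^ 2 - 1 / (2 * ε) * l t ^ 2 - (2 * l t * y t - l t ^ 2 / ε) =
            (2 * ε * y t - l t) ^ 2 / (2 * ε) := by
          field_simp
          ring
        have h7 : 0 ≤ (2 * ε * y t - l t) ^ 2 / (2 * ε) := by positivity
        linarith
      have h8 := mul_le_mul_of_nonneg_right h5 (Real.exp_pos (-t / ε)).le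
      linarith
    rw [intervalIntegral.integral_sub ((hgi T hT).const_mul _) ((hfi T hT).const_mul _),
      intervalIntegral.integral_const_mul, intervalIntegral.integral_const_mul] at h3
    have h4 : ∫ t in (0 : ℝ)..T, y t ^ 2 * Real.exp (-t / ε) ≤
        ∫ t in Ioi (0 : ℝ), y t ^ 2 * Real.exp (-t / ε) := by
      rw [intervalIntegral.integral_of_le hT]
      exact setIntegral_mono_set hyi (Eventually.of_forall fun t => by positivity)
        (Eventually.of_forall fun t ht => Ioc_subset_Ioi_self ht)
    have h5 := h2.trans h3
    set A := ∫ t in (0 : ℝ)..T, l t ^ 2 * Real.exp (-t / ε)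
    set C := ∫ t in (0 : ℝ)..T, y t ^ 2 * Real.exp (-t / ε)
    have h6 : A = 2 * ε * (1 / (2 * ε) * A) := by field_simp
    have h7 : 2 * ε * (1 / (2 * ε) * A) ≤ 2 * ε * (2 * ε * C) :=
      mul_le_mul_of_nonneg_left (by linarith) (by positivity)
    clear_value A C
    calc A ≤ 4 * ε ^ 2 * C := by linarith [h6.trans_le h7, show 2 * ε * (2 * ε * C) = 4 * ε ^ 2 * C by ring]
      _ ≤ _ := by gcongr
  refine integrableOn_Ioi_of_intervalIntegral_norm_bounded (l := atTop) (b := fun n : ℕ => (n : ℝ))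
    (4 * ε ^ 2 * ∫ t in Ioi (0 : ℝ), y t ^ 2 * Real.exp (-t / ε)) 0 (fun n => ?_)
    tendsto_natCast_atTop_atTop (Eventually.of_forall fun n => ?_)
  · exact (intervalIntegrable_iff_integrableOn_Ioc_of_le n.cast_nonneg).1 (hfi n n.cast_nonneg)
  · refine (intervalIntegral.integral_congr fun t _ => ?_).trans_le (key n n.cast_nonneg)
    exact Real.norm_of_nonneg (by positivity)

/-! ### Semicontinuity along curves -/

variable {X : Type*} [MetricSpace X]

/-- Metric convergence implies σ-convergence: the distance to the neighbourhood `V` given by the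
thickening property is at most the distance to `x` itself. -/
theorem LSCC.le_liminf {σ : TopologicalSpace X} {φ : X → EReal} (hφ : LSCC σ φ)
    (hσ : Compatible σ) {v : ℕ → X} {x : X} (hv : Tendsto (fun n => dist (v n) x) atTop (𝓝 0))
    (hb : ∃ C : ℝ, ∀ n m, dist (v n) (v m) ≤ C) :
    φ x ≤ liminf (fun n => φ (v n)) atTop := by
  refine hφ.lsc v x hb fun U hU => ?_
  obtain ⟨W, hWU, hW, hx⟩ := mem_nhds_iff.1 hU
  obtain ⟨V, -, hxV, δ, hδ, h⟩ := hσ.thickening W hW x hx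
  refine mem_map.2 ?_
  filter_upwards [(tendsto_order.1 hv).2 δ hδ] with n hn
  exact hWU (h _ ((Metric.infDist_le_dist_of_mem hxV).trans_lt hn))

/-- Stated without σ, so that the only topology in scope is the metric one. -/
theorem lowerSemicontinuous_of_le_liminf {φ : X → EReal}
    (h : ∀ (v : ℕ → X) (x : X), Tendsto (fun n => dist (v n) x) atTop (𝓝 0) →
      (∃ C : ℝ, ∀ n m, dist (v n) (v m) ≤ C) → φ x ≤ liminf (fun n => φ (v n)) atTop) :
    LowerSemicontinuous φ := by
  intro x c hc
  by_contra hcon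
  obtain ⟨v, hv, hvc⟩ := exists_seq_forall_of_frequently (not_eventually.1 hcon)
  obtain ⟨C, hC⟩ := Metric.isBounded_iff.1 (Metric.isBounded_range_of_tendsto v hv)
  have h1 := h v x (tendsto_iff_dist_tendsto_zero.1 hv)
    ⟨C, fun n m => hC (mem_range_self n) (mem_range_self m)⟩
  have h2 : liminf (fun n => φ (v n)) atTop ≤ c := by
    refine liminf_le_of_le ?_ ?_
    · isBoundedDefault
    · intro b hb
      obtain ⟨n, hn⟩ := hb.exists
      exact hn.trans (not_lt.1 (hvc n))
  exact absurd (h1.trans h2) (not_le.2 hc)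

theorem continuousOn_Ici_of_dist_le {u : ℝ → X} {y : ℝ → ℝ}
    (hy : ∀ T, MemLp y 2 (volume.restrict (Icc 0 T)))
    (h : ∀ s t, 0 ≤ s → s ≤ t → dist (u s) (u t) ≤ ∫ r in s..t, y r) :
    ContinuousOn u (Ici 0) := by
  intro t ht
  have ht' : (0 : ℝ) ≤ t + 1 := by have : (0 : ℝ) ≤ t := ht; linarith
  have h1 := continuousOn_of_dist_le_integral (u := u)
    (intervalIntegrable_of_memLp_two hy le_rfl ht') ht' (fun s hs r _ hsr => h s r hs.1 hsr)
    t ⟨ht, by linarith⟩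
  refine h1.mono_of_mem_nhdsWithin ?_
  filter_upwards [self_mem_nhdsWithin, nhdsWithin_le_nhds (Iio_mem_nhds (lt_add_one t))] with s hs hs'
  exact ⟨hs, hs'.le⟩

/-! ### Minimizers -/

/-- The properties of a minimizer `u` of the weighted energy-dissipation functional on which the
regularity theory rests; `y` is a Borel representative of the speed `|u'|`. -/
structure WedMinimizer (φ : X → EReal) (ε : ℝ) (u : ℝ → X) (y : ℝ → ℝ) : Prop where
  eps_pos : 0 < ε
  lsc : LowerSemicontinuous φ
  ne_bot : ∀ x, φ x ≠ ⊥
  meas : Measurable y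
  nonneg : ∀ t, 0 ≤ y t
  ae_eq : ∀ᵐ t ∂(volume.restrict (Ioi (0 : ℝ))), metricDeriv u t = y t
  memLp : ∀ T, MemLp y 2 (volume.restrict (Icc 0 T))
  dist_le : ∀ s t, 0 ≤ s → s ≤ t → dist (u s) (u t) ≤ ∫ r in s..t, y r
  ae_lt_top : ∀ᵐ t ∂(volume.restrict (Ioi (0 : ℝ))), φ (u t) < ⊤
  int_speed : IntegrableOn (fun t => y t ^ 2 * Real.exp (-t / ε)) (Ioi 0)
  int_energy : IntegrableOn (fun t => (φ (u t)).toReal * Real.exp (-t / ε)) (Ioi 0)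
  minimal : ∀ (v : ℝ → X) (M Φ : ℝ → ℝ), v 0 = u 0 →
    (∀ T, MemLp M 2 (volume.restrict (Icc 0 T))) →
    (∀ s t, 0 ≤ s → s ≤ t → dist (v s) (v t) ≤ ∫ r in s..t, M r) →
    (∀ᵐ t ∂(volume.restrict (Ioi (0 : ℝ))), φ (v t) ≤ (Φ t : EReal)) →
    IntegrableOn (fun t => M t ^ 2 * Real.exp (-t / ε)) (Ioi 0) →
    IntegrableOn (fun t => Φ t * Real.exp (-t / ε)) (Ioi 0) →
    ∫ t in Ioi 0, (ε / 2 * y t ^ 2 + (φ (u t)).toReal) * Real.exp (-t / ε) ≤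
      ∫ t in Ioi 0, (ε / 2 * M t ^ 2 + Φ t) * Real.exp (-t / ε)

theorem LSCC.lowerSemicontinuous {σ : TopologicalSpace X} {φ : X → EReal} (hφ : LSCC σ φ)
    (hσ : Compatible σ) :
    @LowerSemicontinuous X EReal UniformSpace.toTopologicalSpace _ φ :=
  lowerSemicontinuous_of_le_liminf fun _ _ hv hb => hφ.le_liminf hσ hv hb

theorem exists_wedMinimizer {φ : X → EReal} (hlsc : LowerSemicontinuous φ)
    (hbot : ∀ x, φ x ≠ ⊥)
    (hcoer : ∃ (x₀ : X) (A B : ℝ), 0 ≤ A ∧ 0 ≤ B ∧ ∀ u v : X,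
      ((-(B * dist u v ^ 2) - (B * dist v x₀ ^ 2 + A) : ℝ) : EReal) ≤ φ u)
    {ε : ℝ} (hε : 0 < ε) {x : X} {u : ℝ → X} (hu : u ∈ minimizers φ ε x) :
    ∃ y, WedMinimizer φ ε u y := by
  obtain ⟨⟨hac, hux, hfin⟩, hwed, hmin⟩ := hu
  obtain ⟨y, hym, hy0, hyae, hyL, hyd⟩ := exists_speed hac
  have hyae' : ∀ᵐ t ∂(expWeight ε), metricDeriv u t = y t := (ae_expWeight_iff hε).2 hyae
  have hyi' : Integrable (fun t => y t ^ 2) (expWeight ε) := by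
    refine ⟨(hym.pow_const 2).aestronglyMeasurable, ?_⟩
    refine lt_of_le_of_lt (le_of_eq (lintegral_congr_ae ?_)) hfin
    filter_upwards [hyae'] with t ht
    rw [ht, Real.enorm_of_nonneg (by positivity)]
  have hyi := (integrable_expWeight_iff hε).1 hyi'
  have hcont := continuousOn_Ici_of_dist_le hyL hyd
  -- The curve is controlled on [0,∞) only; freezing it at negative times makes the composition
  -- lower semicontinuous on the whole line.
  have hφm : Measurable fun t => φ (u (max t 0)) := by
    have hc : Continuous fun t => u (max t 0) :=
      hcont.comp_continuous (by fun_prop) fun t => mem_Ici.2 (le_max_right t 0)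
    refine LowerSemicontinuous.measurable fun t c h => ?_
    exact hc.continuousAt.eventually (hlsc _ c h)
  have hφae : ∀ᵐ t ∂(expWeight ε), φ (u (max t 0)) = φ (u t) := by
    refine (ae_expWeight_iff hε).2 ((ae_restrict_iff' measurableSet_Ioi).2 ?_)
    refine Eventually.of_forall fun t ht => ?_
    rw [max_eq_left (le_of_lt ht)]
  set f : ℝ → EReal := fun t => ((ε / 2 * y t ^ 2 : ℝ) : EReal) + φ (u (max t 0)) with hf
  have hfm : Measurable f :=
    ((hym.pow_const 2).const_mul (ε / 2)).coe_real_ereal.add hφm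
  have hwf : wedFunctional φ ε u = extIntegral (expWeight ε) f := by
    refine extIntegral_congr_ae ?_
    filter_upwards [hyae', hφae] with t h1 h2
    simp only [hf]
    rw [h1, h2]
  -- In `EReal` one has ⊤ - ⊤ = ⊥, so finiteness of the negative part is what gives `wedFunctional φ
  -- ε u < ⊤` its intended meaning.
  have hneg : ∫⁻ t, (-f t).toENNReal ∂(expWeight ε) < ⊤ := by
    obtain ⟨x₀, A, B, hA, hB, hc⟩ := hcoer
    have h1 := integrableOn_sq_integral_mul_exp hε hyL hyi
    have h2 : Integrable (fun t => 2 * B * (∫ r in (0 : ℝ)..t, y r) ^ 2 +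
        (2 * B * dist (u 0) x₀ ^ 2 + A)) (expWeight ε) := by
      refine (((integrable_expWeight_iff hε).2 h1).const_mul _).add ?_
      refine (integrable_expWeight_iff hε).2 ?_
      exact (integrableOn_exp_neg_div hε).const_mul _
    refine lt_of_le_of_lt (lintegral_mono_ae ?_) h2.2
    refine (ae_expWeight_iff hε).2 ((ae_restrict_iff' measurableSet_Ioi).2 ?_)
    refine Eventually.of_forall fun t ht => ?_
    have ht0 : (0 : ℝ) < t := ht
    rw [Real.enorm_of_nonneg (by positivity)]
    refine (EReal.toENNReal_le_toENNReal (y := ((2 * B * (∫ r in (0 : ℝ)..t, y r) ^ 2 +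
        (2 * B * dist (u 0) x₀ ^ 2 + A) : ℝ) : EReal)) ?_).trans_eq (EReal.real_coe_toENNReal _)
    rw [EReal.neg_le]
    -- Taking both points equal leaves only the squared distance to `x₀`, which the Hardy inequality
    -- makes integrable.
    have h3 := hc (u t) (u t)
    have h4 : dist (u t) x₀ ≤ dist (u 0) x₀ + ∫ r in (0 : ℝ)..t, y r := by
      have := hyd 0 t le_rfl ht0.le
      have h5 := dist_triangle (u t) (u 0) x₀
      rw [dist_comm (u t) (u 0)] at h5
      linarith
    have h5 : dist (u t) x₀ ^ 2 ≤ 2 * dist (u 0) x₀ ^ 2 + 2 * (∫ r in (0 : ℝ)..t, y r) ^ 2 := by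
      have := pow_le_pow_left₀ dist_nonneg h4 2
      nlinarith [sq_nonneg (dist (u 0) x₀ - ∫ r in (0 : ℝ)..t, y r)]
    have h6 : ((-(2 * B * (∫ r in (0 : ℝ)..t, y r) ^ 2 +
        (2 * B * dist (u 0) x₀ ^ 2 + A)) : ℝ) : EReal) ≤ φ (u t) := by
      refine le_trans (EReal.coe_le_coe_iff.2 ?_) h3
      rw [dist_self]
      nlinarith
    rw [← EReal.coe_neg]
    refine h6.trans ?_
    simp only [hf]
    rw [max_eq_left ht0.le]
    have h7 : (0 : EReal) ≤ ((ε / 2 * y t ^ 2 : ℝ) : EReal) := EReal.coe_nonneg.2 (by positivity)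
    calc φ (u t) = 0 + φ (u t) := (zero_add _).symm
      _ ≤ _ := by gcongr
  have hpos : ∫⁻ t, (f t).toENNReal ∂(expWeight ε) < ⊤ := by
    rw [hwf] at hwed
    by_contra h
    rw [not_lt, top_le_iff] at h
    unfold extIntegral at hwed
    rw [h, EReal.coe_ennreal_top, EReal.top_sub] at hwed
    · exact lt_irrefl _ hwed
    · rw [ne_eq, EReal.coe_ennreal_eq_top_iff]; exact hneg.ne
  have hfin' : ∀ᵐ t ∂(expWeight ε), φ (u t) < ⊤ := by
    filter_upwards [ae_lt_top hfm.ereal_toENNReal hpos.ne, hφae] with t h1 h2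
    rw [lt_top_iff_ne_top] at h1 ⊢
    intro h3
    apply h1
    rw [EReal.toENNReal_eq_top_iff]
    simp only [hf]
    rw [h2, h3]
    exact EReal.coe_add_top _
  have hFi : Integrable (fun t => (φ (u t)).toReal) (expWeight ε) := by
    have hm : AEStronglyMeasurable (fun t => (φ (u t)).toReal) (expWeight ε) := by
      refine (hφm.ereal_toReal).aestronglyMeasurable.congr ?_
      filter_upwards [hφae] with t ht
      rw [ht]
    refine ⟨hm, ?_⟩
    -- The energy is the total density minus the kinetic part, so its norm is at most |f| plus the
    -- kinetic term.
    have h1 : ∫⁻ t, ((f t).toENNReal + (-f t).toENNReal + ‖ε / 2 * y t ^ 2‖ₑ) ∂(expWeight ε)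
        < ⊤ := by
      rw [lintegral_add_left (by fun_prop), lintegral_add_left (by fun_prop)]
      exact ENNReal.add_lt_top.2 ⟨ENNReal.add_lt_top.2 ⟨hpos, hneg⟩, (hyi'.const_mul _).2⟩
    refine lt_of_le_of_lt (lintegral_mono_ae ?_) h1
    filter_upwards [hfin', hφae] with t h2 h3
    obtain ⟨r, hr⟩ : ∃ r : ℝ, φ (u t) = r := ⟨_, (EReal.coe_toReal h2.ne (hbot _)).symm⟩
    simp only [hf]
    rw [h3, hr, EReal.toReal_coe, ← EReal.coe_add, ← EReal.coe_neg, EReal.real_coe_toENNReal,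
      EReal.real_coe_toENNReal]
    have h4 : ENNReal.ofReal (ε / 2 * y t ^ 2 + r) + ENNReal.ofReal (-(ε / 2 * y t ^ 2 + r)) =
        ‖ε / 2 * y t ^ 2 + r‖ₑ := by
      rcases le_total 0 (ε / 2 * y t ^ 2 + r) with h | h
      · rw [ENNReal.ofReal_of_nonpos (by linarith : -(ε / 2 * y t ^ 2 + r) ≤ 0), add_zero,
          Real.enorm_of_nonneg h]
      · rw [ENNReal.ofReal_of_nonpos h, zero_add, ← enorm_neg,
          Real.enorm_of_nonneg (by linarith)]
    rw [h4]
    calc ‖r‖ₑ = ‖(ε / 2 * y t ^ 2 + r) - ε / 2 * y t ^ 2‖ₑ := by congr 1; ring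
      _ ≤ _ := enorm_sub_le
  have hval : wedFunctional φ ε u =
      ((∫ t, (ε / 2 * y t ^ 2 + (φ (u t)).toReal) ∂(expWeight ε) : ℝ) : EReal) := by
    have hi : Integrable (fun t => ε / 2 * y t ^ 2 + (φ (u t)).toReal) (expWeight ε) :=
      (hyi'.const_mul _).add hFi
    rw [← extIntegral_coe hi, hwf]
    refine extIntegral_congr_ae ?_
    filter_upwards [hfin', hφae] with t h2 h3
    simp only [hf]
    rw [h3, EReal.coe_add, EReal.coe_toReal h2.ne (hbot _)]
  refine ⟨y, hε, hlsc, hbot, hym, hy0, hyae, hyL, hyd, (ae_expWeight_iff hε).1 hfin', hyi,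
    (integrable_expWeight_iff hε).1 hFi, ?_⟩
  intro v M Φ hv0 hM hd hΦ hMi hΦi
  obtain ⟨hvac, hvM⟩ := isACLoc_of_dist_le hM hd
  have hvM' := (ae_expWeight_iff hε).2 hvM
  have hMi' := (integrable_expWeight_iff hε).2 hMi
  have hΦi' := (integrable_expWeight_iff hε).2 hΦi
  have hadm : v ∈ admissible ε x := by
    refine ⟨hvac, hv0.trans hux, lt_of_le_of_lt (lintegral_mono_ae ?_) hMi'.2⟩
    filter_upwards [hvM'] with t ht
    rw [Real.enorm_of_nonneg (by positivity)]
    exact ENNReal.ofReal_le_ofReal (pow_le_pow_left₀ ht.1 ht.2 2)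
  -- Competitors need only upper bounds: `M` dominates the metric derivative of `v` and `Φ` its
  -- energy.
  have h1 : wedFunctional φ ε v ≤
      ((∫ t, (ε / 2 * M t ^ 2 + Φ t) ∂(expWeight ε) : ℝ) : EReal) := by
    have hi : Integrable (fun t => ε / 2 * M t ^ 2 + Φ t) (expWeight ε) :=
      (hMi'.const_mul _).add hΦi'
    rw [← extIntegral_coe hi]
    refine extIntegral_mono_ae ?_
    filter_upwards [hvM', (ae_expWeight_iff hε).2 hΦ] with t h2 h3
    rw [EReal.coe_add]
    refine add_le_add (EReal.coe_le_coe_iff.2 ?_) h3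
    have := pow_le_pow_left₀ h2.1 h2.2 2
    gcongr
  have h2 := (hmin v hadm).trans h1
  rw [hval, EReal.coe_le_coe_iff, integral_expWeight hε, integral_expWeight hε] at h2
  exact le_of_mul_le_mul_left h2 (inv_pos.2 hε)

end WED

namespace WED

/-! ### Excursions of lower semicontinuous functions -/

/-- If a lower semicontinuous function never makes an excursion above a continuous function `L`,
then it stays below `L`. -/
theorem le_of_forall_not_excursion {f : ℝ → EReal} {L : ℝ → ℝ} {a b : ℝ}
    (hf : LowerSemicontinuousOn f (Icc a b)) (hL : ContinuousOn L (Icc a b))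
    (hfa : f a ≤ L a) (hfb : f b ≤ L b)
    (h : ∀ a' b', a ≤ a' → a' < b' → b' ≤ b → f a' ≤ L a' → f b' ≤ L b' →
      ¬ ∀ t ∈ Ioo a' b', (L t : EReal) < f t) :
    ∀ t ∈ Icc a b, f t ≤ L t := by
  intro s hs
  by_contra hcon
  rw [not_le] at hcon
  -- A strict inequality L < f persists nearby, by lower semicontinuity of f and continuity of L.
  have hclosed : IsClosed {t | t ∈ Icc a b ∧ f t ≤ L t} := by
    refine isClosed_iff_clusterPt.2 fun t ht => ?_
    have htI : t ∈ Icc a b := isClosed_Icc.closure_subset_iff.2 (fun t ht => ht.1)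
      (mem_closure_iff_clusterPt.2 ht)
    refine ⟨htI, ?_⟩
    by_contra hlt
    rw [not_le] at hlt
    obtain ⟨c, hc1, hc2⟩ := EReal.lt_iff_exists_real_btwn.1 hlt
    have h1 := hf t htI c hc2
    have h2 := (hL t htI).eventually (gt_mem_nhds (EReal.coe_lt_coe_iff.1 hc1))
    rw [← mem_closure_iff_clusterPt, mem_closure_iff_frequently] at ht
    refine ht ?_
    filter_upwards [eventually_nhdsWithin_iff.1 h1, eventually_nhdsWithin_iff.1 h2]
      with r hr1 hr2 hr
    exact absurd (hr.2.trans_lt (EReal.coe_lt_coe_iff.2 (hr2 hr.1))) (not_lt.2 (hr1 hr.1).le)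
  -- The excursion around `s` lies between the last point before `s` and the first point after `s`
  -- at which f ≤ L.
  obtain ⟨a', ha', hamax⟩ := ((isCompact_Icc (a := a) (b := s)).inter_left hclosed).exists_isGreatest
    ⟨a, ⟨left_mem_Icc.2 (hs.1.trans hs.2), hfa⟩, left_mem_Icc.2 hs.1⟩
  obtain ⟨b', hb', hbmin⟩ := ((isCompact_Icc (a := s) (b := b)).inter_left hclosed).exists_isLeast
    ⟨b, ⟨right_mem_Icc.2 (hs.1.trans hs.2), hfb⟩, right_mem_Icc.2 hs.2⟩
  have ha's : a' < s := lt_of_le_of_ne ha'.2.2 fun h => absurd ha'.1.2 (not_le.2 (h ▸ hcon))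
  have hsb' : s < b' := lt_of_le_of_ne hb'.2.1 fun h => absurd hb'.1.2 (not_le.2 (h ▸ hcon))
  refine h a' b' ha'.2.1 (ha's.trans hsb') hb'.2.2 ha'.1.2 hb'.1.2 fun t ht => ?_
  by_contra hle
  rw [not_lt] at hle
  have htI : t ∈ Icc a b := ⟨ha'.2.1.trans ht.1.le, ht.2.le.trans hb'.2.2⟩
  rcases le_total t s with hts | hts
  · exact absurd (hamax ⟨⟨htI, hle⟩, htI.1, hts⟩) (not_le.2 ht.1)
  · exact absurd (hbmin ⟨⟨htI, hle⟩, hts, htI.2⟩) (not_le.2 ht.2)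

/-! ### Local competitors -/

variable {X : Type*} [MetricSpace X]

theorem dist_le_integral_glue {v : ℝ → X} {M : ℝ → ℝ} {c : ℝ} (hc : 0 ≤ c)
    (hM : ∀ s t, 0 ≤ s → 0 ≤ t → IntervalIntegrable M volume s t)
    (h1 : ∀ s t, 0 ≤ s → s ≤ t → t ≤ c → dist (v s) (v t) ≤ ∫ r in s..t, M r)
    (h2 : ∀ s t, c ≤ s → s ≤ t → dist (v s) (v t) ≤ ∫ r in s..t, M r) :
    ∀ s t, 0 ≤ s → s ≤ t → dist (v s) (v t) ≤ ∫ r in s..t, M r := by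
  intro s t hs hst
  rcases le_total t c with htc | htc
  · exact h1 s t hs hst htc
  rcases le_total c s with hcs | hcs
  · exact h2 s t hcs hst
  rw [← intervalIntegral.integral_add_adjacent_intervals (hM s c hs hc) (hM c t hc (hs.trans hst))]
  exact (dist_triangle _ (v c) _).trans (add_le_add (h1 s c hs hcs le_rfl) (h2 c t le_rfl htc))

namespace WedMinimizer

variable {φ : X → EReal} {ε : ℝ} {u : ℝ → X} {y : ℝ → ℝ}

theorem intervalIntegrable (h : WedMinimizer φ ε u y) {s t : ℝ} (hs : 0 ≤ s) (ht : 0 ≤ t) :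
    IntervalIntegrable y volume s t :=
  intervalIntegrable_of_memLp_two h.memLp hs ht

theorem continuousOn (h : WedMinimizer φ ε u y) : ContinuousOn u (Ici 0) :=
  continuousOn_Ici_of_dist_le h.memLp h.dist_le

theorem lowerSemicontinuousOn (h : WedMinimizer φ ε u y) :
    LowerSemicontinuousOn (fun t => φ (u t)) (Ici 0) :=
  fun t ht c hc => (h.continuousOn t ht).eventually (h.lsc _ c hc)

theorem intervalIntegrable_energy_mul (h : WedMinimizer φ ε u y) {a b : ℝ} (ha : 0 ≤ a)
    (hab : a ≤ b) :
    IntervalIntegrable (fun t => (φ (u t)).toReal * Real.exp (-t / ε)) volume a b :=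
  (intervalIntegrable_iff_integrableOn_Ioc_of_le hab).2
    (h.int_energy.mono_set fun _ ht => lt_of_le_of_lt ha ht.1)

theorem intervalIntegrable_sq_mul (h : WedMinimizer φ ε u y) {a b : ℝ} (ha : 0 ≤ a)
    (hab : a ≤ b) :
    IntervalIntegrable (fun t => y t ^ 2 * Real.exp (-t / ε)) volume a b :=
  (intervalIntegrable_iff_integrableOn_Ioc_of_le hab).2
    (h.int_speed.mono_set fun _ ht => lt_of_le_of_lt ha ht.1)

/-- Minimality among the curves that differ from `u` on a compact interval only. -/
theorem minimal_Icc (h : WedMinimizer φ ε u y) {a b : ℝ} (ha : 0 ≤ a) (hab : a < b)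
    {v : ℝ → X} {m Φ : ℝ → ℝ} (hva : v a = u a) (hvb : v b = u b)
    (hm : MemLp m 2 (volume.restrict (Icc a b)))
    (hd : ∀ s ∈ Icc a b, ∀ t ∈ Icc a b, s ≤ t → dist (v s) (v t) ≤ ∫ r in s..t, m r)
    (hΦ : ∀ t ∈ Icc a b, φ (v t) ≤ (Φ t : EReal)) (hΦi : IntegrableOn Φ (Icc a b)) :
    ∫ t in a..b, (ε / 2 * y t ^ 2 + (φ (u t)).toReal) * Real.exp (-t / ε) ≤
      ∫ t in a..b, (ε / 2 * m t ^ 2 + Φ t) * Real.exp (-t / ε) := by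
  classical
  -- Half-open, to match interval integrals; the endpoint conditions on `v` make the pasted curve
  -- continuous.
  set S : Set ℝ := Ioc a b with hS
  have hSm : MeasurableSet S := measurableSet_Ioc
  have hS0 : S ⊆ Ioi 0 := fun t ht => lt_of_le_of_lt ha ht.1
  have hSI : S ⊆ Icc a b := Ioc_subset_Icc_self
  have hp : Continuous fun t : ℝ => Real.exp (-t / ε) := by fun_prop
  set w : ℝ → X := fun t => if t ∈ S then v t else u t with hw
  set M : ℝ → ℝ := S.piecewise m y with hM
  set Ψ : ℝ → ℝ := S.piecewise Φ (fun t => (φ (u t)).toReal) with hΨ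
  have hwu : ∀ t, t ≤ a → w t = u t := fun t ht => by
    simp only [hw]; rw [if_neg fun h => absurd h.1 (not_lt.2 ht)]
  have hwu' : ∀ t, b ≤ t → w t = u t := fun t ht => by
    simp only [hw]
    rcases ht.lt_or_eq with h | h
    · rw [if_neg fun h' => absurd h'.2 (not_le.2 h)]
    · rw [← h, if_pos (right_mem_Ioc.2 hab), hvb]
  have hwv : ∀ t ∈ Icc a b, w t = v t := fun t ht => by
    simp only [hw]
    rcases ht.1.lt_or_eq with h | h
    · rw [if_pos ⟨h, ht.2⟩]
    · rw [← h, if_neg fun h' => absurd h'.1 (lt_irrefl _), hva]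
  have hML : ∀ T, MemLp M 2 (volume.restrict (Icc 0 T)) := by
    intro T
    refine MemLp.piecewise hSm ?_ ?_
    · rw [Measure.restrict_restrict hSm]
      exact hm.mono_measure (Measure.restrict_mono (inter_subset_left.trans hSI) le_rfl)
    · exact (h.memLp T).restrict _
  have hMI : ∀ s t, 0 ≤ s → 0 ≤ t → IntervalIntegrable M volume s t := fun s t hs ht =>
    intervalIntegrable_of_memLp_two hML hs ht
  have hMy : ∀ s t, s ≤ t → (t ≤ a ∨ b ≤ s) → ∫ r in s..t, M r = ∫ r in s..t, y r := by
    intro s t hst hor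
    rw [intervalIntegral.integral_of_le hst, intervalIntegral.integral_of_le hst]
    refine setIntegral_congr_fun measurableSet_Ioc fun r hr => piecewise_eq_of_notMem _ _ _ ?_
    rintro ⟨h1, h2⟩
    rcases hor with h3 | h3
    · linarith [hr.2]
    · linarith [hr.1]
  have hMm : ∀ s ∈ Icc a b, ∀ t ∈ Icc a b, s ≤ t → ∫ r in s..t, M r = ∫ r in s..t, m r := by
    intro s hs t ht hst
    rw [intervalIntegral.integral_of_le hst, intervalIntegral.integral_of_le hst]
    exact setIntegral_congr_fun measurableSet_Ioc fun r hr =>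
      piecewise_eq_of_mem _ _ _ ⟨hs.1.trans_lt hr.1, hr.2.trans ht.2⟩
  have hdist : ∀ s t, 0 ≤ s → s ≤ t → dist (w s) (w t) ≤ ∫ r in s..t, M r := by
    refine dist_le_integral_glue ha hMI (fun s t hs hst hta => ?_) ?_
    · rw [hwu s (hst.trans hta), hwu t hta, hMy s t hst (Or.inl hta)]
      exact h.dist_le s t hs hst
    · intro s t hs hst
      have hb : 0 ≤ b := ha.trans hab.le
      rcases le_total t b with htb | htb
      · have h1 : s ∈ Icc a b := ⟨hs, hst.trans htb⟩
        have h2 : t ∈ Icc a b := ⟨hs.trans hst, htb⟩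
        rw [hwv s h1, hwv t h2, hMm s h1 t h2 hst]
        exact hd s h1 t h2 hst
      rcases le_total b s with hbs | hbs
      · rw [hwu' s hbs, hwu' t htb, hMy s t hst (Or.inr hbs)]
        exact h.dist_le s t (ha.trans hs) hst
      · rw [← intervalIntegral.integral_add_adjacent_intervals (hMI s b (ha.trans hs) hb)
          (hMI b t hb (hb.trans htb))]
        have h1 : s ∈ Icc a b := ⟨hs, hbs⟩
        have h2 : b ∈ Icc a b := right_mem_Icc.2 hab.le
        refine (dist_triangle _ (w b) _).trans (add_le_add ?_ ?_)
        · rw [hwv s h1, hwv b h2, hMm s h1 b h2 hbs]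
          exact hd s h1 b h2 hbs
        · rw [hwu' b le_rfl, hwu' t htb, hMy b t htb (Or.inr le_rfl)]
          exact h.dist_le b t hb htb
  have hΨle : ∀ᵐ t ∂(volume.restrict (Ioi (0 : ℝ))), φ (w t) ≤ (Ψ t : EReal) := by
    filter_upwards [h.ae_lt_top] with t ht
    by_cases htS : t ∈ S
    · simp only [hw, hΨ]
      rw [if_pos htS, piecewise_eq_of_mem _ _ _ htS]
      exact hΦ t (hSI htS)
    · simp only [hw, hΨ]
      rw [if_neg htS, piecewise_eq_of_notMem _ _ _ htS, EReal.coe_toReal ht.ne (h.ne_bot _)]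
  have hm2 : IntegrableOn (fun t => m t ^ 2 * Real.exp (-t / ε)) S :=
    (IntegrableOn.mul_continuousOn (hm.integrable_sq) hp.continuousOn isCompact_Icc).mono_set hSI
  have hΦ2 : IntegrableOn (fun t => Φ t * Real.exp (-t / ε)) S :=
    (hΦi.mul_continuousOn hp.continuousOn isCompact_Icc).mono_set hSI
  have hM2 : IntegrableOn (fun t => M t ^ 2 * Real.exp (-t / ε)) (Ioi 0) := by
    have : (fun t => M t ^ 2 * Real.exp (-t / ε)) =
        S.piecewise (fun t => m t ^ 2 * Real.exp (-t / ε)) fun t => y t ^ 2 * Real.exp (-t / ε) := by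
      ext t
      by_cases htS : t ∈ S <;> simp [hM, htS]
    rw [this]
    refine Integrable.piecewise hSm ?_ h.int_speed.integrableOn
    rw [IntegrableOn, Measure.restrict_restrict hSm, inter_eq_left.2 hS0]
    exact hm2
  have hΨ2 : IntegrableOn (fun t => Ψ t * Real.exp (-t / ε)) (Ioi 0) := by
    have : (fun t => Ψ t * Real.exp (-t / ε)) =
        S.piecewise (fun t => Φ t * Real.exp (-t / ε))
          fun t => (φ (u t)).toReal * Real.exp (-t / ε) := by
      ext t
      by_cases htS : t ∈ S <;> simp [hΨ, htS]
    rw [this]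
    refine Integrable.piecewise hSm ?_ h.int_energy.integrableOn
    rw [IntegrableOn, Measure.restrict_restrict hSm, inter_eq_left.2 hS0]
    exact hΦ2
  have key := h.minimal w M Ψ (hwu 0 ha) hML hdist hΨle hM2 hΨ2
  have hi1 : IntegrableOn (fun t => (ε / 2 * y t ^ 2 + (φ (u t)).toReal) * Real.exp (-t / ε))
      (Ioi 0) := by
    refine ((h.int_speed.const_mul (ε / 2)).add h.int_energy).congr (Eventually.of_forall fun t => ?_)
    simp only [Pi.add_apply]; ring
  have hi2 : IntegrableOn (fun t => (ε / 2 * M t ^ 2 + Ψ t) * Real.exp (-t / ε)) (Ioi 0) := by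
    refine ((hM2.const_mul (ε / 2)).add hΨ2).congr (Eventually.of_forall fun t => ?_)
    simp only [Pi.add_apply]; ring
  rw [← integral_inter_add_sdiff hSm hi1, ← integral_inter_add_sdiff hSm hi2,
    inter_eq_right.2 hS0] at key
  have hdiff : ∫ t in Ioi 0 \ S, (ε / 2 * M t ^ 2 + Ψ t) * Real.exp (-t / ε) =
      ∫ t in Ioi 0 \ S, (ε / 2 * y t ^ 2 + (φ (u t)).toReal) * Real.exp (-t / ε) := by
    refine setIntegral_congr_fun (measurableSet_Ioi.diff hSm) fun t ht => ?_
    simp [hM, hΨ, ht.2]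
  have hin : ∫ t in S, (ε / 2 * M t ^ 2 + Ψ t) * Real.exp (-t / ε) =
      ∫ t in S, (ε / 2 * m t ^ 2 + Φ t) * Real.exp (-t / ε) := by
    refine setIntegral_congr_fun hSm fun t ht => ?_
    simp [hM, hΨ, ht]
  rw [intervalIntegral.integral_of_le hab.le, intervalIntegral.integral_of_le hab.le]
  rw [hdiff, hin] at key
  linarith

/-- Comparison with a reparametrized geodesic: the energy of `u` makes no excursion above `L`. -/
theorem not_excursion (h : WedMinimizer φ ε u y) {lam : ℝ} (hconv : GeodConvex lam φ)
    {a b : ℝ} (ha : 0 ≤ a) (hab : a < b) (hua : φ (u a) < ⊤) (hub : φ (u b) < ⊤)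
    {k L : ℝ → ℝ} (hk : MemLp k 2 (volume.restrict (Icc a b))) (hk0 : ∀ t, 0 ≤ k t)
    (hk1 : ∫ t in a..b, k t = 1) (hL : ContinuousOn L (Icc a b))
    (hle : ∫ t in a..b, (ε / 2 * (dist (u a) (u b) * k t) ^ 2 +
      ((1 - ∫ r in a..t, k r) * (φ (u a)).toReal + (∫ r in a..t, k r) * (φ (u b)).toReal
        - lam / 2 * (∫ r in a..t, k r) * (1 - ∫ r in a..t, k r) * dist (u a) (u b) ^ 2))
          * Real.exp (-t / ε) ≤
      ∫ t in a..b, (ε / 2 * y t ^ 2 + L t) * Real.exp (-t / ε)) :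
    ¬ ∀ t ∈ Ioo a b, (L t : EReal) < φ (u t) := by
  intro hlt
  obtain ⟨γ, hγ, hγ0, hγ1, hγφ⟩ := hconv (u a) (u b) hua hub
  set θ : ℝ → ℝ := fun t => ∫ r in a..t, k r with hθ
  set d := dist (u a) (u b) with hd
  have hki : IntervalIntegrable k volume a b := by
    rw [intervalIntegrable_iff_integrableOn_Icc_of_le hab.le]
    exact hk.integrable (by norm_num)
  have sub : ∀ s ∈ Icc a b, ∀ t ∈ Icc a b, IntervalIntegrable k volume s t := fun s hs t ht =>
    hki.mono_set (by rw [uIcc_of_le hab.le]; exact uIcc_subset_Icc hs ht)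
  have haI := left_mem_Icc.2 hab.le
  have hbI := right_mem_Icc.2 hab.le
  have hθdiff : ∀ s ∈ Icc a b, ∀ t ∈ Icc a b, θ t - θ s = ∫ r in s..t, k r := fun s hs t ht =>
    intervalIntegral.integral_interval_sub_left (sub a haI t ht) (sub a haI s hs)
  have hθmono : ∀ s ∈ Icc a b, ∀ t ∈ Icc a b, s ≤ t → θ s ≤ θ t := fun s hs t ht hst => by
    have := hθdiff s hs t ht
    have h2 : 0 ≤ ∫ r in s..t, k r := intervalIntegral.integral_nonneg hst fun r _ => hk0 r
    linarith
  have hθa : θ a = 0 := intervalIntegral.integral_same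
  have hθb : θ b = 1 := hk1
  have hθI : ∀ t ∈ Icc a b, θ t ∈ Icc (0 : ℝ) 1 := fun t ht =>
    ⟨hθa ▸ hθmono a haI t ht ht.1, hθb ▸ hθmono t ht b hbI ht.2⟩
  have hθc : ContinuousOn θ (Icc a b) := by
    have := (hki.absolutelyContinuousOnInterval_intervalIntegral (c := a) left_mem_uIcc).continuousOn
    rwa [uIcc_of_le hab.le] at this
  set Φ : ℝ → ℝ := fun t => (1 - θ t) * (φ (u a)).toReal + θ t * (φ (u b)).toReal
        - lam / 2 * θ t * (1 - θ t) * d ^ 2 with hΦ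
  have hΦc : ContinuousOn Φ (Icc a b) := by fun_prop
  -- The geodesic followed with time law θ has speed `d * k`, and its energy is controlled by
  -- λ-convexity evaluated at θ.
  have key := h.minimal_Icc ha hab (v := γ ∘ θ) (m := fun t => d * k t) (Φ := Φ)
    (by simp only [Function.comp, hθa, hγ0]) (by simp only [Function.comp, hθb, hγ1])
    (hk.const_mul d) (fun s hs t ht hst => by
      simp only [Function.comp]
      rw [hγ _ (hθI s hs) _ (hθI t ht), hγ0, hγ1, intervalIntegral.integral_const_mul,
        hθdiff s hs t ht, abs_of_nonneg (intervalIntegral.integral_nonneg hst fun r _ => hk0 r),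
        mul_comm])
    (fun t ht => hγφ _ (hθI t ht)) (hΦc.integrableOn_Icc)
  have key2 := key.trans hle
  have hp : Continuous fun t : ℝ => Real.exp (-t / ε) := by fun_prop
  have hLp : IntervalIntegrable (fun t => L t * Real.exp (-t / ε)) volume a b :=
    ContinuousOn.intervalIntegrable (by rw [uIcc_of_le hab.le]; exact hL.mul hp.continuousOn)
  have hF := h.intervalIntegrable_energy_mul ha hab.le
  have hY := (h.intervalIntegrable_sq_mul ha hab.le).const_mul (ε / 2)
  have e1 : ∀ G : ℝ → ℝ, IntervalIntegrable (fun t => G t * Real.exp (-t / ε)) volume a b →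
      ∫ t in a..b, (ε / 2 * y t ^ 2 + G t) * Real.exp (-t / ε) =
        (∫ t in a..b, ε / 2 * (y t ^ 2 * Real.exp (-t / ε))) +
          ∫ t in a..b, G t * Real.exp (-t / ε) := fun G hG => by
    rw [← intervalIntegral.integral_add hY hG]
    exact intervalIntegral.integral_congr fun t _ => by ring
  rw [e1 _ hF, e1 _ hLp] at key2
  have hsub := intervalIntegral.integral_sub hF hLp
  -- Since `toReal` sends ⊤ to 0, the integrand is set to 1 on the null set where the energy is
  -- infinite; it is then positive on the entire open interval.
  have hcongr : ∫ t in a..b, ((φ (u t)).toReal * Real.exp (-t / ε) - L t * Real.exp (-t / ε)) =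
      ∫ t in a..b, (if φ (u t) = ⊤ then 1 else
        (φ (u t)).toReal * Real.exp (-t / ε) - L t * Real.exp (-t / ε)) := by
    refine intervalIntegral.integral_congr_ae_restrict ?_
    rw [uIoc_of_le hab.le]
    have h1 := ae_restrict_of_ae_restrict_of_subset
      (show Ioc a b ⊆ Ioi 0 from fun t ht => lt_of_le_of_lt ha ht.1) h.ae_lt_top
    filter_upwards [h1] with t ht
    rw [if_neg ht.ne]
  have hpos : 0 < ∫ t in a..b, (if φ (u t) = ⊤ then 1 else
        (φ (u t)).toReal * Real.exp (-t / ε) - L t * Real.exp (-t / ε)) := by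
    refine intervalIntegral.intervalIntegral_pos_of_pos_on ?_ (fun t ht => ?_) hab
    · refine (hF.sub hLp).congr_ae ?_
      rw [uIoc_of_le hab.le]
      have h1 := ae_restrict_of_ae_restrict_of_subset
        (show Ioc a b ⊆ Ioi 0 from fun t ht => lt_of_le_of_lt ha ht.1) h.ae_lt_top
      filter_upwards [h1] with t ht
      rw [if_neg ht.ne]
    · split_ifs with htop
      · exact one_pos
      · have h1 := hlt t ht
        rw [← EReal.coe_toReal htop (h.ne_bot _), EReal.coe_lt_coe_iff] at h1
        rw [← sub_mul]
        exact mul_pos (sub_pos.2 h1) (Real.exp_pos _)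
  linarith

end WedMinimizer

end WED

namespace WED

/-! ### Convexity of the energy as a function of the arc length -/

/-- The length of the curve on `[0, t]`. -/
noncomputable def arcLength (y : ℝ → ℝ) (t : ℝ) : ℝ := ∫ r in (0 : ℝ)..t, y r

variable {X : Type*} [MetricSpace X]

namespace WedMinimizer

variable {φ : X → EReal} {ε : ℝ} {u : ℝ → X} {y : ℝ → ℝ}

theorem arcLength_sub (h : WedMinimizer φ ε u y) {s t : ℝ} (hs : 0 ≤ s) (ht : 0 ≤ t) :
    arcLength y t - arcLength y s = ∫ r in s..t, y r :=
  intervalIntegral.integral_interval_sub_left (h.intervalIntegrable le_rfl ht)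
    (h.intervalIntegrable le_rfl hs)

theorem dist_le_arcLength (h : WedMinimizer φ ε u y) {s t : ℝ} (hs : 0 ≤ s) (hst : s ≤ t) :
    dist (u s) (u t) ≤ arcLength y t - arcLength y s := by
  rw [h.arcLength_sub hs (hs.trans hst)]; exact h.dist_le s t hs hst

theorem arcLength_mono (h : WedMinimizer φ ε u y) : MonotoneOn (arcLength y) (Ici 0) :=
  fun _ hs _ _ hst => sub_nonneg.1 (dist_nonneg.trans (h.dist_le_arcLength hs hst))

theorem arcLength_nonneg (h : WedMinimizer φ ε u y) {t : ℝ} (ht : 0 ≤ t) : 0 ≤ arcLength y t :=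
  intervalIntegral.integral_nonneg ht fun r _ => h.nonneg r

theorem continuousOn_arcLength (h : WedMinimizer φ ε u y) :
    ContinuousOn (arcLength y) (Ici 0) := by
  refine continuousOn_Ici_of_dist_le h.memLp fun s t hs hst => ?_
  rw [dist_comm, Real.dist_eq, h.arcLength_sub hs (hs.trans hst)]
  exact (abs_of_nonneg (intervalIntegral.integral_nonneg hst fun r _ => h.nonneg r)).le

theorem eq_of_arcLength_eq (h : WedMinimizer φ ε u y) {s t : ℝ} (hs : 0 ≤ s) (hst : s ≤ t)
    (hl : arcLength y s = arcLength y t) : u s = u t := by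
  have := h.dist_le_arcLength hs hst
  rw [hl, sub_self] at this
  exact dist_le_zero.1 this

/-- The competitor is the geodesic run proportionally to arc length: its speed is the speed of u
times d/δ ≤ 1, where d is the distance of the endpoints and δ the length between them. Its energy
lies below the chord because d ≤ δ and λ < 0, so an excursion of the energy above the chord would
contradict minimality. -/
theorem energy_le_chord (h : WedMinimizer φ ε u y) {lam : ℝ} (hlam : lam < 0)
    (hconv : GeodConvex lam φ) {a b : ℝ} (ha : 0 ≤ a)
    (hua : φ (u a) < ⊤) (hub : φ (u b) < ⊤) (hl : arcLength y a < arcLength y b)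
    {s : ℝ} (hs : s ∈ Icc a b) :
    φ (u s) ≤ ((((arcLength y b - arcLength y s) *
        ((φ (u a)).toReal - lam / 2 * arcLength y a ^ 2) +
      (arcLength y s - arcLength y a) * ((φ (u b)).toReal - lam / 2 * arcLength y b ^ 2)) /
        (arcLength y b - arcLength y a) + lam / 2 * arcLength y s ^ 2 : ℝ) : EReal) := by
  set l := arcLength y with hl'
  set A := (φ (u a)).toReal - lam / 2 * l a ^ 2 with hA
  set B := (φ (u b)).toReal - lam / 2 * l b ^ 2 with hB
  have hab : a ≤ b := hs.1.trans hs.2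
  have hδ : 0 < l b - l a := sub_pos.2 hl
  have hIci : Icc a b ⊆ Ici 0 := fun t ht => ha.trans ht.1
  have hlc : ContinuousOn l (Icc a b) := h.continuousOn_arcLength.mono hIci
  set L : ℝ → ℝ := fun t => ((l b - l t) * A + (l t - l a) * B) / (l b - l a) + lam / 2 * l t ^ 2
    with hL
  have hLc : ContinuousOn L (Icc a b) := by fun_prop
  refine le_of_forall_not_excursion (L := L) (h.lowerSemicontinuousOn.mono hIci) hLc ?_ ?_ ?_ s hs
  · rw [← EReal.coe_toReal hua.ne (h.ne_bot _), EReal.coe_le_coe_iff]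
    simp only [hL, hA]
    have : ((l b - l a) * ((φ (u a)).toReal - lam / 2 * l a ^ 2) + (l a - l a) * B) / (l b - l a) =
        (φ (u a)).toReal - lam / 2 * l a ^ 2 := by field_simp; ring
    rw [this]; linarith
  · rw [← EReal.coe_toReal hub.ne (h.ne_bot _), EReal.coe_le_coe_iff]
    simp only [hL, hB]
    have : ((l b - l b) * A + (l b - l a) * ((φ (u b)).toReal - lam / 2 * l b ^ 2)) / (l b - l a) =
        (φ (u b)).toReal - lam / 2 * l b ^ 2 := by field_simp; ring
    rw [this]; linarith
  intro a' b' ha' hab' hb' hLa hLb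
  have ha0 : 0 ≤ a' := ha.trans ha'
  have hb0 : 0 ≤ b' := ha0.trans hab'.le
  -- If no length is covered, u is constant on the interval and no excursion is possible.
  rcases (h.arcLength_mono ha0 hb0 hab'.le).eq_or_lt with heq | hlt
  · intro hex
    have hm : (a' + b') / 2 ∈ Ioo a' b' := ⟨by linarith, by linarith⟩
    have h1 := h.arcLength_mono ha0 (ha0.trans hm.1.le) hm.1.le
    have h2 := h.arcLength_mono (ha0.trans hm.1.le) hb0 hm.2.le
    have h3 : l a' = l ((a' + b') / 2) := le_antisymm h1 (h2.trans heq.ge)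
    have h4 := hex _ hm
    have h5 : L ((a' + b') / 2) = L a' := by simp only [hL]; rw [h3]
    rw [h5, ← h.eq_of_arcLength_eq ha0 hm.1.le h3] at h4
    exact absurd hLa (not_le.2 h4)
  set δ := l b' - l a' with hδ'
  have hδ'pos : 0 < δ := sub_pos.2 hlt
  have hua' : φ (u a') < ⊤ := hLa.trans_lt (EReal.coe_lt_top _)
  have hub' : φ (u b') < ⊤ := hLb.trans_lt (EReal.coe_lt_top _)
  have hsub' : Icc a' b' ⊆ Icc a b := Icc_subset_Icc ha' hb'
  have hLc' := hLc.mono hsub'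
  have hθ : ∀ t, 0 ≤ t → ∫ r in a'..t, y r / δ = (l t - l a') / δ := fun t ht => by
    rw [intervalIntegral.integral_div, h.arcLength_sub ha0 ht]
  have hkL : MemLp (fun t => y t / δ) 2 (volume.restrict (Icc a' b')) := by
    have := ((h.memLp b').mono_measure
      (Measure.restrict_mono (Icc_subset_Icc_left ha0) le_rfl)).const_mul δ⁻¹
    refine this.congr_norm ?_ (Eventually.of_forall fun t => ?_)
    · exact (h.meas.div_const δ).aestronglyMeasurable
    · rw [div_eq_inv_mul]
  refine h.not_excursion hconv ha0 hab' hua' hub' (k := fun t => y t / δ) hkL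
    (fun t => div_nonneg (h.nonneg t) hδ'pos.le) ?_ hLc' ?_
  · rw [hθ b' hb0]; exact div_self hδ'pos.ne'
  set d := dist (u a') (u b') with hd
  have hdδ : d ≤ δ := h.dist_le_arcLength ha0 hab'.le
  have hd0 : 0 ≤ d := dist_nonneg
  rw [← EReal.coe_toReal hua'.ne (h.ne_bot _), EReal.coe_le_coe_iff] at hLa
  rw [← EReal.coe_toReal hub'.ne (h.ne_bot _), EReal.coe_le_coe_iff] at hLb
  have hp : Continuous fun t : ℝ => Real.exp (-t / ε) := by fun_prop
  have hY := h.intervalIntegrable_sq_mul ha0 hab'.le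
  have hlc' : ContinuousOn l (uIcc a' b') := by rw [uIcc_of_le hab'.le]; exact hlc.mono hsub'
  have hcont : ContinuousOn (fun t => (1 - (l t - l a') / δ) * (φ (u a')).toReal +
      (l t - l a') / δ * (φ (u b')).toReal -
      lam / 2 * ((l t - l a') / δ) * (1 - (l t - l a') / δ) * d ^ 2) (uIcc a' b') := by fun_prop
  have hLc'' : ContinuousOn L (uIcc a' b') := by rw [uIcc_of_le hab'.le]; exact hLc'
  have hΦθ : ∫ t in a'..b', (ε / 2 * (d * (y t / δ)) ^ 2 +
      ((1 - ∫ r in a'..t, y r / δ) * (φ (u a')).toReal + (∫ r in a'..t, y r / δ) *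
        (φ (u b')).toReal - lam / 2 * (∫ r in a'..t, y r / δ) * (1 - ∫ r in a'..t, y r / δ) *
          d ^ 2)) * Real.exp (-t / ε) =
      ∫ t in a'..b', ((d / δ) ^ 2 * (ε / 2 * (y t ^ 2 * Real.exp (-t / ε))) +
      ((1 - (l t - l a') / δ) * (φ (u a')).toReal + (l t - l a') / δ * (φ (u b')).toReal -
      lam / 2 * ((l t - l a') / δ) * (1 - (l t - l a') / δ) * d ^ 2) * Real.exp (-t / ε)) := by
    refine intervalIntegral.integral_congr fun t ht => ?_
    rw [uIcc_of_le hab'.le] at ht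
    rw [hθ t (ha0.trans ht.1)]
    ring
  have hR : ∫ t in a'..b', (ε / 2 * y t ^ 2 + L t) * Real.exp (-t / ε) =
      ∫ t in a'..b', (ε / 2 * (y t ^ 2 * Real.exp (-t / ε)) + L t * Real.exp (-t / ε)) :=
    intervalIntegral.integral_congr fun t _ => by ring
  rw [hΦθ, hR]
  refine intervalIntegral.integral_mono_on hab'.le
    (((hY.const_mul _).const_mul _).add (hcont.mul hp.continuousOn).intervalIntegrable)
    ((hY.const_mul _).add (hLc''.mul hp.continuousOn).intervalIntegrable) fun t ht => ?_
  refine add_le_add ?_ (mul_le_mul_of_nonneg_right ?_ (Real.exp_pos _).le)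
  · have h1 : (d / δ) ^ 2 ≤ 1 := pow_le_one₀ (by positivity) ((div_le_one hδ'pos).2 hdδ)
    have h2 : 0 ≤ ε / 2 * (y t ^ 2 * Real.exp (-t / ε)) := by
      have := h.eps_pos; positivity
    exact mul_le_of_le_one_left h2 h1
  · have hlt1 := h.arcLength_mono ha0 (ha0.trans ht.1) ht.1
    have hlt2 := h.arcLength_mono (ha0.trans ht.1) hb0 ht.2
    set θ := (l t - l a') / δ with hθdef
    have hθ0 : 0 ≤ θ := div_nonneg (sub_nonneg.2 hlt1) hδ'pos.le
    have hθ1 : θ ≤ 1 := (div_le_one hδ'pos).2 (by rw [hδ']; linarith)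
    have hlt : l t = l a' + θ * δ := by rw [hθdef]; field_simp; ring
    have hlb' : l b' = l a' + δ := by rw [hδ']; ring
    -- In the variable l the bound `L` is a quadratic polynomial with leading coefficient λ/2, so on
    -- any subinterval it is recovered exactly from its endpoint values.
    have hLt : L t = (1 - θ) * L a' + θ * L b' - lam / 2 * θ * (1 - θ) * δ ^ 2 := by
      simp only [hL]
      rw [hlt, hlb']
      field_simp
      ring
    have hsq : d ^ 2 ≤ δ ^ 2 := pow_le_pow_left₀ hd0 hdδ 2
    have h3 : 0 ≤ -(lam / 2) * (θ * (1 - θ)) :=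
      mul_nonneg (by linarith) (mul_nonneg hθ0 (by linarith))
    rw [hLt]
    nlinarith [mul_le_mul_of_nonneg_left hLa (by linarith : 0 ≤ 1 - θ),
      mul_le_mul_of_nonneg_left hLb hθ0, mul_le_mul_of_nonneg_left hsq h3]

theorem exists_finite_mem_Ioo (h : WedMinimizer φ ε u y) {a b : ℝ} (ha : 0 ≤ a) (hab : a < b) :
    ∃ t ∈ Ioo a b, φ (u t) < ⊤ := by
  by_contra hcon
  push Not at hcon
  have h1 := ae_restrict_of_ae_restrict_of_subset
    (show Ioo a b ⊆ Ioi 0 from fun t ht => lt_of_le_of_lt ha ht.1) h.ae_lt_top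
  have h2 : ∀ᵐ t ∂(volume.restrict (Ioo a b)), False := by
    filter_upwards [h1, ae_restrict_mem measurableSet_Ioo] with t h3 h4
    exact absurd h3 (not_lt.2 (hcon t h4))
  have h3 := eventually_false_iff_eq_bot.1 h2
  rw [ae_eq_bot, Measure.restrict_eq_zero, Real.volume_Ioo] at h3
  simp at h3
  linarith

/-- The energy is finite almost everywhere, so t lies between two times of finite energy and the
chord bound applies; if no length separates the earlier time from t, u takes the same value at both.
-/
theorem energy_lt_top (h : WedMinimizer φ ε u y) {lam : ℝ} (hlam : lam < 0)
    (hconv : GeodConvex lam φ) {t : ℝ} (ht : 0 < t) : φ (u t) < ⊤ := by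
  obtain ⟨a, ha, hua⟩ := h.exists_finite_mem_Ioo le_rfl ht
  obtain ⟨b, hb, hub⟩ := h.exists_finite_mem_Ioo ht.le (lt_add_one t)
  rcases (h.arcLength_mono ha.1.le (ha.1.trans ha.2).le ha.2.le).eq_or_lt with heq | hlt
  · rwa [← h.eq_of_arcLength_eq ha.1.le ha.2.le heq]
  · have h2 := h.arcLength_mono ht.le (ht.trans hb.1).le hb.1.le
    exact (h.energy_le_chord hlam hconv ha.1.le hua hub (hlt.trans_le h2)
      ⟨ha.2.le, hb.1.le⟩).trans_lt (EReal.coe_lt_top _)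

/-- `φ ∘ u - (lam / 2) l²` is convex as a function of the arc length `l`. -/
theorem three_point (h : WedMinimizer φ ε u y) {lam : ℝ} (hlam : lam < 0)
    (hconv : GeodConvex lam φ) {a s b : ℝ} (ha : 0 ≤ a) (has : a ≤ s) (hsb : s ≤ b)
    (hua : φ (u a) < ⊤) (hub : φ (u b) < ⊤) :
    (arcLength y b - arcLength y a) * ((φ (u s)).toReal - lam / 2 * arcLength y s ^ 2) ≤
      (arcLength y b - arcLength y s) * ((φ (u a)).toReal - lam / 2 * arcLength y a ^ 2) +
      (arcLength y s - arcLength y a) * ((φ (u b)).toReal - lam / 2 * arcLength y b ^ 2) := by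
  have h1 := h.arcLength_mono ha (ha.trans has) has
  have h2 := h.arcLength_mono (ha.trans has) (ha.trans (has.trans hsb)) hsb
  rcases (h1.trans h2).eq_or_lt with heq | hlt
  · have h3 : arcLength y s = arcLength y a := le_antisymm (h2.trans heq.ge) h1
    rw [h3, heq]; simp
  · have h3 := h.energy_le_chord hlam hconv ha hua hub hlt ⟨has, hsb⟩
    have h4 : φ (u s) < ⊤ := h3.trans_lt (EReal.coe_lt_top _)
    rw [← EReal.coe_toReal h4.ne (h.ne_bot _), EReal.coe_le_coe_iff, ← sub_le_iff_le_add,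
      le_div_iff₀ (sub_pos.2 hlt)] at h3
    linarith

end WedMinimizer

end WED

namespace WED

/-! ### Continuity of the energy along a minimizer -/

variable {X : Type*} [MetricSpace X]

namespace WedMinimizer

variable {φ : X → EReal} {ε : ℝ} {u : ℝ → X} {y : ℝ → ℝ}

/-- Lower semicontinuity is half of the claim; a continuous upper barrier touching at t, in practice
a chord, supplies the other half. -/
theorem continuousWithinAt_of_le (h : WedMinimizer φ ε u y) {S : Set ℝ} (hS : S ⊆ Ici 0) {t : ℝ}
    (ht : 0 ≤ t) {g : ℝ → ℝ} (hg : ContinuousWithinAt g S t) (hgt : (g t : EReal) ≤ φ (u t))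
    (hle : ∀ᶠ s in 𝓝[S] t, φ (u s) ≤ g s) :
    ContinuousWithinAt (fun s => φ (u s)) S t := by
  refine tendsto_order.2 ⟨fun c hc => ?_, fun c hc => ?_⟩
  · exact (h.lowerSemicontinuousOn t ht c hc).filter_mono (nhdsWithin_mono t hS)
  · have h1 : ContinuousWithinAt (fun s => (g s : EReal)) S t :=
      continuous_coe_real_ereal.continuousAt.comp_continuousWithinAt hg
    filter_upwards [(tendsto_order.1 h1).2 c (hgt.trans_lt hc), hle] with s hs1 hs2
    exact hs2.trans_lt hs1

theorem continuousWithinAt_energy_Ici (h : WedMinimizer φ ε u y) {lam : ℝ} (hlam : lam < 0)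
    (hconv : GeodConvex lam φ) {t : ℝ} (ht : 0 ≤ t) (hut : φ (u t) < ⊤) :
    ContinuousWithinAt (fun s => φ (u s)) (Ici t) t := by
  have hsub : Ici t ⊆ Ici 0 := Ici_subset_Ici.2 ht
  by_cases hex : ∃ b, t < b ∧ arcLength y t < arcLength y b
  · obtain ⟨b, htb, hl⟩ := hex
    have hub := h.energy_lt_top hlam hconv (ht.trans_lt htb)
    have hlc : ContinuousWithinAt (arcLength y) (Ici t) t :=
      (h.continuousOn_arcLength t ht).mono hsub
    refine h.continuousWithinAt_of_le hsub ht (g := fun s => ((arcLength y b - arcLength y s) *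
        ((φ (u t)).toReal - lam / 2 * arcLength y t ^ 2) +
      (arcLength y s - arcLength y t) * ((φ (u b)).toReal - lam / 2 * arcLength y b ^ 2)) /
        (arcLength y b - arcLength y t) + lam / 2 * arcLength y s ^ 2) ?_ ?_ ?_
    · fun_prop
    · rw [← EReal.coe_toReal hut.ne (h.ne_bot _), EReal.coe_le_coe_iff]
      have h1 : arcLength y b - arcLength y t ≠ 0 := (sub_pos.2 hl).ne'
      rw [sub_self, zero_mul, add_zero, mul_div_cancel_left₀ _ h1, EReal.toReal_coe]
      linarith
    · filter_upwards [self_mem_nhdsWithin, nhdsWithin_le_nhds (Iio_mem_nhds htb)] with s hs1 hs2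
      exact h.energy_le_chord hlam hconv ht hut hub hl ⟨hs1, hs2.le⟩
  -- Without a later point at positive length, the curve has stopped and the energy is constant.
  · push Not at hex
    have hconst : ∀ s ∈ Ici t, φ (u s) = φ (u t) := fun s hs => by
      rcases eq_or_lt_of_le (mem_Ici.1 hs) with rfl | hlt
      · rfl
      · rw [h.eq_of_arcLength_eq ht hs (le_antisymm (h.arcLength_mono ht (hsub hs) hs) (hex s hlt))]
    exact continuousWithinAt_const.congr hconst rfl

theorem continuousWithinAt_energy_Iic (h : WedMinimizer φ ε u y) {lam : ℝ} (hlam : lam < 0)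
    (hconv : GeodConvex lam φ) {t : ℝ} (ht : 0 < t) :
    ContinuousWithinAt (fun s => φ (u s)) (Ioc 0 t) t := by
  have hsub : Ioc 0 t ⊆ Ici 0 := fun s hs => hs.1.le
  have hut := h.energy_lt_top hlam hconv ht
  by_cases hex : ∃ a, 0 < a ∧ a < t ∧ arcLength y a < arcLength y t
  · obtain ⟨a, ha, hat, hl⟩ := hex
    have hua := h.energy_lt_top hlam hconv ha
    have hlc : ContinuousWithinAt (arcLength y) (Ioc 0 t) t :=
      (h.continuousOn_arcLength t ht.le).mono hsub
    refine h.continuousWithinAt_of_le hsub ht.le (g := fun s => ((arcLength y t - arcLength y s) *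
        ((φ (u a)).toReal - lam / 2 * arcLength y a ^ 2) +
      (arcLength y s - arcLength y a) * ((φ (u t)).toReal - lam / 2 * arcLength y t ^ 2)) /
        (arcLength y t - arcLength y a) + lam / 2 * arcLength y s ^ 2) ?_ ?_ ?_
    · fun_prop
    · rw [← EReal.coe_toReal hut.ne (h.ne_bot _), EReal.coe_le_coe_iff]
      have h1 : arcLength y t - arcLength y a ≠ 0 := (sub_pos.2 hl).ne'
      rw [sub_self, zero_mul, zero_add, mul_div_cancel_left₀ _ h1, EReal.toReal_coe]
      linarith
    · filter_upwards [self_mem_nhdsWithin, nhdsWithin_le_nhds (Ioi_mem_nhds hat)] with s hs1 hs2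
      exact h.energy_le_chord hlam hconv ha.le hua hut hl ⟨hs2.le, hs1.2⟩
  · push Not at hex
    have hconst : ∀ s ∈ Ioc 0 t, φ (u s) = φ (u t) := fun s hs => by
      rcases eq_or_lt_of_le hs.2 with rfl | hlt
      · rfl
      · rw [h.eq_of_arcLength_eq hs.1.le hs.2
          (le_antisymm (h.arcLength_mono hs.1.le ht.le hs.2) (hex s hs.1 hlt))]
    exact continuousWithinAt_const.congr hconst rfl

theorem continuousAt_energy (h : WedMinimizer φ ε u y) {lam : ℝ} (hlam : lam < 0)
    (hconv : GeodConvex lam φ) {t : ℝ} (ht : 0 < t) :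
    ContinuousAt (fun s => φ (u s)) t := by
  have h1 := (h.continuousWithinAt_energy_Ici hlam hconv ht.le (h.energy_lt_top hlam hconv ht)).union
    (h.continuousWithinAt_energy_Iic hlam hconv ht)
  refine h1.continuousAt ?_
  filter_upwards [Ioi_mem_nhds ht] with s hs
  rcases le_total t s with h2 | h2
  · exact Or.inl h2
  · exact Or.inr ⟨hs, h2⟩

theorem continuousOn_toReal_energy (h : WedMinimizer φ ε u y) {lam : ℝ} (hlam : lam < 0)
    (hconv : GeodConvex lam φ) : ContinuousOn (fun s => (φ (u s)).toReal) (Ioi 0) :=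
  fun _ ht => ((EReal.tendsto_toReal (h.energy_lt_top hlam hconv ht).ne (h.ne_bot _)).comp
    (h.continuousAt_energy hlam hconv ht).tendsto).mono_left nhdsWithin_le_nhds

/-- When the initial energy is ⊤, lower semicontinuity alone forces the energies to tend to ⊤. -/
theorem continuousWithinAt_energy_zero (h : WedMinimizer φ ε u y) {lam : ℝ} (hlam : lam < 0)
    (hconv : GeodConvex lam φ) : ContinuousWithinAt (fun s => φ (u s)) (Ici 0) 0 := by
  rcases lt_or_eq_of_le (le_top (a := φ (u 0))) with hlt | heq
  · exact h.continuousWithinAt_energy_Ici hlam hconv le_rfl hlt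
  · refine tendsto_order.2 ⟨fun c hc => h.lowerSemicontinuousOn 0 (mem_Ici.2 le_rfl) c hc,
      fun c hc => ?_⟩
    exact absurd hc (by simp [heq])

end WedMinimizer

end WED

namespace WED

/-! ### Inner variations -/

theorem IsTest.exists_bound {ξ : ℝ → ℝ} (hξ : IsTest ξ) :
    ∃ K, 0 < K ∧ (∀ t, |ξ t| ≤ K) ∧ ∀ t, |deriv ξ t| ≤ K := by
  obtain ⟨C, hC⟩ := hξ.2.1.exists_bound_of_continuous hξ.1.continuous
  obtain ⟨D, hD⟩ := hξ.2.1.deriv.exists_bound_of_continuous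
    (hξ.1.continuous_deriv (by simp))
  refine ⟨max 1 (max C D), by positivity, fun t => ?_, fun t => ?_⟩
  · exact (hC t).trans ((le_max_left _ _).trans (le_max_right _ _))
  · exact (hD t).trans ((le_max_right _ _).trans (le_max_right _ _))

theorem IsTest.eq_zero {ξ : ℝ → ℝ} (hξ : IsTest ξ) {t : ℝ} (ht : t ≤ 0) : ξ t = 0 :=
  image_eq_zero_of_notMem_tsupport fun h => absurd (hξ.2.2 h) (not_lt.2 ht)

theorem IsTest.hasDerivAt {ξ : ℝ → ℝ} (hξ : IsTest ξ) (t : ℝ) : HasDerivAt ξ (deriv ξ t) t :=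
  (hξ.1.differentiable (by simp)).differentiableAt.hasDerivAt

theorem IsTest.continuous_deriv {ξ : ℝ → ℝ} (hξ : IsTest ξ) : Continuous (deriv ξ) :=
  hξ.1.continuous_deriv (by simp)

/-- A small multiple of a test function perturbs the identity to an increasing homeomorphism. -/
theorem IsTest.exists_orderIso {ξ : ℝ → ℝ} (hξ : IsTest ξ) {K τ : ℝ} (hK : ∀ t, |ξ t| ≤ K)
    (hK' : ∀ t, |deriv ξ t| ≤ K) (hτ : |τ| * K ≤ 1 / 2) :
    ∃ e : ℝ ≃o ℝ, (∀ t, e t = t + τ * ξ t) ∧ (∀ t, 1 / 2 ≤ 1 + τ * deriv ξ t) := by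
  have hb : ∀ t, |τ * ξ t| ≤ 1 / 2 := fun t => by
    rw [abs_mul]; exact (mul_le_mul_of_nonneg_left (hK t) (abs_nonneg _)).trans hτ
  have hb' : ∀ t, 1 / 2 ≤ 1 + τ * deriv ξ t := fun t => by
    have : |τ * deriv ξ t| ≤ 1 / 2 := by
      rw [abs_mul]; exact (mul_le_mul_of_nonneg_left (hK' t) (abs_nonneg _)).trans hτ
    linarith [(abs_le.1 this).1]
  have hd : ∀ t, HasDerivAt (fun t => t + τ * ξ t) (1 + τ * deriv ξ t) t := fun t =>
    (hasDerivAt_id t).add ((hξ.hasDerivAt t).const_mul τ)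
  have hmono : StrictMono fun t => t + τ * ξ t := strictMono_of_deriv_pos fun t => by
    rw [(hd t).deriv]; linarith [hb' t]
  have hcont : Continuous fun t => t + τ * ξ t := by
    have := hξ.1.continuous
    fun_prop
  have hsurj : Function.Surjective fun t => t + τ * ξ t := by
    refine hcont.surjective ?_ ?_
    · refine tendsto_atTop_mono (fun t => ?_) (tendsto_atTop_add_const_right _ (-(1 / 2)) tendsto_id)
      simp only [id]
      linarith [(abs_le.1 (hb t)).1]
    · refine tendsto_atBot_mono (fun t => ?_) (tendsto_atBot_add_const_right _ (1 / 2) tendsto_id)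
      simp only [id]
      linarith [(abs_le.1 (hb t)).2]
  exact ⟨hmono.orderIsoOfSurjective _ hsurj, fun t => rfl, hb'⟩

variable {X : Type*} [MetricSpace X]

namespace WedMinimizer

variable {φ : X → EReal} {ε : ℝ} {u : ℝ → X} {y : ℝ → ℝ}

/-- The competitor is u∘e⁻¹ with e(s) = s + τξ(s), whose speed at e(s) is y(s)/(1 + τξ'(s)).
Substituting t = e(s) multiplies by the Jacobian 1 + τξ', so the kinetic term keeps one inverse
factor. In this form τ enters only through smooth functions. -/
theorem minimal_reparam (h : WedMinimizer φ ε u y) (hfin : ∀ t, 0 < t → φ (u t) < ⊤)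
    {ξ : ℝ → ℝ} (hξ : IsTest ξ) {K τ : ℝ}
    (hK : ∀ t, |ξ t| ≤ K) (hK' : ∀ t, |deriv ξ t| ≤ K) (hτ : |τ| * K ≤ 1 / 2) :
    ∫ s in Ioi 0, (ε / 2 * y s ^ 2 + (φ (u s)).toReal) * Real.exp (-s / ε) ≤
      ∫ s in Ioi 0, (ε / 2 * y s ^ 2 * (1 + τ * deriv ξ s)⁻¹ +
        (φ (u s)).toReal * (1 + τ * deriv ξ s)) * Real.exp (-(s + τ * ξ s) / ε) := by
  obtain ⟨e, he, hpos⟩ := hξ.exists_orderIso hK hK' hτ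
  have hε := h.eps_pos
  have hr : ∀ s, 0 < 1 + τ * deriv ξ s := fun s => by linarith [hpos s]
  have hτξ : ∀ s, |τ * ξ s| ≤ 1 / 2 := fun s => by
    rw [abs_mul]; exact (mul_le_mul_of_nonneg_left (hK s) (abs_nonneg _)).trans hτ
  have hr2 : ∀ s, 1 + τ * deriv ξ s ≤ 3 / 2 := fun s => by
    have : |τ * deriv ξ s| ≤ 1 / 2 := by
      rw [abs_mul]; exact (mul_le_mul_of_nonneg_left (hK' s) (abs_nonneg _)).trans hτ
    linarith [(abs_le.1 this).2]
  have hd : ∀ t, HasDerivAt e (1 + τ * deriv ξ t) t := fun t => by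
    have : (e : ℝ → ℝ) = fun t => t + τ * ξ t := funext he
    rw [this]
    exact (hasDerivAt_id t).add ((hξ.hasDerivAt t).const_mul τ)
  have he0 : e 0 = 0 := by rw [he, hξ.eq_zero le_rfl]; simp
  have hs0 : e.symm 0 = 0 := by rw [← he0, e.symm_apply_apply, he0]
  have himage : e '' Ioi 0 = Ioi 0 := by rw [e.image_Ioi, he0]
  have hξc := hξ.1.continuous
  have hξc' := hξ.continuous_deriv
  have hsc : Continuous e.symm := e.symm.continuous
  have cvi : ∀ (S : Set ℝ), MeasurableSet S → ∀ g : ℝ → ℝ, IntegrableOn g (e '' S) ↔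
      IntegrableOn (fun s => (1 + τ * deriv ξ s) * g (e s)) S := fun S hS g => by
    rw [integrableOn_image_iff_integrableOn_abs_deriv_smul hS
      (fun s _ => (hd s).hasDerivWithinAt) e.injective.injOn]
    simp_rw [abs_of_pos (hr _), smul_eq_mul]
  have cv : ∀ (S : Set ℝ), MeasurableSet S → ∀ g : ℝ → ℝ, ∫ t in e '' S, g t =
      ∫ s in S, (1 + τ * deriv ξ s) * g (e s) := fun S hS g => by
    rw [integral_image_eq_integral_abs_deriv_smul hS
      (fun s _ => (hd s).hasDerivWithinAt) e.injective.injOn]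
    simp_rw [abs_of_pos (hr _), smul_eq_mul]
  set M : ℝ → ℝ := fun t => y (e.symm t) * (1 + τ * deriv ξ (e.symm t))⁻¹ with hM
  set Φ : ℝ → ℝ := fun t => (φ (u (e.symm t))).toReal with hΦ
  have hMe : ∀ s, M (e s) = y s * (1 + τ * deriv ξ s)⁻¹ := fun s => by
    simp only [hM, e.symm_apply_apply]
  have hΦe : ∀ s, Φ (e s) = (φ (u s)).toReal := fun s => by simp only [hΦ, e.symm_apply_apply]
  have hMm : Measurable M :=
    (h.meas.comp hsc.measurable).mul
      ((measurable_const.add ((hξc'.measurable.comp hsc.measurable).const_mul τ)).inv)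
  have hexp : ∀ s, Real.exp (-(s + τ * ξ s) / ε) =
      Real.exp (-s / ε) * Real.exp (-(τ * ξ s) / ε) := fun s => by
    rw [← Real.exp_add]; congr 1; ring
  have hexpb : ∀ s, ‖Real.exp (-(τ * ξ s) / ε)‖ ≤ Real.exp (1 / ε) := fun s => by
    rw [Real.norm_of_nonneg (Real.exp_pos _).le, Real.exp_le_exp]
    gcongr
    linarith [(abs_le.1 (hτξ s)).1]
  have hMi : IntegrableOn (fun t => M t ^ 2 * Real.exp (-t / ε)) (Ioi 0) := by
    rw [← himage, cvi _ measurableSet_Ioi]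
    have h1 : IntegrableOn (fun s => ((1 + τ * deriv ξ s)⁻¹ * Real.exp (-(τ * ξ s) / ε)) *
        (y s ^ 2 * Real.exp (-s / ε))) (Ioi 0) := by
      refine h.int_speed.bdd_mul (c := 2 * Real.exp (1 / ε)) ?_ (Eventually.of_forall fun s => ?_)
      · refine Continuous.aestronglyMeasurable ?_
        refine Continuous.mul (Continuous.inv₀ (by fun_prop) fun s => (hr s).ne') (by fun_prop)
      · rw [norm_mul]
        refine mul_le_mul ?_ (hexpb s) (norm_nonneg _) (by norm_num)
        rw [norm_inv, Real.norm_of_nonneg (hr s).le]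
        refine (inv_anti₀ (by norm_num) (hpos s)).trans (by norm_num)
    refine h1.congr_fun (fun s _ => ?_) measurableSet_Ioi
    simp only
    rw [hMe, he, hexp]
    have := (hr s).ne'
    field_simp
  have hΦi : IntegrableOn (fun t => Φ t * Real.exp (-t / ε)) (Ioi 0) := by
    rw [← himage, cvi _ measurableSet_Ioi]
    have h1 : IntegrableOn (fun s => ((1 + τ * deriv ξ s) * Real.exp (-(τ * ξ s) / ε)) *
        ((φ (u s)).toReal * Real.exp (-s / ε))) (Ioi 0) := by
      refine h.int_energy.bdd_mul (c := 2 * Real.exp (1 / ε)) ?_ (Eventually.of_forall fun s => ?_)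
      · refine Continuous.aestronglyMeasurable ?_
        fun_prop
      · rw [norm_mul]
        refine mul_le_mul ?_ (hexpb s) (norm_nonneg _) (by norm_num)
        rw [Real.norm_of_nonneg (hr s).le]
        linarith [hr2 s]
    refine h1.congr_fun (fun s _ => ?_) measurableSet_Ioi
    simp only
    rw [hΦe, he, hexp]
    ring
  have hML : ∀ T, MemLp M 2 (volume.restrict (Icc 0 T)) := fun T => by
    rw [memLp_two_iff_integrable_sq hMm.aestronglyMeasurable]
    have h1 : IntegrableOn (fun t => M t ^ 2 * Real.exp (-t / ε)) (Icc 0 T) :=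
      ((integrableOn_Ici_iff_integrableOn_Ioi).2 hMi).mono_set Icc_subset_Ici_self
    have h2 := h1.mul_continuousOn (g' := fun t => Real.exp (t / ε))
      (by fun_prop) isCompact_Icc
    refine h2.congr_fun (fun t _ => ?_) measurableSet_Icc
    simp only
    rw [mul_assoc, ← Real.exp_add, neg_div, neg_add_cancel, Real.exp_zero, mul_one]
  have hdist : ∀ s t, 0 ≤ s → s ≤ t →
      dist ((u ∘ e.symm) s) ((u ∘ e.symm) t) ≤ ∫ r in s..t, M r := by
    intro s t hs hst
    have hs' : 0 ≤ e.symm s := by rw [← hs0]; exact e.symm.monotone hs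
    have hst' : e.symm s ≤ e.symm t := e.symm.monotone hst
    refine (h.dist_le _ _ hs' hst').trans_eq ?_
    have h1 : e '' Ioc (e.symm s) (e.symm t) = Ioc s t := by
      rw [e.image_Ioc, e.apply_symm_apply, e.apply_symm_apply]
    rw [intervalIntegral.integral_of_le hst', intervalIntegral.integral_of_le hst, ← h1,
      cv _ measurableSet_Ioc]
    refine setIntegral_congr_fun measurableSet_Ioc fun r _ => ?_
    rw [hMe]
    have := (hr r).ne'
    field_simp
  have hle : ∀ᵐ t ∂(volume.restrict (Ioi (0 : ℝ))), φ ((u ∘ e.symm) t) ≤ (Φ t : EReal) := by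
    filter_upwards [ae_restrict_mem measurableSet_Ioi] with t ht
    have h1 : 0 < e.symm t := by rw [← hs0]; exact e.symm.strictMono ht
    exact EReal.le_coe_toReal (hfin _ h1).ne
  have key := h.minimal (u ∘ e.symm) M Φ (by simp [hs0]) hML hdist hle hMi hΦi
  refine key.trans_eq ?_
  conv_lhs => rw [← himage]
  rw [cv _ measurableSet_Ioi]
  refine setIntegral_congr_fun measurableSet_Ioi fun s _ => ?_
  rw [hMe, hΦe, he]
  have := (hr s).ne'
  field_simp

/-- Stationarity with respect to inner variations, in weighted form. -/
theorem stationary_weighted (h : WedMinimizer φ ε u y) (hfin : ∀ t, 0 < t → φ (u t) < ⊤)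
    {ξ : ℝ → ℝ} (hξ : IsTest ξ) :
    ∫ s in Ioi 0, (((φ (u s)).toReal - ε / 2 * y s ^ 2) * deriv ξ s -
      (ε / 2 * y s ^ 2 + (φ (u s)).toReal) * (ξ s / ε)) * Real.exp (-s / ε) = 0 := by
  obtain ⟨K, hK0, hK, hK'⟩ := hξ.exists_bound
  have hε := h.eps_pos
  have hξc := hξ.1.continuous
  have hξc' := hξ.continuous_deriv
  set F : ℝ → ℝ := fun s => (φ (u s)).toReal with hF
  set J : ℝ → ℝ → ℝ := fun τ s => (ε / 2 * y s ^ 2 * (1 + τ * deriv ξ s)⁻¹ +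
        F s * (1 + τ * deriv ξ s)) * Real.exp (-(s + τ * ξ s) / ε) with hJ
  set J' : ℝ → ℝ → ℝ := fun τ s =>
    (ε / 2 * y s ^ 2 * (-deriv ξ s / (1 + τ * deriv ξ s) ^ 2) + F s * deriv ξ s) *
      Real.exp (-(s + τ * ξ s) / ε) + (ε / 2 * y s ^ 2 * (1 + τ * deriv ξ s)⁻¹ +
        F s * (1 + τ * deriv ξ s)) * (Real.exp (-(s + τ * ξ s) / ε) * (-ξ s / ε)) with hJ'
  -- For |τ| < τ₀ the Jacobian stays between 1/2 and 3/2.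
  set τ₀ : ℝ := 1 / (2 * K) with hτ₀
  have hτ₀pos : 0 < τ₀ := by positivity
  have hτ : ∀ τ ∈ Metric.ball (0 : ℝ) τ₀, |τ| * K ≤ 1 / 2 := fun τ hτ => by
    rw [mem_ball_zero_iff, Real.norm_eq_abs] at hτ
    calc |τ| * K ≤ τ₀ * K := by gcongr
      _ = 1 / 2 := by rw [hτ₀]; field_simp
  have hr : ∀ τ ∈ Metric.ball (0 : ℝ) τ₀, ∀ s, |τ * ξ s| ≤ 1 / 2 ∧ 1 / 2 ≤ 1 + τ * deriv ξ s ∧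
      1 + τ * deriv ξ s ≤ 3 / 2 := fun τ hτ' s => by
    have h1 : |τ * deriv ξ s| ≤ 1 / 2 := by
      rw [abs_mul]; exact (mul_le_mul_of_nonneg_left (hK' s) (abs_nonneg _)).trans (hτ τ hτ')
    have h2 : |τ * ξ s| ≤ 1 / 2 := by
      rw [abs_mul]; exact (mul_le_mul_of_nonneg_left (hK s) (abs_nonneg _)).trans (hτ τ hτ')
    exact ⟨h2, by linarith [(abs_le.1 h1).1], by linarith [(abs_le.1 h1).2]⟩
  have hFm : AEStronglyMeasurable F (volume.restrict (Ioi 0)) := by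
    have h1 := h.int_energy.aestronglyMeasurable.mul
      (Continuous.aestronglyMeasurable (f := fun t : ℝ => Real.exp (t / ε)) (by fun_prop))
    refine h1.congr (Eventually.of_forall fun t => ?_)
    simp only [Pi.mul_apply]
    rw [mul_assoc, ← Real.exp_add, neg_div, neg_add_cancel, Real.exp_zero, mul_one]
  have hym : AEStronglyMeasurable (fun s => ε / 2 * y s ^ 2) (volume.restrict (Ioi 0)) :=
    ((h.meas.pow_const 2).const_mul _).aestronglyMeasurable
  have hJm : ∀ τ, AEStronglyMeasurable (J τ) (volume.restrict (Ioi 0)) := fun τ => by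
    have hm1 : AEStronglyMeasurable (fun s => (1 + τ * deriv ξ s)⁻¹) (volume.restrict (Ioi 0)) :=
      ((measurable_const.add (hξc'.measurable.const_mul τ)).inv).aestronglyMeasurable
    have hm2 : AEStronglyMeasurable (fun s => 1 + τ * deriv ξ s) (volume.restrict (Ioi 0)) :=
      Continuous.aestronglyMeasurable (by fun_prop)
    have hm3 : AEStronglyMeasurable (fun s => Real.exp (-(s + τ * ξ s) / ε))
      (volume.restrict (Ioi 0)) := Continuous.aestronglyMeasurable (by fun_prop)
    exact ((hym.mul hm1).add (hFm.mul hm2)).mul hm3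
  have hJ0 : J 0 = fun s => (ε / 2 * y s ^ 2 + F s) * Real.exp (-s / ε) := by
    ext s; simp [hJ]
  have hJ0i : Integrable (J 0) (volume.restrict (Ioi 0)) := by
    rw [hJ0]
    refine ((h.int_speed.const_mul (ε / 2)).add h.int_energy).congr (Eventually.of_forall fun t => ?_)
    simp only [Pi.add_apply, hF]; ring
  have hJ'0 : J' 0 = fun s => ((F s - ε / 2 * y s ^ 2) * deriv ξ s -
      (ε / 2 * y s ^ 2 + F s) * (ξ s / ε)) * Real.exp (-s / ε) := by
    ext s; simp only [hJ']; simp; ring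
  have hJ'm : AEStronglyMeasurable (J' 0) (volume.restrict (Ioi 0)) := by
    rw [hJ'0]
    have hm1 : AEStronglyMeasurable (deriv ξ) (volume.restrict (Ioi 0)) :=
      hξc'.aestronglyMeasurable
    have hm2 : AEStronglyMeasurable (fun s => ξ s / ε) (volume.restrict (Ioi 0)) :=
      Continuous.aestronglyMeasurable (by fun_prop)
    have hm3 : AEStronglyMeasurable (fun s : ℝ => Real.exp (-s / ε))
      (volume.restrict (Ioi 0)) := Continuous.aestronglyMeasurable (by fun_prop)
    exact (((hFm.sub hym).mul hm1).sub ((hym.add hFm).mul hm2)).mul hm3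
  -- The 4 bounds (1 + τξ')⁻², the 2 bounds both 1 + τξ' and its inverse, and the exponential bounds
  -- the shift of the weight.
  set C : ℝ := (4 * K + 2 * (K / ε)) * Real.exp (1 / ε) with hC
  have hbound : ∀ s, ∀ τ ∈ Metric.ball (0 : ℝ) τ₀, ‖J' τ s‖ ≤
      C * (ε / 2 * (y s ^ 2 * Real.exp (-s / ε)) + ‖F s * Real.exp (-s / ε)‖) := by
    intro s τ hτ'
    obtain ⟨h1, h2, h3⟩ := hr τ hτ' s
    have hrpos : 0 < 1 + τ * deriv ξ s := by linarith
    have hexp : Real.exp (-(s + τ * ξ s) / ε) ≤ Real.exp (-s / ε) * Real.exp (1 / ε) := by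
      rw [← Real.exp_add, Real.exp_le_exp, ← add_div]
      gcongr
      linarith [(abs_le.1 h1).1]
    have hinv : (1 + τ * deriv ξ s)⁻¹ ≤ 2 := (inv_anti₀ (by norm_num) h2).trans (by norm_num)
    have hw0 : 0 ≤ ε / 2 * y s ^ 2 := by positivity
    have hq : |(-deriv ξ s / (1 + τ * deriv ξ s) ^ 2)| ≤ 4 * K := by
      rw [abs_div, abs_neg, abs_of_pos (by positivity : 0 < (1 + τ * deriv ξ s) ^ 2),
        div_le_iff₀ (by positivity)]
      have hsq : 1 / 4 ≤ (1 + τ * deriv ξ s) ^ 2 := by nlinarith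
      have := mul_le_mul_of_nonneg_left hsq (by positivity : 0 ≤ 4 * K)
      linarith [hK' s]
    have hA : |ε / 2 * y s ^ 2 * (-deriv ξ s / (1 + τ * deriv ξ s) ^ 2) + F s * deriv ξ s| ≤
        (ε / 2 * y s ^ 2 + |F s|) * (4 * K) := by
      refine (abs_add_le _ _).trans ?_
      rw [abs_mul (ε / 2 * y s ^ 2), abs_mul (F s), abs_of_nonneg hw0, add_mul]
      refine add_le_add (mul_le_mul_of_nonneg_left hq hw0) ?_
      exact mul_le_mul_of_nonneg_left ((hK' s).trans (by linarith)) (abs_nonneg _)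
    have hB : |(ε / 2 * y s ^ 2 * (1 + τ * deriv ξ s)⁻¹ + F s * (1 + τ * deriv ξ s))| ≤
        (ε / 2 * y s ^ 2 + |F s|) * 2 := by
      refine (abs_add_le _ _).trans ?_
      rw [abs_mul (ε / 2 * y s ^ 2), abs_mul (F s), abs_of_nonneg hw0, add_mul, abs_of_pos hrpos,
        abs_of_pos (inv_pos.2 hrpos)]
      refine add_le_add (mul_le_mul_of_nonneg_left hinv hw0) ?_
      exact mul_le_mul_of_nonneg_left (by linarith) (abs_nonneg _)
    have hD : |(-ξ s / ε)| ≤ K / ε := by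
      rw [abs_div, abs_neg, abs_of_pos hε]
      gcongr
      exact hK s
    have hE := Real.exp_pos (-(s + τ * ξ s) / ε)
    calc ‖J' τ s‖ ≤ (ε / 2 * y s ^ 2 + |F s|) * (4 * K) * Real.exp (-(s + τ * ξ s) / ε) +
          (ε / 2 * y s ^ 2 + |F s|) * 2 * (Real.exp (-(s + τ * ξ s) / ε) * (K / ε)) := by
          rw [Real.norm_eq_abs]
          refine (abs_add_le _ _).trans ?_
          rw [abs_mul, abs_mul, abs_mul (Real.exp _), abs_of_pos hE]
          gcongr
      _ = (ε / 2 * y s ^ 2 + |F s|) * (4 * K + 2 * (K / ε)) * Real.exp (-(s + τ * ξ s) / ε) := by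
          ring
      _ ≤ (ε / 2 * y s ^ 2 + |F s|) * (4 * K + 2 * (K / ε)) *
            (Real.exp (-s / ε) * Real.exp (1 / ε)) := by gcongr
      _ = _ := by
          rw [norm_mul, Real.norm_eq_abs, Real.norm_of_nonneg (Real.exp_pos _).le, hC]; ring
  have hbi : Integrable (fun s => C * (ε / 2 * (y s ^ 2 * Real.exp (-s / ε)) +
      ‖F s * Real.exp (-s / ε)‖)) (volume.restrict (Ioi 0)) :=
    ((h.int_speed.const_mul (ε / 2)).add h.int_energy.norm).const_mul C
  have hdiff : ∀ s, ∀ τ ∈ Metric.ball (0 : ℝ) τ₀, HasDerivAt (J · s) (J' τ s) τ := by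
    intro s τ hτ'
    obtain ⟨h1, h2, h3⟩ := hr τ hτ' s
    have hne : 1 + τ * deriv ξ s ≠ 0 := by linarith
    have d1 : HasDerivAt (fun τ : ℝ => 1 + τ * deriv ξ s) (deriv ξ s) τ := by
      simpa using ((hasDerivAt_id τ).mul_const (deriv ξ s)).const_add 1
    have d2 : HasDerivAt (fun τ : ℝ => -(s + τ * ξ s) / ε) (-ξ s / ε) τ := by
      simpa using ((((hasDerivAt_id τ).mul_const (ξ s)).const_add s).neg).div_const ε
    exact (((d1.inv hne).const_mul _).add (d1.const_mul _)).mul d2.exp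
  obtain ⟨-, hD⟩ := hasDerivAt_integral_of_dominated_loc_of_deriv_le
    (Metric.ball_mem_nhds (0 : ℝ) hτ₀pos) (Eventually.of_forall hJm) hJ0i hJ'm
    (Eventually.of_forall hbound) hbi (Eventually.of_forall hdiff)
  -- τ = 0 corresponds to u itself, so the derivative under the integral vanishes there.
  have hmin : IsLocalMin (fun τ => ∫ s in Ioi 0, J τ s) 0 := by
    filter_upwards [Metric.ball_mem_nhds (0 : ℝ) hτ₀pos] with τ hτ'
    rw [hJ0]
    exact h.minimal_reparam hfin hξ hK hK' (hτ τ hτ')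
  have := hmin.hasDerivAt_eq_zero hD
  rwa [hJ'0] at this

/-- Stationarity with respect to inner variations: `(φ ∘ u - (ε / 2) |u'|²)' = - |u'|²` in the
sense of distributions. -/
theorem stationary (h : WedMinimizer φ ε u y) (hfin : ∀ t, 0 < t → φ (u t) < ⊤)
    {η : ℝ → ℝ} (hη : IsTest η) :
    ∫ s in Ioi 0, (((φ (u s)).toReal - ε / 2 * y s ^ 2) * deriv η s - y s ^ 2 * η s) = 0 := by
  have hε := h.eps_pos
  -- This factor cancels the weight; its derivative contributes η/ε, which cancels the energy in the
  -- zeroth-order term and leaves -|u'|²η.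
  set ξ : ℝ → ℝ := fun s => Real.exp (s / ε) * η s with hξdef
  have hsupp : tsupport ξ ⊆ tsupport η := by
    refine closure_mono fun s hs => ?_
    simp only [hξdef, Function.mem_support] at hs ⊢
    exact right_ne_zero_of_mul hs
  have hξ : IsTest ξ := by
    refine ⟨?_, ?_, hsupp.trans hη.2.2⟩
    · have := hη.1
      fun_prop
    · exact hη.2.1.of_isClosed_subset (isClosed_tsupport _) hsupp
  refine Eq.trans ?_ (h.stationary_weighted hfin hξ)
  refine setIntegral_congr_fun measurableSet_Ioi fun s _ => ?_
  have hd : deriv ξ s = Real.exp (s / ε) * (deriv η s + η s / ε) := by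
    have h1 : HasDerivAt (fun s : ℝ => Real.exp (s / ε)) (Real.exp (s / ε) * (1 / ε)) s :=
      ((hasDerivAt_id s).div_const ε).exp
    refine (h1.mul (hη.hasDerivAt s)).deriv.trans ?_
    ring
  have he : Real.exp (s / ε) * Real.exp (-s / ε) = 1 := by
    rw [← Real.exp_add, neg_div, add_neg_cancel, Real.exp_zero]
  rw [hd]
  simp only [hξdef]
  set E := Real.exp (s / ε)
  set E' := Real.exp (-s / ε)
  have h2 : ∀ a b : ℝ, (a * (E * (deriv η s + η s / ε)) - b * (E * η s / ε)) * E' =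
      (a * (deriv η s + η s / ε) - b * (η s / ε)) * (E * E') := fun a b => by ring
  rw [h2, he]
  field_simp
  ring

end WedMinimizer

end WED

namespace WED

/-! ### Test functions and the lemma of du Bois-Reymond on `(0, ∞)` -/

theorem IsTest.exists_Icc {ξ : ℝ → ℝ} (hξ : IsTest ξ) :
    ∃ a b, 0 < a ∧ a < b ∧ ∀ t, t ∉ Icc a b → ξ t = 0 := by
  rcases (tsupport ξ).eq_empty_or_nonempty with hemp | hne
  · refine ⟨1, 2, one_pos, one_lt_two, fun t _ => image_eq_zero_of_notMem_tsupport ?_⟩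
    rw [hemp]; exact notMem_empty t
  · have hc : IsCompact (tsupport ξ) := hξ.2.1
    obtain ⟨a, ha, hamin⟩ := hc.exists_isLeast hne
    obtain ⟨b, hb, hbmax⟩ := hc.exists_isGreatest hne
    refine ⟨a, b + 1, hξ.2.2 ha, by linarith [hamin hb], fun t ht =>
      image_eq_zero_of_notMem_tsupport fun h => ht ⟨hamin h, by linarith [hbmax h]⟩⟩

theorem IsTest.of_eq_zero {ξ : ℝ → ℝ} (hξ : ContDiff ℝ ∞ ξ) {a b : ℝ} (ha : 0 < a)
    (h : ∀ t, t ∉ Icc a b → ξ t = 0) : IsTest ξ := by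
  have hsub : tsupport ξ ⊆ Icc a b :=
    closure_minimal (fun t ht => by_contra fun hn => ht (h t hn)) isClosed_Icc
  exact ⟨hξ, isCompact_Icc.of_isClosed_subset (isClosed_tsupport _) hsub,
    fun t ht => ha.trans_le (hsub ht).1⟩

theorem IsTest.deriv {ξ : ℝ → ℝ} (hξ : IsTest ξ) : IsTest (deriv ξ) :=
  ⟨(contDiff_infty_iff_deriv.1 hξ.1).2, hξ.2.1.deriv,
    tsupport_deriv_subset.trans hξ.2.2⟩

theorem IsTest.integrableOn_mul {ξ ζ : ℝ → ℝ} (hξ : IsTest ξ)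
    (hζ : LocallyIntegrableOn ζ (Ioi 0)) : IntegrableOn (fun t => ζ t * ξ t) (Ioi 0) := by
  obtain ⟨a, b, ha, hab, h0⟩ := hξ.exists_Icc
  have hsub : Icc a b ⊆ Ioi 0 := fun t ht => ha.trans_le ht.1
  have h1 : IntegrableOn (fun t => ζ t * ξ t) (Icc a b) :=
    (hζ.integrableOn_compact_subset hsub isCompact_Icc).mul_continuousOn
      hξ.1.continuous.continuousOn isCompact_Icc
  exact (h1.integrable_of_forall_notMem_eq_zero fun t ht => by rw [h0 t ht, mul_zero]).integrableOn

/-- Zero mean is what makes the primitive vanish again to the right of the support. -/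
theorem IsTest.primitive {q : ℝ → ℝ} (hq : IsTest q) (hint : ∫ t in Ioi 0, q t = 0) :
    IsTest (fun t => ∫ r in (0 : ℝ)..t, q r) ∧
      _root_.deriv (fun t => ∫ r in (0 : ℝ)..t, q r) = q := by
  obtain ⟨a, b, ha, hab, h0⟩ := hq.exists_Icc
  have hqc := hq.1.continuous
  have hder : ∀ t, HasDerivAt (fun t => ∫ r in (0 : ℝ)..t, q r) (q t) t := fun t =>
    hqc.integral_hasStrictDerivAt 0 t |>.hasDerivAt
  have hder' : _root_.deriv (fun t => ∫ r in (0 : ℝ)..t, q r) = q := funext fun t => (hder t).deriv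
  refine ⟨IsTest.of_eq_zero (a := a) (b := b) ?_ ha fun t ht => ?_, hder'⟩
  · rw [contDiff_infty_iff_deriv, hder']
    exact ⟨fun t => (hder t).differentiableAt, hq.1⟩
  · rcases lt_or_ge t a with hta | hta
    · refine intervalIntegral.integral_zero_ae (Eventually.of_forall fun r hr => h0 r fun hr' => ?_)
      have : r ≤ max 0 t := (uIoc_subset_uIcc hr).2
      rcases le_max_iff.1 this with h | h
      · linarith [hr'.1]
      · linarith [hr'.1]
    · have htb : b < t := by
        by_contra hn
        exact ht ⟨hta, not_lt.1 hn⟩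
      rw [intervalIntegral.integral_of_le (ha.le.trans hta)]
      refine Eq.trans ?_ hint
      exact (setIntegral_eq_of_subset_of_forall_sdiff_eq_zero measurableSet_Ioi Ioc_subset_Ioi_self
        fun r hr => h0 r fun hr' => hr.2 ⟨hr.1, hr'.2.trans htb.le⟩).symm

theorem ae_eq_const_of_integral_mul_deriv_eq_zero {ζ : ℝ → ℝ}
    (hζ : LocallyIntegrableOn ζ (Ioi 0))
    (h : ∀ η, IsTest η → ∫ t in Ioi 0, ζ t * deriv η t = 0) :
    ∃ c, ∀ᵐ t ∂(volume.restrict (Ioi (0 : ℝ))), ζ t = c := by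
  let f : ContDiffBump (2 : ℝ) := ⟨1 / 2, 1, by norm_num, by norm_num⟩
  set ψ : ℝ → ℝ := f.normed volume with hψ
  have hψt : IsTest ψ := by
    refine ⟨f.contDiff_normed, f.hasCompactSupport_normed, ?_⟩
    rw [hψ, f.tsupport_normed_eq, Real.closedBall_eq_Icc]
    intro t ht
    have : (2 : ℝ) - 1 ≤ t := ht.1
    exact mem_Ioi.2 (by linarith)
  have hIoi : ∀ q, IsTest q → ∫ t in Ioi 0, q t = ∫ t, q t := fun q hq =>
    setIntegral_eq_integral_of_forall_compl_eq_zero fun t ht => hq.eq_zero (not_lt.1 ht)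
  have hψ1 : ∫ t in Ioi 0, ψ t = 1 := by rw [hIoi ψ hψt]; exact f.integral_normed
  refine ⟨∫ t in Ioi 0, ζ t * ψ t, ?_⟩
  set c := ∫ t in Ioi 0, ζ t * ψ t with hc
  have hloc : LocallyIntegrableOn (fun t => ζ t - c) (Ioi 0) :=
    hζ.sub ((locallyIntegrable_const c).locallyIntegrableOn _)
  have key := isOpen_Ioi.ae_eq_zero_of_integral_contDiff_smul_eq_zero hloc fun g hg hgc hgs => by
    have hgt : IsTest g := ⟨hg, hgc, hgs⟩
    have hgi : IntegrableOn g (Ioi 0) :=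
      (hg.continuous.integrable_of_hasCompactSupport hgc).integrableOn
    have hψi : IntegrableOn ψ (Ioi 0) :=
      (hψt.1.continuous.integrable_of_hasCompactSupport hψt.2.1).integrableOn
    set I := ∫ t in Ioi 0, g t with hI
    -- Subtracting the mean along the unit-mass bump ψ makes `g` a derivative of a test function;
    -- the constant is then forced to be the pairing of ζ with ψ.
    have hq : IsTest fun t => g t - I * ψ t := by
      obtain ⟨a, b, ha, hab, h1⟩ := hgt.exists_Icc
      obtain ⟨a', b', ha', hab', h2⟩ := hψt.exists_Icc
      refine IsTest.of_eq_zero (a := min a a') (b := max b b') ?_ (lt_min ha ha') fun t ht => ?_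
      · have := hψt.1
        fun_prop
      · rw [h1 t fun h => ht ⟨(min_le_left _ _).trans h.1, h.2.trans (le_max_left _ _)⟩,
          h2 t fun h => ht ⟨(min_le_right _ _).trans h.1, h.2.trans (le_max_right _ _)⟩]
        ring
    have hq0 : ∫ t in Ioi 0, (g t - I * ψ t) = 0 := by
      rw [integral_sub hgi (hψi.const_mul I), integral_const_mul, hψ1]; ring
    obtain ⟨hη, hη'⟩ := hq.primitive hq0
    have h3 := h _ hη
    rw [hη'] at h3
    have h4 : ∀ t, ζ t * (g t - I * ψ t) = ζ t * g t - I * (ζ t * ψ t) := fun t => by ring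
    simp_rw [h4] at h3
    rw [integral_sub (hgt.integrableOn_mul hζ) ((hψt.integrableOn_mul hζ).const_mul I),
      integral_const_mul] at h3
    have h5 : ∫ t, g t • (ζ t - c) = ∫ t in Ioi 0, (ζ t * g t - c * g t) := by
      rw [← setIntegral_eq_integral_of_forall_compl_eq_zero (s := Ioi 0)]
      · exact setIntegral_congr_fun measurableSet_Ioi fun t _ => by simp only [smul_eq_mul]; ring
      · intro t ht
        rw [hgt.eq_zero (not_lt.1 ht), zero_smul]
    rw [h5, integral_sub (hgt.integrableOn_mul hζ) (hgi.const_mul c), integral_const_mul]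
    linarith
  refine (ae_restrict_iff' measurableSet_Ioi).2 ?_
  filter_upwards [key] with t ht htI
  linarith [ht htI]

/-! ### The first integral of a minimizer -/

variable {X : Type*} [MetricSpace X]

/-- `∫_0^t |u'|²`. -/
noncomputable def sqIntegral (y : ℝ → ℝ) (t : ℝ) : ℝ := ∫ r in (0 : ℝ)..t, y r ^ 2

namespace WedMinimizer

variable {φ : X → EReal} {ε : ℝ} {u : ℝ → X} {y : ℝ → ℝ}

theorem intervalIntegrable_sq (h : WedMinimizer φ ε u y) {s t : ℝ} (hs : 0 ≤ s) (ht : 0 ≤ t) :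
    IntervalIntegrable (fun r => y r ^ 2) volume s t := by
  have h1 : IntegrableOn (fun r => y r ^ 2) (Icc 0 (max s t)) := (h.memLp (max s t)).integrable_sq
  exact IntegrableOn.intervalIntegrable (h1.mono_set
    (uIcc_subset_Icc ⟨hs, le_max_left _ _⟩ ⟨ht, le_max_right _ _⟩))

theorem continuousOn_sqIntegral (h : WedMinimizer φ ε u y) :
    ContinuousOn (sqIntegral y) (Ici 0) := by
  intro t ht
  have ht' : (0 : ℝ) ≤ t + 1 := by have : (0 : ℝ) ≤ t := ht; linarith
  have h1 := ((h.intervalIntegrable_sq le_rfl ht').absolutelyContinuousOnInterval_intervalIntegral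
    (c := 0) left_mem_uIcc).continuousOn
  rw [uIcc_of_le ht'] at h1
  refine (h1 t ⟨ht, by linarith⟩).mono_of_mem_nhdsWithin ?_
  filter_upwards [self_mem_nhdsWithin, nhdsWithin_le_nhds (Iio_mem_nhds (lt_add_one t))] with s hs hs'
  exact ⟨hs, hs'.le⟩

theorem integral_sqIntegral_mul_deriv (h : WedMinimizer φ ε u y) {η : ℝ → ℝ} (hη : IsTest η) :
    ∫ t in Ioi 0, sqIntegral y t * deriv η t = - ∫ t in Ioi 0, y t ^ 2 * η t := by
  obtain ⟨a, b, ha, hab, h0⟩ := hη.exists_Icc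
  obtain ⟨a', b', ha', hab', h0'⟩ := hη.deriv.exists_Icc
  set T := max b b' + 1 with hT
  have hb : b < T := by linarith [le_max_left b b']
  have hb' : b' < T := by linarith [le_max_right b b']
  have hT0 : 0 ≤ T := by linarith
  have e1 : ∀ g : ℝ → ℝ, (∀ t, T < t → g t = 0) → ∫ t in Ioi 0, g t = ∫ t in (0 : ℝ)..T, g t := by
    intro g hg
    rw [intervalIntegral.integral_of_le hT0]
    exact (setIntegral_eq_of_subset_of_forall_sdiff_eq_zero measurableSet_Ioi Ioc_subset_Ioi_self
      fun r hr => hg r (by by_contra hn; exact hr.2 ⟨hr.1, not_lt.1 hn⟩))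
  have hac := (h.intervalIntegrable_sq le_rfl hT0).absolutelyContinuousOnInterval_intervalIntegral
    (c := 0) left_mem_uIcc
  have hηac : AbsolutelyContinuousOnInterval η 0 T :=
    ContDiffOn.absolutelyContinuousOnInterval (hη.1.of_le (by simp)).contDiffOn
  rw [e1 _ fun t ht => by rw [h0' t fun h => by linarith [h.2], mul_zero],
    e1 _ fun t ht => by rw [h0 t fun h => by linarith [h.2], mul_zero]]
  have h2 := hac.integral_mul_deriv_eq_deriv_mul hηac
  refine h2.trans ?_
  rw [h0 T fun h => by linarith [h.2], h0 0 fun h => by linarith [h.1]]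
  simp only [mul_zero, sub_self, zero_sub, neg_inj]
  refine intervalIntegral.integral_congr_ae ?_
  filter_upwards [(h.intervalIntegrable_sq le_rfl hT0).ae_hasDerivAt_integral] with t ht htI
  rw [(ht (uIoc_subset_uIcc htI) 0 left_mem_uIcc).deriv]

theorem locallyIntegrableOn_energy (h : WedMinimizer φ ε u y) :
    LocallyIntegrableOn (fun t => (φ (u t)).toReal) (Ioi 0) := by
  refine (locallyIntegrableOn_iff isOpen_Ioi.isLocallyClosed).2 fun k hk hkc => ?_
  have h1 := (h.int_energy.mono_set hk).mul_continuousOn (g' := fun t => Real.exp (t / ε))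
      (by fun_prop) hkc
  refine h1.congr_fun (fun t _ => ?_) hkc.measurableSet
  simp only
  rw [mul_assoc, ← Real.exp_add, neg_div, neg_add_cancel, Real.exp_zero, mul_one]

theorem locallyIntegrableOn_sq (h : WedMinimizer φ ε u y) :
    LocallyIntegrableOn (fun t => y t ^ 2) (Ioi 0) := by
  refine (locallyIntegrableOn_iff isOpen_Ioi.isLocallyClosed).2 fun k hk hkc => ?_
  have h1 := (h.int_speed.mono_set hk).mul_continuousOn (g' := fun t => Real.exp (t / ε))
      (by fun_prop) hkc
  refine h1.congr_fun (fun t _ => ?_) hkc.measurableSet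
  simp only
  rw [mul_assoc, ← Real.exp_add, neg_div, neg_add_cancel, Real.exp_zero, mul_one]

/-- The first integral `φ ∘ u - (ε / 2) |u'|² + ∫_0^t |u'|²`. -/
theorem exists_first_integral (h : WedMinimizer φ ε u y) (hfin : ∀ t, 0 < t → φ (u t) < ⊤) :
    ∃ c, ∀ᵐ t ∂(volume.restrict (Ioi (0 : ℝ))),
      (φ (u t)).toReal - ε / 2 * y t ^ 2 + sqIntegral y t = c := by
  have hA : LocallyIntegrableOn (sqIntegral y) (Ioi 0) :=
    (h.continuousOn_sqIntegral.mono Ioi_subset_Ici_self).locallyIntegrableOn measurableSet_Ioi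
  have hy2 : LocallyIntegrableOn (fun t => ε / 2 * y t ^ 2) (Ioi 0) :=
    (h.locallyIntegrableOn_sq).smul (ε / 2)
  have hFy : LocallyIntegrableOn (fun t => (φ (u t)).toReal - ε / 2 * y t ^ 2) (Ioi 0) :=
    h.locallyIntegrableOn_energy.sub hy2
  have hFA : LocallyIntegrableOn
      (fun t => (φ (u t)).toReal - ε / 2 * y t ^ 2 + sqIntegral y t) (Ioi 0) := hFy.add hA
  refine ae_eq_const_of_integral_mul_deriv_eq_zero hFA fun η hη => ?_
  have h1 := h.stationary hfin hη
  have i1 := hη.deriv.integrableOn_mul hFy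
  have i2 := hη.integrableOn_mul h.locallyIntegrableOn_sq
  have i3 := hη.deriv.integrableOn_mul hA
  rw [integral_sub i1 i2] at h1
  have h2 := h.integral_sqIntegral_mul_deriv hη
  have h3 : ∫ t in Ioi 0, ((φ (u t)).toReal - ε / 2 * y t ^ 2 + sqIntegral y t) * deriv η t =
      ∫ t in Ioi 0, (((φ (u t)).toReal - ε / 2 * y t ^ 2) *
        deriv η t + sqIntegral y t * deriv η t) :=
    setIntegral_congr_fun measurableSet_Ioi fun t _ => by ring
  rw [h3, integral_add i1 i3, h2]
  linarith

end WedMinimizer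

end WED

namespace WED

/-! ### Regularity of minimizers -/

theorem locallyLipschitzOn_Ioi_of_Icc {f : ℝ → ℝ}
    (h : ∀ a b : ℝ, 0 < a → a < b → ∃ K, ∀ s ∈ Icc a b, ∀ t ∈ Icc a b, s ≤ t →
      |f t - f s| ≤ K * (t - s)) : LocallyLipschitzOn (Ioi 0) f := by
  intro x hx
  have hx' : (0 : ℝ) < x := hx
  obtain ⟨K, hK⟩ := h (x / 2) (x + 1) (by linarith) (by linarith)
  refine ⟨K.toNNReal, Icc (x / 2) (x + 1), mem_nhdsWithin_of_mem_nhds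
    (Icc_mem_nhds (by linarith) (by linarith)), LipschitzOnWith.of_dist_le_mul fun s hs t ht => ?_⟩
  rcases le_total s t with hst | hst
  · rw [dist_comm, dist_comm s t, Real.dist_eq, Real.dist_eq, abs_of_nonneg (sub_nonneg.2 hst)]
    exact (hK s hs t ht hst).trans
      (mul_le_mul_of_nonneg_right (Real.le_coe_toNNReal K) (sub_nonneg.2 hst))
  · rw [Real.dist_eq, Real.dist_eq, abs_of_nonneg (sub_nonneg.2 hst)]
    exact (hK t ht s hs hst).trans
      (mul_le_mul_of_nonneg_right (Real.le_coe_toNNReal K) (sub_nonneg.2 hst))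

variable {X : Type*} [MetricSpace X]

/-- Allows the speed to be replaced by its continuous representative. -/
theorem WedMinimizer.congr_ae {φ : X → EReal} {ε : ℝ} {u : ℝ → X} {y z : ℝ → ℝ}
    (h : WedMinimizer φ ε u y) (hz : Measurable z) (hz0 : ∀ t, 0 ≤ z t)
    (hyz : ∀ᵐ t ∂(volume.restrict (Ioi (0 : ℝ))), y t = z t) : WedMinimizer φ ε u z := by
  have hIcc : ∀ T, ∀ᵐ t ∂(volume.restrict (Icc (0 : ℝ) T)), y t = z t := fun T => by
    rw [← restrict_Ioc_eq_restrict_Icc]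
    exact ae_restrict_of_ae_restrict_of_subset Ioc_subset_Ioi_self hyz
  exact
  { eps_pos := h.eps_pos
    lsc := h.lsc
    ne_bot := h.ne_bot
    meas := hz
    nonneg := hz0
    ae_eq := by filter_upwards [h.ae_eq, hyz] with t h1 h2 using h1.trans h2
    memLp := fun T => (h.memLp T).ae_eq (hIcc T)
    dist_le := fun s t hs hst => by
      refine (h.dist_le s t hs hst).trans_eq ?_
      rw [intervalIntegral.integral_of_le hst, intervalIntegral.integral_of_le hst]
      refine integral_congr_ae (ae_restrict_of_ae_restrict_of_subset (fun r hr => ?_) hyz)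
      exact lt_of_le_of_lt hs hr.1
    ae_lt_top := h.ae_lt_top
    int_speed := h.int_speed.congr (by filter_upwards [hyz] with t ht; rw [ht])
    int_energy := h.int_energy
    minimal := fun v M Φ h1 h2 h3 h4 h5 h6 => by
      refine le_trans (le_of_eq ?_) (h.minimal v M Φ h1 h2 h3 h4 h5 h6)
      exact integral_congr_ae (by filter_upwards [hyz] with t ht; rw [ht]) }

/-- A minimizer for a `lam`-convex functional whose speed `y` is continuous on `(0, ∞)`, with the
first integral holding everywhere. -/
structure RegularMinimizer (φ : X → EReal) (lam ε c : ℝ) (u : ℝ → X) (y : ℝ → ℝ) : Prop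
    extends WedMinimizer φ ε u y where
  lam_neg : lam < 0
  conv : GeodConvex lam φ
  lt_top : ∀ t, 0 < t → φ (u t) < ⊤
  cont : ContinuousOn y (Ioi 0)
  first_integral : ∀ t, 0 < t → (φ (u t)).toReal = c + ε / 2 * y t ^ 2 - sqIntegral y t

theorem WedMinimizer.exists_regularMinimizer {φ : X → EReal} {ε : ℝ} {u : ℝ → X} {y : ℝ → ℝ}
    (h : WedMinimizer φ ε u y) {lam : ℝ} (hlam : lam < 0) (hconv : GeodConvex lam φ) :
    ∃ (c : ℝ) (z : ℝ → ℝ), RegularMinimizer φ lam ε c u z := by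
  have hfin : ∀ t, 0 < t → φ (u t) < ⊤ := fun t ht => h.energy_lt_top hlam hconv ht
  obtain ⟨c, hc⟩ := h.exists_first_integral hfin
  have hε := h.eps_pos
  -- The first integral solved for |u'|²: the right-hand side is continuous, so its square root is
  -- the continuous speed.
  set W : ℝ → ℝ := fun t => 2 / ε * ((φ (u t)).toReal + sqIntegral y t - c) with hW
  have hWc : ContinuousOn W (Ioi 0) :=
    (((h.continuousOn_toReal_energy hlam hconv).add
      (h.continuousOn_sqIntegral.mono Ioi_subset_Ici_self)).sub continuousOn_const).const_mul _
  have hWy : ∀ᵐ t ∂(volume.restrict (Ioi (0 : ℝ))), W t = y t ^ 2 := by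
    filter_upwards [hc] with t ht
    simp only [hW]
    rw [← ht]
    field_simp
    ring
  have hW0 : ∀ t, 0 < t → 0 ≤ W t := by
    -- Nonnegativity holds almost everywhere; as an equality of continuous functions it extends to
    -- every t > 0.
    have h1 : ∀ᵐ t ∂(volume.restrict (Ioi (0 : ℝ))), W t = |W t| := by
      filter_upwards [hWy] with t ht
      rw [ht, abs_of_nonneg (sq_nonneg _)]
    intro t ht
    have := Measure.eqOn_open_of_ae_eq h1 isOpen_Ioi hWc hWc.abs ht
    rw [this]; exact abs_nonneg _
  set z : ℝ → ℝ := (Ioi 0).indicator fun t => √(W t) with hz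
  have hzc : ContinuousOn z (Ioi 0) :=
    hWc.sqrt.congr fun t ht => indicator_of_mem ht _
  have hzm : Measurable z :=
    by
    classical
    rw [hz, ← piecewise_eq_indicator]
    exact hWc.sqrt.measurable_piecewise continuousOn_const measurableSet_Ioi
  have hz0 : ∀ t, 0 ≤ z t := fun t => indicator_nonneg (fun _ _ => Real.sqrt_nonneg _) t
  have hyz : ∀ᵐ t ∂(volume.restrict (Ioi (0 : ℝ))), y t = z t := by
    filter_upwards [hWy, ae_restrict_mem measurableSet_Ioi] with t h1 h2
    rw [hz, indicator_of_mem h2, h1, Real.sqrt_sq (h.nonneg t)]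
  have hA : ∀ t, 0 < t → sqIntegral z t = sqIntegral y t := fun t ht => by
    unfold sqIntegral
    rw [intervalIntegral.integral_of_le ht.le, intervalIntegral.integral_of_le ht.le]
    refine integral_congr_ae (ae_restrict_of_ae_restrict_of_subset Ioc_subset_Ioi_self ?_)
    filter_upwards [hyz] with r hr
    rw [hr]
  refine ⟨c, z, { h.congr_ae hzm hz0 hyz with
    lam_neg := hlam, conv := hconv, lt_top := hfin, cont := hzc, first_integral := ?_ }⟩
  intro t ht
  rw [hA t ht, hz, indicator_of_mem (mem_Ioi.2 ht), Real.sq_sqrt (hW0 t ht), hW]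
  field_simp
  ring

namespace RegularMinimizer

variable {φ : X → EReal} {lam ε c : ℝ} {u : ℝ → X} {y : ℝ → ℝ}

theorem continuousAt_speed (h : RegularMinimizer φ lam ε c u y) {t : ℝ} (ht : 0 < t) :
    ContinuousAt y t := h.cont.continuousAt (Ioi_mem_nhds ht)

theorem continuousOn_energy (h : RegularMinimizer φ lam ε c u y) :
    ContinuousOn (fun t => (φ (u t)).toReal) (Ioi 0) :=
  h.toWedMinimizer.continuousOn_toReal_energy h.lam_neg h.conv

theorem hasDerivAt_arcLength (h : RegularMinimizer φ lam ε c u y) {t : ℝ} (ht : 0 < t) :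
    HasDerivAt (arcLength y) (y t) t :=
  intervalIntegral.integral_hasDerivAt_right (h.intervalIntegrable le_rfl ht.le)
    (h.meas.stronglyMeasurable.stronglyMeasurableAtFilter) (h.continuousAt_speed ht)

theorem hasDerivAt_sqIntegral (h : RegularMinimizer φ lam ε c u y) {t : ℝ} (ht : 0 < t) :
    HasDerivAt (sqIntegral y) (y t ^ 2) t :=
  intervalIntegral.integral_hasDerivAt_right (h.intervalIntegrable_sq le_rfl ht.le)
    ((h.meas.pow_const 2).stronglyMeasurable.stronglyMeasurableAtFilter)
    ((h.continuousAt_speed ht).pow 2)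

theorem exists_speed_le (h : RegularMinimizer φ lam ε c u y) {a b : ℝ} (ha : 0 < a) :
    ∃ Y, 0 ≤ Y ∧ ∀ t ∈ Icc a b, y t ≤ Y := by
  obtain ⟨Y, hY⟩ := isCompact_Icc.exists_bound_of_continuousOn
    (h.cont.mono (fun t ht => ha.trans_le ht.1 : Icc a b ⊆ Ioi 0))
  exact ⟨max Y 0, le_max_right _ _, fun t ht =>
    ((le_abs_self _).trans (hY t ht)).trans (le_max_left _ _)⟩

theorem sqIntegral_sub (h : RegularMinimizer φ lam ε c u y) {s t : ℝ} (hs : 0 ≤ s) (ht : 0 ≤ t) :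
    sqIntegral y t - sqIntegral y s = ∫ r in s..t, y r ^ 2 :=
  intervalIntegral.integral_interval_sub_left (h.intervalIntegrable_sq le_rfl ht)
    (h.intervalIntegrable_sq le_rfl hs)

theorem sqIntegral_mono (h : RegularMinimizer φ lam ε c u y) :
    MonotoneOn (sqIntegral y) (Ici 0) := fun s hs t ht hst => by
  rw [← sub_nonneg, h.sqIntegral_sub hs ht]
  exact intervalIntegral.integral_nonneg hst fun r _ => sq_nonneg _

theorem arcLength_sub_le (h : RegularMinimizer φ lam ε c u y) {Y s t : ℝ} (hs : 0 ≤ s)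
    (hst : s ≤ t) (hY : ∀ r ∈ Icc s t, y r ≤ Y) :
    arcLength y t - arcLength y s ≤ Y * (t - s) := by
  have h1 := intervalIntegral.integral_mono_on hst (h.intervalIntegrable hs (hs.trans hst))
    intervalIntegrable_const hY
  rw [h.arcLength_sub hs (hs.trans hst)]
  refine h1.trans_eq ?_
  rw [intervalIntegral.integral_const, smul_eq_mul, mul_comm]

theorem sqIntegral_sub_le (h : RegularMinimizer φ lam ε c u y) {Y s t : ℝ} (hs : 0 ≤ s)
    (hst : s ≤ t) (hY : ∀ r ∈ Icc s t, y r ≤ Y) :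
    sqIntegral y t - sqIntegral y s ≤ Y * (arcLength y t - arcLength y s) := by
  have h1 := intervalIntegral.integral_mono_on hst (h.intervalIntegrable_sq hs (hs.trans hst))
    ((h.intervalIntegrable hs (hs.trans hst)).const_mul Y) fun r hr => by
      rw [pow_two]; exact mul_le_mul_of_nonneg_right (hY r hr) (h.nonneg r)
  rwa [intervalIntegral.integral_const_mul, ← h.arcLength_sub hs (hs.trans hst),
    ← h.sqIntegral_sub hs (hs.trans hst)] at h1

theorem speed_eq_zero (h : RegularMinimizer φ lam ε c u y) {s t : ℝ} (hs : 0 < s)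
    (hst : s < t) (hl : arcLength y s = arcLength y t) : ∀ r ∈ Icc s t, y r = 0 := by
  have h1 : ∀ r ∈ Ioo s t, y r = 0 := by
    intro r hr
    have h2 : arcLength y =ᶠ[𝓝 r] fun _ => arcLength y s := by
      filter_upwards [Ioo_mem_nhds hr.1 hr.2] with q hq
      refine le_antisymm ?_ (h.arcLength_mono hs.le (hs.trans hq.1).le hq.1.le)
      rw [hl]
      exact h.arcLength_mono (hs.trans hq.1).le (hs.trans hst).le hq.2.le
    exact (h.hasDerivAt_arcLength (hs.trans hr.1)).unique
      ((hasDerivAt_const r _).congr_of_eventuallyEq h2)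
  exact EqOn.of_subset_closure h1
    (h.cont.mono (fun r hr => hs.trans_le hr.1 : Icc s t ⊆ Ioi 0)) continuousOn_const
    Ioo_subset_Icc_self (closure_Ioo hst.ne).ge

/-- A convex function of l is Lipschitz away from the ends of its domain. The compact interval may
reach an end of the range of l, if the curve has stopped after b or has not moved before a. The
speed then vanishes at that endpoint, and the first integral supplies the missing one-sided bound.
-/
theorem energy_lipschitz_arcLength (h : RegularMinimizer φ lam ε c u y) {a b : ℝ} (ha : 0 < a)
    (hab : a < b) : ∃ K, 0 ≤ K ∧ ∀ s ∈ Icc a b, ∀ t ∈ Icc a b, s ≤ t →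
      |(φ (u t)).toReal - (φ (u s)).toReal| ≤ K * (arcLength y t - arcLength y s) := by
  set l := arcLength y with hl
  set F : ℝ → ℝ := fun t => (φ (u t)).toReal with hF
  set G : ℝ → ℝ := fun t => F t - lam / 2 * l t ^ 2 with hG
  have hb := ha.trans hab
  have hlam := h.lam_neg
  have hsub : Icc a b ⊆ Ioi 0 := fun t ht => ha.trans_le ht.1
  have hGc : ContinuousOn G (Icc a b) :=
    (h.continuousOn_energy.mono hsub).sub
      (((h.continuousOn_arcLength.mono (hsub.trans Ioi_subset_Ici_self)).pow 2).const_mul _)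
  obtain ⟨N, hN⟩ := isCompact_Icc.exists_bound_of_continuousOn hGc
  simp only [Real.norm_eq_abs] at hN
  obtain ⟨Y, hY0, hY⟩ := h.exists_speed_le (b := b) ha
  have hmono : ∀ s t, 0 < s → s ≤ t → l s ≤ l t := fun s t hs hst =>
    h.arcLength_mono hs.le (hs.le.trans hst) hst
  have h3 : ∀ p q r, 0 < p → p ≤ q → q ≤ r →
      (l r - l p) * G q ≤ (l r - l q) * G p + (l q - l p) * G r := fun p q r hp hpq hqr =>
    h.three_point hlam h.conv hp.le hpq hqr (h.lt_top p hp) (h.lt_top r (hp.trans_le (hpq.trans hqr)))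
  have hGeq : ∀ s t, 0 < s → s ≤ t → l s = l t → G s = G t := fun s t hs hst hlt => by
    simp only [hG, hF]; rw [h.eq_of_arcLength_eq hs.le hst hlt, hlt]
  have hlb : ∀ t ∈ Icc a b, l t ≤ l b := fun t ht => hmono t b (hsub ht) ht.2
  have hl0 : ∀ t ∈ Icc a b, 0 ≤ l t := fun t ht => h.arcLength_nonneg (hsub ht).le
  have hup : ∃ K, 0 ≤ K ∧ ∀ s ∈ Icc a b, ∀ t ∈ Icc a b, s ≤ t → G t - G s ≤ K * (l t - l s) := by
    -- With room to the right, the slope on [s,t] is at most the slope on [s,d], whose denominator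
    -- is at least `l d - l b`.
    by_cases hex : ∃ d, b < d ∧ l b < l d
    · obtain ⟨d, hbd, hld⟩ := hex
      refine ⟨(|G d| + N) / (l d - l b), div_nonneg ?_ (sub_pos.2 hld).le, fun s hs t ht hst => ?_⟩
      · have := (abs_nonneg _).trans (hN a (left_mem_Icc.2 hab.le)); positivity
      have h4 := h3 s t d (hsub hs) hst (ht.2.trans hbd.le)
      have h5 := hlb s hs
      have h6 := hmono s t (hsub hs) hst
      have h7 := (abs_le.1 (hN s hs)).1
      have h8 := le_abs_self (G d)
      have h9 : (l d - l s) * (G t - G s) ≤ (l t - l s) * (|G d| + N) := by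
        nlinarith [mul_le_mul_of_nonneg_left (by linarith : G d - G s ≤ |G d| + N)
          (sub_nonneg.2 h6)]
      rw [div_mul_eq_mul_div, le_div_iff₀ (sub_pos.2 hld)]
      by_cases hneg : G t - G s ≤ 0
      · have : 0 ≤ (|G d| + N) * (l t - l s) := mul_nonneg (by
          have := (abs_nonneg _).trans (hN a (left_mem_Icc.2 hab.le)); positivity) (by linarith)
        nlinarith [sub_pos.2 hld]
      · nlinarith
    · push Not at hex
      have hy : y b = 0 := h.speed_eq_zero hb (lt_add_one b)
        (le_antisymm (hmono b _ hb (by linarith)) (hex _ (lt_add_one b))) b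
          (left_mem_Icc.2 (by linarith))
      refine ⟨-lam * l b, mul_nonneg (by linarith) (hl0 b (right_mem_Icc.2 hab.le)),
        fun s hs t ht hst => ?_⟩
      have h4 := h3 s t b (hsub hs) hst ht.2
      have h6 := hmono s t (hsub hs) hst
      rcases (hlb s hs).eq_or_lt with h5 | h5
      · have : l s = l t := le_antisymm h6 (by rw [h5]; exact hlb t ht)
        rw [hGeq s t (hsub hs) hst this, this]; simp
      -- Here the speed vanishes at b, and ∫|u'|² is nondecreasing.
      have hFs : F b ≤ F s := by
        have e1 := h.first_integral b hb
        have e2 := h.first_integral s (hsub hs)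
        have e3 := h.sqIntegral_mono (mem_Ici_of_Ioi (hsub hs)) hb.le hs.2
        rw [hy] at e1
        have : 0 ≤ ε / 2 * y s ^ 2 := by have := h.eps_pos; positivity
        simp only [hF]
        linarith
      have h7 : G b - G s ≤ -lam * l b * (l b - l s) := by
        have := hl0 s hs
        have h8 : l b ^ 2 - l s ^ 2 ≤ 2 * l b * (l b - l s) := by nlinarith
        have := mul_le_mul_of_nonneg_left h8 (by linarith : 0 ≤ -(lam / 2))
        simp only [hG]
        linarith
      have h8 : (l b - l s) * (G t - G s) ≤ (l b - l s) * (-lam * l b * (l t - l s)) := by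
        nlinarith [mul_le_mul_of_nonneg_left h7 (sub_nonneg.2 h6)]
      exact le_of_mul_le_mul_left h8 (sub_pos.2 h5)
  have hlow : ∃ K, 0 ≤ K ∧ ∀ s ∈ Icc a b, ∀ t ∈ Icc a b, s ≤ t → G s - G t ≤ K * (l t - l s) := by
    by_cases hex : ∃ d, 0 < d ∧ d < a ∧ l d < l a
    · obtain ⟨d, hd, hda, hld⟩ := hex
      have hN0 : 0 ≤ N := (abs_nonneg _).trans (hN a (left_mem_Icc.2 hab.le))
      refine ⟨(|G d| + N) / (l a - l d), div_nonneg ?_ (sub_pos.2 hld).le, fun s hs t ht hst => ?_⟩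
      · positivity
      have h4 := h3 d s t hd (hda.le.trans hs.1) hst
      have h5 := hmono a t ha ht.1
      have h6 := hmono s t (hsub hs) hst
      have h7 := (abs_le.1 (hN t ht)).1
      have h8 := le_abs_self (G d)
      have h9 : (l t - l d) * (G s - G t) ≤ (l t - l s) * (|G d| + N) := by
        nlinarith [mul_le_mul_of_nonneg_left (by linarith : G d - G t ≤ |G d| + N)
          (sub_nonneg.2 h6)]
      rw [div_mul_eq_mul_div, le_div_iff₀ (sub_pos.2 hld)]
      by_cases hneg : G s - G t ≤ 0
      · have : 0 ≤ (|G d| + N) * (l t - l s) := mul_nonneg (by positivity) (by linarith)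
        nlinarith [sub_pos.2 hld]
      · nlinarith
    · push Not at hex
      have hy : y a = 0 := h.speed_eq_zero (half_pos ha) (half_lt_self ha)
        (le_antisymm (hmono _ _ (half_pos ha) (by linarith)) (hex _ (half_pos ha) (half_lt_self ha)))
          a (right_mem_Icc.2 (by linarith))
      refine ⟨Y, hY0, fun s hs t ht hst => ?_⟩
      have h4 := h3 a s t ha hs.1 hst
      have h6 := hmono s t (hsub hs) hst
      have h10 := hmono a s ha hs.1
      rcases (hmono a t ha ht.1).eq_or_lt with h5 | h5
      · have : l s = l t := le_antisymm h6 (h5 ▸ h10)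
        rw [hGeq s t (hsub hs) hst this, this]; simp
      -- With zero speed at a, the energy drops by at most ∫|u'|² over [a,t], and this is at most Y
      -- times the length.
      have hFs : F a - F t ≤ Y * (l t - l a) := by
        have e1 := h.first_integral a ha
        have e2 := h.first_integral t (hsub ht)
        have e3 := h.sqIntegral_sub_le ha.le ht.1 (fun r hr => hY r ⟨hr.1, hr.2.trans ht.2⟩)
        rw [hy] at e1
        have : 0 ≤ ε / 2 * y t ^ 2 := by have := h.eps_pos; positivity
        simp only [hF]
        linarith
      have h7 : G a - G t ≤ Y * (l t - l a) := by
        have := hl0 a (left_mem_Icc.2 hab.le)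
        have h8 : 0 ≤ l t ^ 2 - l a ^ 2 := by nlinarith
        have := mul_nonneg (by linarith : 0 ≤ -(lam / 2)) h8
        simp only [hG]
        linarith
      have h8 : (l t - l a) * (G s - G t) ≤ (l t - l a) * (Y * (l t - l s)) := by
        nlinarith [mul_le_mul_of_nonneg_left h7 (sub_nonneg.2 h6)]
      exact le_of_mul_le_mul_left h8 (sub_pos.2 h5)
  obtain ⟨K₁, hK₁, h1⟩ := hup
  obtain ⟨K₂, hK₂, h2⟩ := hlow
  have hlb0 := hl0 b (right_mem_Icc.2 hab.le)
  refine ⟨K₁ + K₂ + -lam * l b, by have := mul_nonneg (by linarith : 0 ≤ -lam) hlb0; linarith,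
    fun s hs t ht hst => ?_⟩
  have h4 := h1 s hs t ht hst
  have h5 := h2 s hs t ht hst
  have h6 := sub_nonneg.2 (hmono s t (hsub hs) hst)
  have h7 : 0 ≤ -lam / 2 * (l t ^ 2 - l s ^ 2) :=
    mul_nonneg (by linarith) (by nlinarith [hl0 s hs])
  have h8 : -lam / 2 * (l t ^ 2 - l s ^ 2) ≤ -lam * l b * (l t - l s) := by
    have : l t ^ 2 - l s ^ 2 ≤ 2 * l b * (l t - l s) := by
      nlinarith [hlb t ht, hlb s hs, hl0 s hs]
    nlinarith [mul_le_mul_of_nonneg_left this (by linarith : 0 ≤ -lam / 2)]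
  have h9 := mul_nonneg hK₁ h6
  have h10 := mul_nonneg hK₂ h6
  simp only [hG] at h4 h5
  rw [abs_le]
  constructor <;> linarith

theorem energy_lipschitz (h : RegularMinimizer φ lam ε c u y) {a b : ℝ} (ha : 0 < a)
    (hab : a < b) : ∃ K, 0 ≤ K ∧ ∀ s ∈ Icc a b, ∀ t ∈ Icc a b, s ≤ t →
      |(φ (u t)).toReal - (φ (u s)).toReal| ≤ K * (t - s) := by
  obtain ⟨K, hK, h1⟩ := h.energy_lipschitz_arcLength ha hab
  obtain ⟨Y, hY0, hY⟩ := h.exists_speed_le (b := b) ha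
  refine ⟨K * Y, by positivity, fun s hs t ht hst => (h1 s hs t ht hst).trans ?_⟩
  rw [mul_assoc]
  exact mul_le_mul_of_nonneg_left (h.arcLength_sub_le (ha.le.trans hs.1) hst
    fun r hr => hY r ⟨hs.1.trans hr.1, hr.2.trans ht.2⟩) hK

theorem locallyLipschitzOn_energy (h : RegularMinimizer φ lam ε c u y) :
    LocallyLipschitzOn (Ioi 0) fun t => (φ (u t)).toReal :=
  locallyLipschitzOn_Ioi_of_Icc fun _ _ ha hab =>
    let ⟨K, _, hK⟩ := h.energy_lipschitz ha hab
    ⟨K, hK⟩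

theorem locallyLipschitzOn_sq_speed (h : RegularMinimizer φ lam ε c u y) :
    LocallyLipschitzOn (Ioi 0) fun t => y t ^ 2 := by
  refine locallyLipschitzOn_Ioi_of_Icc fun a b ha hab => ?_
  obtain ⟨K, hK, h1⟩ := h.energy_lipschitz ha hab
  obtain ⟨Y, hY0, hY⟩ := h.exists_speed_le (b := b) ha
  have hε := h.eps_pos
  refine ⟨2 / ε * (K + Y * Y), fun s hs t ht hst => ?_⟩
  have hs0 : 0 < s := ha.trans_le hs.1
  have hY' : ∀ r ∈ Icc s t, y r ≤ Y := fun r hr => hY r ⟨hs.1.trans hr.1, hr.2.trans ht.2⟩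
  have e1 := h.first_integral s hs0
  have e2 := h.first_integral t (hs0.trans_le hst)
  have e3 : y t ^ 2 - y s ^ 2 = 2 / ε * (((φ (u t)).toReal - (φ (u s)).toReal) +
      (sqIntegral y t - sqIntegral y s)) := by
    rw [e1, e2]; field_simp; ring
  have e4 := h.sqIntegral_mono hs0.le (hs0.le.trans hst) hst
  have e5 := (h.sqIntegral_sub_le hs0.le hst hY').trans
    (mul_le_mul_of_nonneg_left (h.arcLength_sub_le hs0.le hst hY') hY0)
  rw [e3, abs_mul, abs_of_pos (by positivity : 0 < 2 / ε), mul_assoc]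
  refine mul_le_mul_of_nonneg_left ((abs_add_le _ _).trans ?_) (by positivity)
  rw [abs_of_nonneg (sub_nonneg.2 e4)]
  have := h1 s hs t ht hst
  linarith

end RegularMinimizer

end WED

namespace WED

/-! ### Second differences and distributional second derivatives -/

/-- Mean value theorem twice: for ξ(· + h) - ξ, then for ξ'. -/
theorem exists_second_difference_eq {ξ : ℝ → ℝ} (hξ : ContDiff ℝ ∞ ξ) {s h : ℝ} (hh : 0 < h) :
    ∃ r ∈ Icc (s - h) (s + h), ξ (s + h) + ξ (s - h) - 2 * ξ s = h ^ 2 * deriv (deriv ξ) r := by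
  have hd : ∀ t, HasDerivAt ξ (deriv ξ t) t := fun t =>
    (hξ.differentiable (by simp)).differentiableAt.hasDerivAt
  have hξ' : ContDiff ℝ ∞ (deriv ξ) := (contDiff_infty_iff_deriv.1 hξ).2
  have hd' : ∀ t, HasDerivAt (deriv ξ) (deriv (deriv ξ) t) t := fun t =>
    (hξ'.differentiable (by simp)).differentiableAt.hasDerivAt
  have h1 : ∀ t, HasDerivAt (fun t => ξ (t + h) - ξ t) (deriv ξ (t + h) - deriv ξ t) t := fun t =>
    ((hd (t + h)).comp_add_const t h).sub (hd t)
  obtain ⟨p, hp, hpe⟩ := exists_hasDerivAt_eq_slope _ _ (sub_lt_self s hh)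
    (fun t _ => (h1 t).continuousAt.continuousWithinAt) fun t _ => h1 t
  obtain ⟨r, hr, hre⟩ := exists_hasDerivAt_eq_slope _ _ (lt_add_of_pos_right p hh)
    (fun t _ => (hd' t).continuousAt.continuousWithinAt) fun t _ => hd' t
  refine ⟨r, ⟨by linarith [hp.1, hr.1], by linarith [hp.2, hr.2]⟩, ?_⟩
  rw [hre, hpe]
  have e1 : s - (s - h) = h := by ring
  have e2 : p + h - p = h := by ring
  have e3 : s - h + h = s := by ring
  rw [e1, e2, e3]
  field_simp
  ring

/-- A function whose second differences are bounded below by `g` satisfies `g ≤ f''` in the sense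
of distributions. -/
theorem integral_mul_le_integral_mul_deriv_deriv {f g : ℝ → ℝ} (hf : ContinuousOn f (Ioi 0))
    (hg : ContinuousOn g (Ioi 0))
    (hfg : ∀ s h m, 0 < h → h < s → (∀ r ∈ Icc (s - h) (s + h), m ≤ g r) →
      h ^ 2 * m ≤ f (s + h) + f (s - h) - 2 * f s)
    {ξ : ℝ → ℝ} (hξ : IsTest ξ) (hξ0 : ∀ t, 0 ≤ ξ t) :
    ∫ t in Ioi 0, g t * ξ t ≤ ∫ t in Ioi 0, f t * deriv (deriv ξ) t := by
  obtain ⟨a, b, ha, hab, h0⟩ := hξ.exists_Icc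
  -- The support enlarged by a/2: shifts h < a/2 of its points stay in J and away from 0.
  set J : Set ℝ := Icc (a / 2) (b + a / 2) with hJ
  have hJ0 : J ⊆ Ioi 0 := fun t ht => (half_pos ha).trans_le ht.1
  set f₀ : ℝ → ℝ := J.indicator f with hf₀
  have hf₀i : Integrable f₀ :=
    (hf.mono hJ0).integrableOn_Icc.integrable_indicator measurableSet_Icc
  have hf₀J : ∀ t ∈ J, f₀ t = f t := fun t ht => indicator_of_mem ht _
  have hξc := hξ.1.continuous
  have hξi : Integrable ξ := hξc.integrable_of_hasCompactSupport hξ.2.1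
  obtain ⟨B, -, hB, -⟩ := hξ.exists_bound
  have hmul : ∀ {q : ℝ → ℝ}, Continuous q → (∃ B, ∀ t, |q t| ≤ B) →
      Integrable fun t => f₀ t * q t := fun {q} hq ⟨B, hB⟩ =>
    hf₀i.mul_bdd (c := B) hq.aestronglyMeasurable (Eventually.of_forall hB)
  have hI : ∀ {q : ℝ → ℝ}, IsTest q → (∀ t, t ∉ Icc a b → q t = 0) →
      ∫ t in Ioi 0, f t * q t = ∫ t, f₀ t * q t := by
    intro q hq hq0
    rw [← setIntegral_eq_integral_of_forall_compl_eq_zero (s := Ioi (0 : ℝ))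
      (f := fun t => f₀ t * q t)]
    · refine setIntegral_congr_fun (measurableSet_Ioi (a := (0 : ℝ))) fun t _ => ?_
      by_cases ht : t ∈ Icc a b
      · rw [hf₀J t ⟨by linarith [ht.1], by linarith [ht.2]⟩]
      · rw [hq0 t ht, mul_zero, mul_zero]
    · intro t ht
      rw [hq.eq_zero (not_lt.1 ht), mul_zero]
  have h0' : ∀ t, t ∉ Icc a b → deriv (deriv ξ) t = 0 := by
    have h1 : ∀ {q : ℝ → ℝ}, (∀ t, t ∉ Icc a b → q t = 0) → ∀ t, t ∉ Icc a b → deriv q t = 0 :=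
      fun {q} hq t ht => by
        have : q =ᶠ[𝓝 t] fun _ => 0 := by
          filter_upwards [(isClosed_Icc (a := a) (b := b)).isOpen_compl.mem_nhds ht] with r hr using hq r hr
        rw [this.deriv_eq, deriv_const]
    exact h1 (h1 h0)
  have hξ2 := hξ.deriv.deriv
  obtain ⟨B₂, -, hB₂, -⟩ := hξ2.exists_bound
  set C : ℝ := (∫ t, |f₀ t|) + ∫ t, ξ t with hC
  have hgi := hξ.integrableOn_mul (hg.locallyIntegrableOn measurableSet_Ioi)
  suffices hsuff : ∀ η, 0 < η → ∫ t in Ioi 0, g t * ξ t ≤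
      (∫ t in Ioi 0, f t * deriv (deriv ξ) t) + η * C by
    refine le_of_forall_pos_le_add fun e he => ?_
    have hC0 : 0 ≤ C := add_nonneg (integral_nonneg fun t => abs_nonneg _) (integral_nonneg hξ0)
    refine (hsuff (e / (C + 1)) (by positivity)).trans ?_
    have : e / (C + 1) * C ≤ e := by
      rw [div_mul_eq_mul_div, div_le_iff₀ (by positivity)]
      nlinarith
    linarith
  intro η hη
  obtain ⟨δ₁, hδ₁, hu₁⟩ := Metric.uniformContinuousOn_iff.1
    (isCompact_Icc.uniformContinuousOn_of_continuous (hg.mono hJ0)) η hη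
  obtain ⟨δ₂, hδ₂, hu₂⟩ := Metric.uniformContinuous_iff.1
    (hξ2.1.continuous.uniformContinuous_of_tendsto_cocompact (x := 0)
      hξ2.2.1.is_zero_at_infty) η hη
  obtain ⟨h, hh0, hh⟩ := exists_between (lt_min (lt_min hδ₁ hδ₂) (half_pos ha))
  have hh1 : h < δ₁ := hh.trans_le ((min_le_left _ _).trans (min_le_left _ _))
  have hh2 : h < δ₂ := hh.trans_le ((min_le_left _ _).trans (min_le_right _ _))
  have hha : h < a / 2 := hh.trans_le (min_le_right _ _)
  have i1 : Integrable fun t => f₀ t * ξ (t + h) := hmul (by fun_prop) ⟨B, fun t => hB _⟩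
  have i2 : Integrable fun t => f₀ t * ξ (t - h) := hmul (by fun_prop) ⟨B, fun t => hB _⟩
  have i3 : Integrable fun t => f₀ t * ξ t := hmul hξc ⟨B, hB⟩
  have i4 : Integrable fun t => f₀ t * deriv (deriv ξ) t := hmul hξ2.1.continuous ⟨B₂, hB₂⟩
  have j1 : Integrable fun t => f₀ (t - h) * ξ t := by
    have := i1.comp_sub_right h
    simpa using this
  have j2 : Integrable fun t => f₀ (t + h) * ξ t := by
    have := i2.comp_add_right h
    simpa using this
  have s1 : ∫ t, f₀ (t - h) * ξ t = ∫ t, f₀ t * ξ (t + h) := by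
    have := integral_sub_right_eq_self (μ := volume) (fun t => f₀ t * ξ (t + h)) h
    simpa using this
  have s2 : ∫ t, f₀ (t + h) * ξ t = ∫ t, f₀ t * ξ (t - h) := by
    have := integral_add_right_eq_self (μ := volume) (fun t => f₀ t * ξ (t - h)) h
    simpa using this
  -- Uniform continuity makes g(t) - η a lower bound of g on [t-h, t+h], so the hypothesis applies
  -- with this constant.
  have hlow : h ^ 2 * ((∫ t in Ioi 0, g t * ξ t) - η * ∫ t, ξ t) ≤
      ∫ t, (f₀ (t + h) * ξ t + f₀ (t - h) * ξ t - 2 * (f₀ t * ξ t)) := by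
    have e1 : (∫ t in Ioi 0, g t * ξ t) - η * ∫ t, ξ t = ∫ t in Ioi 0, (g t - η) * ξ t := by
      have e2 : ∫ t, ξ t = ∫ t in Ioi 0, ξ t :=
        (setIntegral_eq_integral_of_forall_compl_eq_zero fun t ht =>
          hξ.eq_zero (not_lt.1 ht)).symm
      rw [e2, ← integral_const_mul, ← integral_sub hgi (hξi.integrableOn.const_mul η)]
      exact integral_congr_ae (Eventually.of_forall fun t => by ring)
    have e3 : ∫ t, (f₀ (t + h) * ξ t + f₀ (t - h) * ξ t - 2 * (f₀ t * ξ t)) =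
        ∫ t in Ioi 0, (f₀ (t + h) * ξ t + f₀ (t - h) * ξ t - 2 * (f₀ t * ξ t)) :=
      (setIntegral_eq_integral_of_forall_compl_eq_zero fun t ht => by
        rw [hξ.eq_zero (not_lt.1 ht)]; ring).symm
    have i5 : IntegrableOn (fun t => (g t - η) * ξ t) (Ioi 0) := by
      refine (hgi.sub (hξi.integrableOn.const_mul η)).congr (Eventually.of_forall fun t => ?_)
      simp only [Pi.sub_apply]; ring
    rw [e1, e3, ← integral_const_mul]
    refine setIntegral_mono_on (i5.const_mul _) ((j2.add j1).sub (i3.const_mul 2)).integrableOn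
      measurableSet_Ioi fun t _ => ?_
    by_cases ht : t ∈ Icc a b
    · have h1 := hfg t h (g t - η) hh0 (by linarith [ht.1]) fun r hr => by
        have h2 := hu₁ r ⟨by linarith [ht.1, hr.1], by linarith [ht.2, hr.2]⟩ t
          ⟨by linarith [ht.1], by linarith [ht.2]⟩ (by
            rw [Real.dist_eq, abs_lt]; constructor <;> linarith [hr.1, hr.2])
        rw [Real.dist_eq, abs_lt] at h2
        linarith [h2.1]
      rw [hf₀J t ⟨by linarith [ht.1], by linarith [ht.2]⟩,
        hf₀J (t + h) ⟨by linarith [ht.1], by linarith [ht.2]⟩,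
        hf₀J (t - h) ⟨by linarith [ht.1], by linarith [ht.2]⟩]
      have := mul_le_mul_of_nonneg_right h1 (hξ0 t)
      linarith
    · rw [h0 t ht]; simp
  have hup : ∫ t, (f₀ (t + h) * ξ t + f₀ (t - h) * ξ t - 2 * (f₀ t * ξ t)) ≤
      h ^ 2 * ((∫ t in Ioi 0, f t * deriv (deriv ξ) t) + η * ∫ t, |f₀ t|) := by
    -- Discrete integration by parts: translation invariance moves the second difference onto ξ.
    have e1 : ∫ t, (f₀ (t + h) * ξ t + f₀ (t - h) * ξ t - 2 * (f₀ t * ξ t)) =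
        ∫ t, (f₀ t * ξ (t - h) + f₀ t * ξ (t + h) - 2 * (f₀ t * ξ t)) := by
      refine (integral_sub (j2.add j1) (i3.const_mul 2)).trans ?_
      refine Eq.trans ?_ (integral_sub (i2.add i1) (i3.const_mul 2)).symm
      congr 1
      refine (integral_add j2 j1).trans (Eq.trans ?_ (integral_add i2 i1).symm)
      rw [s1, s2]
    rw [e1, hI hξ2 h0',
      ← integral_const_mul, ← integral_add i4 (hf₀i.abs.const_mul η), ← integral_const_mul]
    refine integral_mono ((i2.add i1).sub (i3.const_mul 2))
      ((i4.add (hf₀i.abs.const_mul η)).const_mul _) fun t => ?_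
    obtain ⟨r, hr, hre⟩ := exists_second_difference_eq hξ.1 (s := t) hh0
    have h1 := hu₂ (a := r) (b := t) (by
      rw [Real.dist_eq, abs_lt]; constructor <;> linarith [hr.1, hr.2])
    rw [Real.dist_eq] at h1
    have h2 : f₀ t * (deriv (deriv ξ) r - deriv (deriv ξ) t) ≤ |f₀ t| * η :=
      (le_abs_self _).trans ((abs_mul _ _).le.trans
        (mul_le_mul_of_nonneg_left h1.le (abs_nonneg _)))
    have h3 : f₀ t * ξ (t - h) + f₀ t * ξ (t + h) - 2 * (f₀ t * ξ t) =
        h ^ 2 * (f₀ t * deriv (deriv ξ) r) := by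
      have : f₀ t * ξ (t - h) + f₀ t * ξ (t + h) - 2 * (f₀ t * ξ t) =
        f₀ t * (ξ (t + h) + ξ (t - h) - 2 * ξ t) := by ring
      rw [this, hre]; ring
    beta_reduce
    rw [h3]
    refine mul_le_mul_of_nonneg_left ?_ (sq_nonneg h)
    linarith
  have := le_of_mul_le_mul_left (hlow.trans hup) (by positivity)
  rw [hC]
  linarith

/-! ### Convexity in time -/

variable {X : Type*} [MetricSpace X]

namespace RegularMinimizer

variable {φ : X → EReal} {lam ε c : ℝ} {u : ℝ → X} {y : ℝ → ℝ}

/-- Cauchy-Schwarz, by integrating the square of y - d/(b-a). -/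
theorem sq_dist_le (h : RegularMinimizer φ lam ε c u y) {a b : ℝ} (ha : 0 ≤ a) (hab : a < b) :
    dist (u a) (u b) ^ 2 ≤ (b - a) * (sqIntegral y b - sqIntegral y a) := by
  set d := dist (u a) (u b) with hd
  have hδ : 0 < b - a := sub_pos.2 hab
  have hy := h.intervalIntegrable ha (ha.trans hab.le)
  have hy2 := h.intervalIntegrable_sq ha (ha.trans hab.le)
  have h1 : d ≤ ∫ r in a..b, y r := h.dist_le a b ha hab.le
  have h2 : 0 ≤ ∫ r in a..b, (y r ^ 2 - 2 * (d / (b - a)) * y r + (d / (b - a)) ^ 2) :=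
    intervalIntegral.integral_nonneg hab.le fun r _ => by nlinarith [sq_nonneg (y r - d / (b - a))]
  rw [intervalIntegral.integral_add (hy2.sub (hy.const_mul _)) intervalIntegrable_const,
    intervalIntegral.integral_sub hy2 (hy.const_mul _), intervalIntegral.integral_const_mul,
    intervalIntegral.integral_const, ← h.sqIntegral_sub ha (ha.trans hab.le), smul_eq_mul] at h2
  have hd0 : 0 ≤ d / (b - a) := div_nonneg dist_nonneg hδ.le
  have h3 := mul_le_mul_of_nonneg_left h1 hd0
  have h4 : d / (b - a) * d ≤ sqIntegral y b - sqIntegral y a := by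
    have : (b - a) * (d / (b - a)) ^ 2 = d / (b - a) * d := by field_simp
    linarith
  have h5 := mul_le_mul_of_nonneg_left h4 hδ.le
  calc d ^ 2 = (b - a) * (d / (b - a) * d) := by field_simp
    _ ≤ _ := h5

/-- Let V be ε times the difference of A/2 and its chord. It vanishes at both endpoints, so the
integral of (V exp(-t/ε))' is zero, and this is the identity. Thus replacing |u'|² by its mean costs
exactly the deviation of A/2 from its chord. -/
theorem integral_sq_mul_exp (h : RegularMinimizer φ lam ε c u y) {a b : ℝ} (ha : 0 < a)
    (hab : a < b) :
    ∫ t in a..b, (ε / 2 * y t ^ 2 - (sqIntegral y t / 2 - ((b - t) * (sqIntegral y a / 2) +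
      (t - a) * (sqIntegral y b / 2)) / (b - a))) * Real.exp (-t / ε) =
    ∫ t in a..b, ε / 2 * ((sqIntegral y b - sqIntegral y a) / (b - a)) * Real.exp (-t / ε) := by
  have hε := h.eps_pos
  have hδ : b - a ≠ 0 := (sub_pos.2 hab).ne'
  set A := sqIntegral y with hA
  set V : ℝ → ℝ := fun t => ε * (A t / 2 - ((b - t) * (A a / 2) + (t - a) * (A b / 2)) / (b - a))
    with hV
  set V' : ℝ → ℝ := fun t => ε * (y t ^ 2 / 2 - ((A b - A a) / (b - a)) / 2) with hV'
  have hpos : ∀ t ∈ uIcc a b, 0 < t := fun t ht => by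
    rw [uIcc_of_le hab.le] at ht; exact ha.trans_le ht.1
  have hd : ∀ t ∈ uIcc a b, HasDerivAt V (V' t) t := fun t ht => by
    have h1 := ((h.hasDerivAt_sqIntegral (hpos t ht)).div_const 2)
    have h2 : HasDerivAt (fun t => ((b - t) * (A a / 2) + (t - a) * (A b / 2)) / (b - a))
        (((-1) * (A a / 2) + 1 * (A b / 2)) / (b - a)) t :=
      ((((hasDerivAt_id t).const_sub b).mul_const _).add
        (((hasDerivAt_id t).sub_const a).mul_const _)).div_const _
    refine ((h1.sub h2).const_mul ε).congr_deriv ?_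
    simp only [hV']
    field_simp
    ring
  have hp : ∀ t ∈ uIcc a b, HasDerivAt (fun t : ℝ => Real.exp (-t / ε))
      (Real.exp (-t / ε) * (-1 / ε)) t := fun t _ =>
    (((hasDerivAt_id t).neg).div_const ε).exp
  have hyc : ContinuousOn y (uIcc a b) := h.cont.mono hpos
  have hVi : IntervalIntegrable V' volume a b := by
    refine ContinuousOn.intervalIntegrable ?_
    fun_prop
  have hparts := intervalIntegral.integral_mul_deriv_eq_deriv_mul hd hp hVi
    (Continuous.intervalIntegrable (by fun_prop) a b)
  have hVa : V a = 0 := by simp only [hV]; field_simp; ring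
  have hVb : V b = 0 := by simp only [hV]; field_simp; ring
  rw [hVa, hVb, zero_mul, zero_mul, sub_zero, zero_sub] at hparts
  have hVc : ContinuousOn V (uIcc a b) := fun t ht => (hd t ht).continuousAt.continuousWithinAt
  have hpc : Continuous fun t : ℝ => Real.exp (-t / ε) := by fun_prop
  have hi1 : IntervalIntegrable (fun t => V' t * Real.exp (-t / ε)) volume a b :=
    hVi.mul_continuousOn hpc.continuousOn
  have hi2 : IntervalIntegrable (fun t => V t * (Real.exp (-t / ε) * (-1 / ε))) volume a b :=
    (hVc.mul (by fun_prop)).intervalIntegrable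
  have hi3 : IntervalIntegrable (fun t => ε / 2 * ((A b - A a) / (b - a)) * Real.exp (-t / ε))
    volume a b := Continuous.intervalIntegrable (by fun_prop) a b
  have hsum : ∫ t in a..b, (V' t * Real.exp (-t / ε) + V t * (Real.exp (-t / ε) * (-1 / ε)) +
      ε / 2 * ((A b - A a) / (b - a)) * Real.exp (-t / ε)) =
      ∫ t in a..b, ε / 2 * ((A b - A a) / (b - a)) * Real.exp (-t / ε) := by
    rw [intervalIntegral.integral_add (hi1.add hi2) hi3, intervalIntegral.integral_add hi1 hi2]
    linarith
  rw [← hsum]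
  refine intervalIntegral.integral_congr fun t _ => ?_
  simp only [hV, hV']
  field_simp
  ring

set_option maxHeartbeats 1000000 in
/-- `φ ∘ u + ½ ∫ |u'|²` is `lam M²`-convex on intervals on which `|u'| ≤ M`. -/
theorem energy_add_le_chord (h : RegularMinimizer φ lam ε c u y) {a b M : ℝ} (ha : 0 < a)
    (hab : a < b) (hM : ∀ r ∈ Icc a b, y r ≤ M) {s : ℝ} (hs : s ∈ Icc a b) :
    (φ (u s)).toReal + sqIntegral y s / 2 ≤
      ((b - s) * ((φ (u a)).toReal + sqIntegral y a / 2) +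
        (s - a) * ((φ (u b)).toReal + sqIntegral y b / 2)) / (b - a) -
      lam / 2 * M ^ 2 * ((s - a) * (b - s)) := by
  have hlam := h.lam_neg
  have hε := h.eps_pos
  set A := sqIntegral y with hA
  set F : ℝ → ℝ := fun t => (φ (u t)).toReal with hF
  have hFE : ∀ t, 0 < t → φ (u t) = (F t : EReal) := fun t ht =>
    (EReal.coe_toReal (h.lt_top t ht).ne (h.ne_bot _)).symm
  have hδ : 0 < b - a := sub_pos.2 hab
  set L : ℝ → ℝ := fun s => ((b - s) * (F a + A a / 2) + (s - a) * (F b + A b / 2)) / (b - a) -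
    lam / 2 * M ^ 2 * ((s - a) * (b - s)) - A s / 2 with hL
  have hIci : Icc a b ⊆ Ici 0 := fun t ht => ha.le.trans ht.1
  have hAc : ContinuousOn A (Icc a b) := h.continuousOn_sqIntegral.mono hIci
  have hLc : ContinuousOn L (Icc a b) := by fun_prop
  suffices hsuff : φ (u s) ≤ (L s : EReal) by
    rw [hFE s (ha.trans_le hs.1), EReal.coe_le_coe_iff] at hsuff
    simp only [hL] at hsuff
    linarith
  refine le_of_forall_not_excursion (L := L) (h.lowerSemicontinuousOn.mono hIci) hLc ?_ ?_ ?_ s hs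
  · rw [hFE a ha, EReal.coe_le_coe_iff]
    refine le_of_eq ?_
    simp only [hL]; field_simp; ring
  · rw [hFE b (ha.trans hab), EReal.coe_le_coe_iff]
    refine le_of_eq ?_
    simp only [hL]; field_simp; ring
  intro a' b' ha' hab' hb' hLa hLb
  have ha0 : 0 < a' := ha.trans_le ha'
  have hb0 : 0 < b' := ha0.trans hab'
  rw [hFE a' ha0, EReal.coe_le_coe_iff] at hLa
  rw [hFE b' hb0, EReal.coe_le_coe_iff] at hLb
  set δ := b' - a' with hδ'
  have hδ'pos : 0 < δ := sub_pos.2 hab'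
  have hsub' : Icc a' b' ⊆ Icc a b := Icc_subset_Icc ha' hb'
  have hθ : ∀ t, ∫ r in a'..t, (fun _ : ℝ => δ⁻¹) r = (t - a') / δ := fun t => by
    rw [intervalIntegral.integral_const, smul_eq_mul, div_eq_mul_inv]
  refine h.not_excursion h.conv ha0.le hab' (h.lt_top a' ha0) (h.lt_top b' hb0)
    (k := fun _ => δ⁻¹) (memLp_const _) (fun _ => (inv_pos.2 hδ'pos).le) ?_ (hLc.mono hsub') ?_
  · rw [hθ b']; exact div_self hδ'pos.ne'
  set d := dist (u a') (u b') with hd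
  have hd0 : 0 ≤ d := dist_nonneg
  have hdM : d ≤ M * δ := (h.dist_le_arcLength ha0.le hab'.le).trans
    (h.arcLength_sub_le ha0.le hab'.le fun r hr => hM r (hsub' hr))
  have hdA : d ^ 2 ≤ δ * (A b' - A a') := h.sq_dist_le ha0.le hab'
  have hy2 : ContinuousOn (fun t => y t ^ 2) (uIcc a' b') := by
    rw [uIcc_of_le hab'.le]
    exact (h.cont.mono (fun t ht => ha0.trans_le ht.1)).pow 2
  have hAc' : ContinuousOn A (uIcc a' b') := by rw [uIcc_of_le hab'.le]; exact hAc.mono hsub'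
  set Q : ℝ → ℝ := fun t => (1 - (t - a') / δ) * F a' + (t - a') / δ * F b' -
    lam / 2 * ((t - a') / δ) * (1 - (t - a') / δ) * d ^ 2 with hQ
  have hQc : Continuous Q := by fun_prop
  set P : ℝ → ℝ := fun t => ε / 2 * y t ^ 2 - (A t / 2 - ((b' - t) * (A a' / 2) +
      (t - a') * (A b' / 2)) / (b' - a')) with hP
  have hPc : ContinuousOn P (uIcc a' b') := by fun_prop
  have hpc : Continuous fun t : ℝ => Real.exp (-t / ε) := by fun_prop
  have hchord := h.integral_sq_mul_exp ha0 hab'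
  -- The constant-speed geodesic has squared speed at most the mean of |u'|². That mean is traded
  -- for `P` by the integral identity, and the chord of A/2 inside `P` completes F(a'), F(b') to F +
  -- A/2 at the endpoints.
  calc ∫ t in a'..b', (ε / 2 * (d * (fun _ : ℝ => δ⁻¹) t) ^ 2 +
      ((1 - ∫ r in a'..t, (fun _ : ℝ => δ⁻¹) r) * F a' + (∫ r in a'..t, (fun _ : ℝ => δ⁻¹) r) * F b'
        - lam / 2 * (∫ r in a'..t, (fun _ : ℝ => δ⁻¹) r) *
          (1 - ∫ r in a'..t, (fun _ : ℝ => δ⁻¹) r) * d ^ 2)) * Real.exp (-t / ε)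
      = ∫ t in a'..b', (ε / 2 * (d * δ⁻¹) ^ 2 * Real.exp (-t / ε) + Q t * Real.exp (-t / ε)) := by
        refine intervalIntegral.integral_congr fun t _ => ?_
        simp only [hθ, hQ]
        ring
    _ ≤ ∫ t in a'..b', (ε / 2 * ((A b' - A a') / (b' - a')) * Real.exp (-t / ε) +
          Q t * Real.exp (-t / ε)) := by
        refine intervalIntegral.integral_mono_on hab'.le
          (Continuous.intervalIntegrable (by fun_prop) _ _)
          (Continuous.intervalIntegrable (by fun_prop) _ _) fun t _ => ?_
        refine add_le_add_left (mul_le_mul_of_nonneg_right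
          (mul_le_mul_of_nonneg_left ?_ (by positivity)) (Real.exp_pos _).le) _
        rw [← hδ', le_div_iff₀ hδ'pos]
        have : (d * δ⁻¹) ^ 2 * δ = d ^ 2 / δ := by field_simp
        rw [this, div_le_iff₀ hδ'pos]
        linarith
    _ = ∫ t in a'..b', (P t * Real.exp (-t / ε) + Q t * Real.exp (-t / ε)) := by
        rw [intervalIntegral.integral_add (Continuous.intervalIntegrable (by fun_prop) _ _)
          (Continuous.intervalIntegrable (by fun_prop) _ _), ← hchord,
          intervalIntegral.integral_add (f := fun t => P t * Real.exp (-t / ε))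
          (hPc.mul hpc.continuousOn).intervalIntegrable
          (Continuous.intervalIntegrable (by fun_prop) _ _)]
    _ ≤ ∫ t in a'..b', (ε / 2 * y t ^ 2 + L t) * Real.exp (-t / ε) := by
        have hLc' : ContinuousOn L (uIcc a' b') := by
          rw [uIcc_of_le hab'.le]; exact hLc.mono hsub'
        refine intervalIntegral.integral_mono_on hab'.le
          ((hPc.mul hpc.continuousOn).add (hQc.mul hpc).continuousOn).intervalIntegrable
          (((hy2.const_mul _).add hLc').mul hpc.continuousOn).intervalIntegrable fun t ht => ?_
        rw [← add_mul]
        refine mul_le_mul_of_nonneg_right ?_ (Real.exp_pos _).le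
        set θ := (t - a') / δ with hθdef
        have hθ0 : 0 ≤ θ := div_nonneg (sub_nonneg.2 ht.1) hδ'pos.le
        have hθ1 : θ ≤ 1 := (div_le_one hδ'pos).2 (by rw [hδ']; linarith [ht.2])
        have htθ : t = a' + θ * δ := by rw [hθdef]; field_simp; ring
        have hbδ : b' = a' + δ := by rw [hδ']; ring
        have hchordA : ((b' - t) * (A a' / 2) + (t - a') * (A b' / 2)) / (b' - a') =
            (1 - θ) * (A a' / 2) + θ * (A b' / 2) := by
          rw [← hδ', div_eq_iff hδ'pos.ne']
          have e1 : b' - t = (1 - θ) * δ := by rw [htθ, hbδ]; ring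
          have e2 : t - a' = θ * δ := by rw [htθ]; ring
          rw [e1, e2]; ring
        -- L + A/2 is quadratic in time, so it is recovered from its values at a' and b' with the
        -- same second-order coefficient.
        have hLt : L t = (1 - θ) * (L a' + A a' / 2) + θ * (L b' + A b' / 2) - A t / 2 -
            lam / 2 * M ^ 2 * (θ * (1 - θ) * δ ^ 2) := by
          have : ∀ q, L q + A q / 2 = ((b - q) * (F a + A a / 2) + (q - a) * (F b + A b / 2)) /
              (b - a) - lam / 2 * M ^ 2 * ((q - a) * (b - q)) := fun q => by
            simp only [hL]; ring
          have hLt' := this t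
          rw [this a', this b']
          rw [eq_sub_iff_add_eq.2 hLt']
          generalize A t = At
          generalize F a + A a / 2 = fa
          generalize F b + A b / 2 = fb
          rw [hbδ, htθ]
          field_simp
          ring
        have hPt : P t = ε / 2 * y t ^ 2 - (A t / 2 - ((1 - θ) * (A a' / 2) + θ * (A b' / 2))) := by
          simp only [hP]; rw [hchordA]
        have hsq : d ^ 2 ≤ (M * δ) ^ 2 := pow_le_pow_left₀ hd0 hdM 2
        have h3 : 0 ≤ -(lam / 2) * (θ * (1 - θ)) :=
          mul_nonneg (by linarith) (mul_nonneg hθ0 (by linarith))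
        rw [hLt, hPt]
        have e1 := mul_le_mul_of_nonneg_left hLa (by linarith : 0 ≤ 1 - θ)
        have e2 := mul_le_mul_of_nonneg_left hLb hθ0
        have e3 := mul_le_mul_of_nonneg_left hsq h3
        have e4 : Q t = (1 - θ) * F a' + θ * F b' - lam / 2 * θ * (1 - θ) * d ^ 2 := rfl
        rw [e4]
        linarith

/-- As λ < 0, m ≤ λ|u'|² says |u'|² ≤ m/λ; the speed bound M = √(m/λ) turns λM² into m. -/
theorem second_difference_le (h : RegularMinimizer φ lam ε c u y) {s k m : ℝ} (hk : 0 < k)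
    (hks : k < s) (hm : ∀ r ∈ Icc (s - k) (s + k), m ≤ lam * y r ^ 2) :
    k ^ 2 * m ≤ ((φ (u (s + k))).toReal + sqIntegral y (s + k) / 2) +
      ((φ (u (s - k))).toReal + sqIntegral y (s - k) / 2) -
      2 * ((φ (u s)).toReal + sqIntegral y s / 2) := by
  have hlam := h.lam_neg
  have hy : ∀ r ∈ Icc (s - k) (s + k), y r ≤ √(m / lam) := fun r hr => by
    refine Real.le_sqrt_of_sq_le ?_
    rw [le_div_iff_of_neg hlam]
    linarith [hm r hr]
  have hm0 : 0 ≤ m / lam := by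
    have := hm s ⟨by linarith, by linarith⟩
    refine div_nonneg_of_nonpos ?_ hlam.le
    nlinarith [sq_nonneg (y s)]
  have h1 := h.energy_add_le_chord (sub_pos.2 hks) (by linarith : s - k < s + k) hy
    (s := s) ⟨by linarith, by linarith⟩
  rw [Real.sq_sqrt hm0] at h1
  have e1 : s + k - s = k := by ring
  have e2 : s - (s - k) = k := by ring
  have e3 : s + k - (s - k) = 2 * k := by ring
  have e4 : lam / 2 * (m / lam) * (k * k) = k ^ 2 * m / 2 := by
    have := hlam.ne
    field_simp
  rw [e1, e2, e3, e4] at h1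
  generalize (φ (u (s - k))).toReal + sqIntegral y (s - k) / 2 = p at *
  generalize (φ (u (s + k))).toReal + sqIntegral y (s + k) / 2 = q at *
  have e5 : (k * p + k * q) / (2 * k) = (p + q) / 2 := by field_simp
  rw [e5] at h1
  linarith

theorem continuousOn_energy_add (h : RegularMinimizer φ lam ε c u y) :
    ContinuousOn (fun t => (φ (u t)).toReal + sqIntegral y t / 2) (Ioi 0) :=
  h.continuousOn_energy.add
    ((h.continuousOn_sqIntegral.mono Ioi_subset_Ici_self).div_const 2)

theorem integral_sq_mul_le (h : RegularMinimizer φ lam ε c u y) {ξ : ℝ → ℝ} (hξ : IsTest ξ)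
    (hξ0 : ∀ t, 0 ≤ ξ t) :
    ∫ t in Ioi 0, lam * y t ^ 2 * ξ t ≤
      (∫ t in Ioi 0, (φ (u t)).toReal * deriv (deriv ξ) t) -
        1 / 2 * ∫ t in Ioi 0, y t ^ 2 * deriv ξ t := by
  have h1 := integral_mul_le_integral_mul_deriv_deriv h.continuousOn_energy_add
    ((h.cont.pow 2).const_mul lam) (fun s k m hk hks hm => h.second_difference_le hk hks hm) hξ hξ0
  refine h1.trans_eq ?_
  have hA : LocallyIntegrableOn (sqIntegral y) (Ioi 0) :=
    (h.continuousOn_sqIntegral.mono Ioi_subset_Ici_self).locallyIntegrableOn measurableSet_Ioi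
  have h2 := h.integral_sqIntegral_mul_deriv hξ.deriv
  have h3 : ∀ t, ((φ (u t)).toReal + sqIntegral y t / 2) * deriv (deriv ξ) t =
      (φ (u t)).toReal * deriv (deriv ξ) t + 1 / 2 * (sqIntegral y t * deriv (deriv ξ) t) :=
    fun t => by ring
  simp_rw [h3]
  rw [integral_add (hξ.deriv.deriv.integrableOn_mul h.locallyIntegrableOn_energy)
    ((hξ.deriv.deriv.integrableOn_mul hA).const_mul _), integral_const_mul, h2]
  ring

theorem strongConvexOn (h : RegularMinimizer φ lam ε c u y) {a b : ℝ} (ha : 0 < a) :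
    ∃ C, 0 < C ∧ StrongConvexOn (Icc a b) (lam * C)
      fun t => (φ (u t)).toReal + sqIntegral y t / 2 := by
  obtain ⟨M, hM0, hM⟩ := h.exists_speed_le (b := b) ha
  have hM1 : ∀ r ∈ Icc a b, y r ≤ M + 1 := fun r hr => (hM r hr).trans (by linarith)
  set f : ℝ → ℝ := fun t => (φ (u t)).toReal + sqIntegral y t / 2 with hf
  have key : ∀ s ∈ Icc a b, ∀ t ∈ Icc a b, s < t → ∀ p q : ℝ, 0 ≤ p → 0 ≤ q → p + q = 1 →
      f (p * s + q * t) ≤ p * f s + q * f t - p * q * (lam * (M + 1) ^ 2 / 2 * (t - s) ^ 2) := by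
    intro s hs t ht hst p q hp hq hpq
    obtain rfl : p = 1 - q := by linarith
    have hδ : t - s ≠ 0 := (sub_pos.2 hst).ne'
    have h1 := h.energy_add_le_chord (ha.trans_le hs.1) hst
      (fun r hr => hM1 r ⟨hs.1.trans hr.1, hr.2.trans ht.2⟩) (s := (1 - q) * s + q * t)
      ⟨by nlinarith, by nlinarith⟩
    refine h1.trans_eq ?_
    simp only [hf]
    generalize (φ (u s)).toReal + sqIntegral y s / 2 = fs
    generalize (φ (u t)).toReal + sqIntegral y t / 2 = ft
    field_simp
    ring
  -- The bound M may be zero; the shift by one keeps the constant positive.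
  refine ⟨(M + 1) ^ 2, by positivity, convex_Icc a b, fun s hs t ht p q hp hq hpq => ?_⟩
  simp only [smul_eq_mul, Real.norm_eq_abs, sq_abs]
  rcases lt_trichotomy s t with hst | rfl | hst
  · refine (key s hs t ht hst p q hp hq hpq).trans_eq ?_
    ring
  · rw [← add_mul, ← add_mul, hpq]; simp [hf]
  · rw [add_comm (p * s)]
    refine (key t ht s hs hst q p hq hp (by linarith)).trans_eq ?_
    ring

end RegularMinimizer

end WED

namespace WED

/-! ### Monotonicity from touching functions -/

/-- A continuous function touched from above at every point, to the right of it, by a function with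
nonpositive derivative is nonincreasing. -/
theorem le_of_touching_above {f : ℝ → ℝ} {a b : ℝ} (hab : a ≤ b) (hf : ContinuousOn f (Icc a b))
    (h : ∀ x ∈ Ico a b, ∃ (p : ℝ → ℝ) (p' : ℝ), p' ≤ 0 ∧ HasDerivAt p p' x ∧ p x = f x ∧
      ∀ z ∈ Icc x b, f z ≤ p z) : f b ≤ f a := by
  -- Touching on the right bounds the right slopes of f by those of p, which is all this criterion
  -- needs.
  refine image_le_of_liminf_slope_right_le_deriv_boundary hf (B := fun _ => f a) (B' := fun _ => 0)
    le_rfl continuousOn_const (fun x _ => hasDerivWithinAt_const _ _ _) (fun x hx r hr => ?_)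
    (right_mem_Icc.2 hab)
  obtain ⟨p, p', hp', hp, hpx, hle⟩ := h x hx
  have h1 := (hasDerivAt_iff_tendsto_slope.1 hp).mono_left
    (nhdsWithin_mono x fun z (hz : x < z) => hz.ne')
  have h2 : ∀ᶠ z in 𝓝[>] x, slope f x z < r := by
    filter_upwards [h1.eventually_lt_const (hp'.trans_lt hr), Ioc_mem_nhdsGT hx.2] with z hz hzb
    refine lt_of_le_of_lt ?_ hz
    rw [slope_def_field, slope_def_field, hpx]
    have := hle z ⟨hzb.1.le, hzb.2⟩
    have : 0 ≤ z - x := sub_nonneg.2 hzb.1.le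
    gcongr
  exact h2.frequently

theorem le_of_touching_below {f : ℝ → ℝ} {a b : ℝ} (hab : a ≤ b) (hf : ContinuousOn f (Icc a b))
    (h : ∀ x ∈ Ico a b, ∃ (p : ℝ → ℝ) (p' : ℝ), 0 ≤ p' ∧ HasDerivAt p p' x ∧ p x = f x ∧
      ∀ z ∈ Icc x b, p z ≤ f z) : f a ≤ f b := by
  refine neg_le_neg_iff.1 (le_of_touching_above (f := fun t => -f t) hab hf.neg fun x hx => ?_)
  obtain ⟨p, p', hp', hp, hpx, hle⟩ := h x hx
  exact ⟨fun z => -p z, -p', neg_nonpos.2 hp', hp.neg, congrArg Neg.neg hpx,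
    fun z hz => neg_le_neg (hle z hz)⟩

/-- The factor g need not be differentiable because the other factor vanishes at x. It is applied to
the speed times an increment of arc length. -/
theorem hasDerivAt_mul_of_continuousAt {f g : ℝ → ℝ} {f' x : ℝ} (hg : ContinuousAt g x)
    (hf : HasDerivAt f f' x) (h0 : f x = 0) : HasDerivAt (fun z => g z * f z) (g x * f') x := by
  rw [hasDerivAt_iff_tendsto_slope] at hf ⊢
  refine ((hg.mono_left nhdsWithin_le_nhds).mul hf).congr fun z => ?_
  rw [slope_def_field, slope_def_field, h0]
  ring

/-! ### Growth of the speed -/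

variable {X : Type*} [MetricSpace X]

namespace RegularMinimizer

variable {φ : X → EReal} {lam ε c : ℝ} {u : ℝ → X} {y : ℝ → ℝ}

theorem arcLength_lt (h : RegularMinimizer φ lam ε c u y) {s t r : ℝ} (hs : 0 < s) (hst : s < t)
    (hr : r ∈ Icc s t) (hy : 0 < y r) : arcLength y s < arcLength y t :=
  lt_of_le_of_ne (h.arcLength_mono hs.le (hs.trans hst).le hst.le) fun heq =>
    hy.ne' (h.speed_eq_zero hs hst heq r hr)

/-- Along a minimizer, slopes of the convexified energy bound from below the later growth of the
speed. -/
theorem speed_growth (h : RegularMinimizer φ lam ε c u y) {s₀ t₀ σ : ℝ} (hs₀ : 0 < s₀)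
    (hst₀ : s₀ < t₀) (hy : 0 < y t₀)
    (hσ : σ * (arcLength y t₀ - arcLength y s₀) =
      ((φ (u t₀)).toReal - lam / 2 * arcLength y t₀ ^ 2) -
        ((φ (u s₀)).toReal - lam / 2 * arcLength y s₀ ^ 2)) {s t : ℝ} (hs : t₀ ≤ s) (hst : s ≤ t) :
    ε / 2 * y s ^ 2 + σ * (arcLength y t - arcLength y s) +
      lam / 2 * (arcLength y t ^ 2 - arcLength y s ^ 2) + (sqIntegral y t - sqIntegral y s) ≤
      ε / 2 * y t ^ 2 := by
  set l := arcLength y with hl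
  have ht₀ := hs₀.trans hst₀
  have hs0 := ht₀.trans_le hs
  have hδ : 0 < l t₀ - l s₀ := sub_pos.2 (h.arcLength_lt hs₀ hst₀ (right_mem_Icc.2 hst₀.le) hy)
  -- By convexity in l, slopes after t₀ are at least σ; the argument is repeated from t₀ to s below,
  -- and the first integral then converts energy increments into increments of |u'|².
  have h1 : ∀ r, t₀ ≤ r → σ * (l r - l t₀) ≤ ((φ (u r)).toReal - lam / 2 * l r ^ 2) -
      ((φ (u t₀)).toReal - lam / 2 * l t₀ ^ 2) := fun r hr => by
    have h2 := h.three_point h.lam_neg h.conv hs₀.le hst₀.le hr (h.lt_top s₀ hs₀)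
      (h.lt_top r (ht₀.trans_le hr))
    refine le_of_mul_le_mul_left ?_ hδ
    calc (l t₀ - l s₀) * (σ * (l r - l t₀)) = (l r - l t₀) * (σ * (l t₀ - l s₀)) := by ring
      _ ≤ _ := by rw [hσ]; linarith
  have h2 : σ * (l t - l s) ≤ ((φ (u t)).toReal - lam / 2 * l t ^ 2) -
      ((φ (u s)).toReal - lam / 2 * l s ^ 2) := by
    rcases hs.eq_or_lt with rfl | hlt
    · exact h1 t hst
    have h3 := h.three_point h.lam_neg h.conv ht₀.le hs hst (h.lt_top t₀ ht₀)
      (h.lt_top t (hs0.trans_le hst))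
    have h4 : 0 < l s - l t₀ := sub_pos.2 (h.arcLength_lt ht₀ hlt (left_mem_Icc.2 hs) hy)
    have h5 := mul_le_mul_of_nonneg_left (h1 s hs)
      (sub_nonneg.2 (h.arcLength_mono hs0.le (hs0.le.trans hst) hst) : 0 ≤ l t - l s)
    refine le_of_mul_le_mul_left ?_ h4
    calc (l s - l t₀) * (σ * (l t - l s)) = (l t - l s) * (σ * (l s - l t₀)) := by ring
      _ ≤ _ := by linarith
  have e1 := h.first_integral s hs0
  have e2 := h.first_integral t (hs0.trans_le hst)
  linarith

theorem not_integrableOn_of_growth {y : ℝ → ℝ} {ε R κ t₁ : ℝ} (hR : 1 / ε ≤ 2 * R)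
    (hκ : 0 < κ) (h : ∀ t, t₁ ≤ t → κ * Real.exp (R * t) ≤ y t) :
    ¬ IntegrableOn (fun t => y t ^ 2 * Real.exp (-t / ε)) (Ioi t₁) := by
  intro hint
  set t₂ := max t₁ 0 with ht₂
  have h1 : IntegrableOn (fun _ : ℝ => κ ^ 2) (Ioi t₂) := by
    refine (hint.mono_set (Ioi_subset_Ioi (le_max_left _ _))).mono'
      aestronglyMeasurable_const ?_
    filter_upwards [ae_restrict_mem measurableSet_Ioi] with t ht
    have ht1 : t₁ ≤ t := (le_max_left _ _).trans (le_of_lt ht)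
    have ht0 : 0 ≤ t := (le_max_right _ _).trans (le_of_lt ht)
    rw [Real.norm_of_nonneg (sq_nonneg _)]
    have h2 : (κ * Real.exp (R * t)) ^ 2 ≤ y t ^ 2 := pow_le_pow_left₀ (by positivity) (h t ht1) 2
    have h3 : 1 ≤ Real.exp (R * t) ^ 2 * Real.exp (-t / ε) := by
      rw [← Real.exp_nat_mul, ← Real.exp_add, Real.one_le_exp_iff]
      have := mul_le_mul_of_nonneg_right hR ht0
      have e : -t / ε = -(1 / ε * t) := by ring
      rw [e]
      push_cast
      linarith
    calc κ ^ 2 ≤ κ ^ 2 * (Real.exp (R * t) ^ 2 * Real.exp (-t / ε)) :=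
          le_mul_of_one_le_right (sq_nonneg _) h3
      _ = (κ * Real.exp (R * t)) ^ 2 * Real.exp (-t / ε) := by ring
      _ ≤ _ := mul_le_mul_of_nonneg_right h2 (Real.exp_pos _).le
  rw [integrableOn_const_iff] at h1
  rcases h1 with h1 | h1
  · exact (pow_pos hκ 2).ne' (enorm_eq_zero.1 h1)
  · simp at h1

/-- If a slope of the convexified energy were too large at a point of positive speed, the speed
would grow so fast that its energy is infinite. -/
theorem slope_le (h : RegularMinimizer φ lam ε c u y) {r : ℝ} (hr : 0 ≤ r)
    (hr1 : 2 * ε * r ≤ 1) (hr2 : -lam ≤ r - ε * r ^ 2) {s₀ t₀ σ : ℝ} (hs₀ : 0 < s₀)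
    (hst₀ : s₀ < t₀) (hy : 0 < y t₀)
    (hσ : σ * (arcLength y t₀ - arcLength y s₀) =
      ((φ (u t₀)).toReal - lam / 2 * arcLength y t₀ ^ 2) -
        ((φ (u s₀)).toReal - lam / 2 * arcLength y s₀ ^ 2)) :
    (1 - ε * r) * y t₀ + σ + lam * arcLength y t₀ ≤ 0 := by
  by_contra hcon
  rw [not_le] at hcon
  have hε := h.eps_pos
  have hlam := h.lam_neg
  have ht₀ := hs₀.trans hst₀
  set l := arcLength y with hl
  set A := sqIntegral y with hA
  set R := 1 / ε - r with hR
  have hεR : ε * R = 1 - ε * r := by rw [hR]; field_simp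
  have hRpos : 0 < ε * R := by rw [hεR]; linarith
  have hR0 : 0 < R := pos_of_mul_pos_right hRpos hε.le
  set Q : ℝ → ℝ := fun t => ε * R * y t + σ + lam * l t with hQ
  set Q₀ := Q t₀ with hQ₀
  have hQ₀pos : 0 < Q₀ := by rw [hQ₀, hQ]; simp only; rw [hεR]; exact hcon
  have hsub : Ici t₀ ⊆ Ioi 0 := fun t ht => ht₀.trans_le ht
  have hyc : ContinuousOn y (Ici t₀) := h.cont.mono hsub
  have hlc : ContinuousOn l (Ici t₀) := h.continuousOn_arcLength.mono (hsub.trans Ioi_subset_Ici_self)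
  -- The growth estimate gives the square of a lower barrier for the speed; its root has derivative
  -- (σ + λl + y)/ε where the speed is positive.
  have htouch : ∀ x, t₀ ≤ x → 0 < y x → ∃ p : ℝ → ℝ,
      HasDerivAt p ((σ + lam * l x + y x) / ε) x ∧ p x = y x ∧ ∀ z, x ≤ z → p z ≤ y z := by
    intro x hx hyx
    have hx0 := ht₀.trans_le hx
    set q : ℝ → ℝ := fun z => 2 / ε * (ε / 2 * y x ^ 2 + σ * (l z - l x) +
      lam / 2 * (l z ^ 2 - l x ^ 2) + (A z - A x)) with hq
    have hqx : q x = y x ^ 2 := by simp only [hq]; field_simp; ring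
    have hld := h.hasDerivAt_arcLength hx0
    have hAd := h.hasDerivAt_sqIntegral hx0
    have hqd : HasDerivAt q (2 / ε * (σ * y x + lam / 2 * (2 * l x * y x) + y x ^ 2)) x := by
      refine HasDerivAt.const_mul _ ?_
      have h1 := ((hld.sub_const (l x)).const_mul σ).const_add (ε / 2 * y x ^ 2)
      have h2 := (((hld.pow 2).sub_const (l x ^ 2)).const_mul (lam / 2))
      refine ((h1.add h2).add (hAd.sub_const (A x))).congr_deriv ?_
      simp [hl]
    refine ⟨fun z => √(q z), ?_, ?_, fun z hz => ?_⟩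
    · refine (hqd.sqrt (by rw [hqx]; positivity)).congr_deriv ?_
      rw [hqx, Real.sqrt_sq hyx.le]
      field_simp
    · simp only
      rw [hqx, Real.sqrt_sq hyx.le]
    · refine Real.sqrt_le_iff.2 ⟨h.nonneg z, ?_⟩
      have h1 := h.speed_growth hs₀ hst₀ hy hσ hx hz
      have h2 : y z ^ 2 = 2 / ε * (ε / 2 * y z ^ 2) := by field_simp
      rw [h2]
      exact mul_le_mul_of_nonneg_left h1 (by positivity)
  -- Gronwall for Q' ≥ RQ: the remainder is (R(1 - εR) + λ)y, and R(1 - εR) = r - εr² ≥ -λ.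
  have hgrow : ∀ T, t₀ ≤ T → (∀ t ∈ Ico t₀ T, 0 < y t) →
      Q₀ * Real.exp (R * (T - t₀)) ≤ Q T := by
    intro T hT hpos
    have hQc : ContinuousOn Q (Icc t₀ T) := by
      have h1 := hyc.mono (Icc_subset_Ici_self : Icc t₀ T ⊆ Ici t₀)
      have h2 := hlc.mono (Icc_subset_Ici_self : Icc t₀ T ⊆ Ici t₀)
      fun_prop
    have h1 := le_of_touching_below (f := fun t => Real.exp (-(R * t)) * Q t) hT
      ((by fun_prop : Continuous fun t => Real.exp (-(R * t))).continuousOn.mul hQc) fun x hx => by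
        obtain ⟨p, hp, hpx, hple⟩ := htouch x hx.1 (hpos x hx)
        have hld := h.hasDerivAt_arcLength (ht₀.trans_le hx.1)
        have hed : HasDerivAt (fun t => Real.exp (-(R * t))) (Real.exp (-(R * x)) * -R) x := by
          simpa using (((hasDerivAt_id x).const_mul R).neg).exp
        refine ⟨fun z => Real.exp (-(R * z)) * (ε * R * p z + σ + lam * l z), _, ?_,
          hed.mul ((((hp.const_mul (ε * R)).add_const σ).add (hld.const_mul lam))), ?_,
          fun z hz => ?_⟩
        · have e1 : Real.exp (-(R * x)) * -R * (ε * R * p x + σ + lam * l x) +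
              Real.exp (-(R * x)) * (ε * R * ((σ + lam * l x + y x) / ε) + lam * y x) =
              Real.exp (-(R * x)) * ((R * (1 - ε * R) + lam) * y x) := by
            rw [hpx]; field_simp; ring
          rw [e1]
          refine mul_nonneg (Real.exp_pos _).le (mul_nonneg ?_ (h.nonneg x))
          have e2 : R * (1 - ε * R) = r - ε * r ^ 2 := by rw [hεR, hR]; field_simp; ring
          rw [e2]; linarith
        · simp only [hpx, hQ]
        · refine mul_le_mul_of_nonneg_left ?_ (Real.exp_pos _).le
          have := mul_le_mul_of_nonneg_left (hple z hz.1) hRpos.le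
          simp only [hQ]
          linarith
    have h2 := mul_le_mul_of_nonneg_left h1 (Real.exp_pos (R * T)).le
    rw [← mul_assoc, ← mul_assoc, ← Real.exp_add, ← Real.exp_add] at h2
    have e1 : R * T + -(R * T) = 0 := by ring
    have e2 : R * T + -(R * t₀) = R * (T - t₀) := by ring
    rwa [e1, e2, Real.exp_zero, one_mul, mul_comm] at h2
  have hmono : ∀ T, t₀ ≤ T → (∀ t ∈ Ico t₀ T, 0 < y t) → y t₀ ≤ y T := by
    intro T hT hpos
    refine le_of_touching_below hT (hyc.mono Icc_subset_Ici_self) fun x hx => ?_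
    obtain ⟨p, hp, hpx, hple⟩ := htouch x hx.1 (hpos x hx)
    refine ⟨p, _, div_nonneg ?_ hε.le, hp, hpx, fun z hz => hple z hz.1⟩
    have h1 := hgrow x hx.1 fun t ht => hpos t ⟨ht.1, ht.2.trans hx.2⟩
    have h2 : 0 < Q x := (by positivity : 0 < Q₀ * Real.exp (R * (x - t₀))).trans_le h1
    have h3 : σ + lam * l x + y x = Q x + ε * r * y x := by
      simp only [hQ]; rw [hεR]; ring
    rw [h3]
    have := h.nonneg x
    positivity
  -- At a first zero the speed would still be at least `y t₀`, since it is nondecreasing while it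
  -- stays positive.
  have hpos : ∀ T, t₀ ≤ T → 0 < y T := by
    intro T hT
    by_contra hyT
    have hyT0 : y T = 0 := le_antisymm (not_lt.1 hyT) (h.nonneg T)
    have hcl : IsClosed (Icc t₀ T ∩ y ⁻¹' {0}) :=
      (hyc.mono Icc_subset_Ici_self).preimage_isClosed_of_isClosed isClosed_Icc isClosed_singleton
    have hcpt : IsCompact (Icc t₀ T ∩ y ⁻¹' {0}) :=
      isCompact_Icc.of_isClosed_subset hcl inter_subset_left
    obtain ⟨τ, hτ, hτmin⟩ := hcpt.exists_isLeast ⟨T, right_mem_Icc.2 hT, hyT0⟩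
    have h1 := hmono τ hτ.1.1 fun t ht => by
      refine lt_of_le_of_ne (h.nonneg t) fun heq => ?_
      exact absurd (hτmin ⟨⟨ht.1, ht.2.le.trans hτ.1.2⟩, heq.symm⟩) (not_le.2 ht.2)
    have h2 : y τ = 0 := hτ.2
    linarith
  have hlow : ∀ t, t₀ ≤ t → Q₀ * Real.exp (R * (t - t₀)) ≤ ε * R * y t + |σ| := fun t ht => by
    have h1 := hgrow t ht fun s hs => hpos s hs.1
    have h2 : lam * l t ≤ 0 :=
      mul_nonpos_of_nonpos_of_nonneg hlam.le (h.arcLength_nonneg (ht₀.le.trans ht))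
    have h3 := le_abs_self σ
    simp only [hQ] at h1
    linarith
  -- Half of the exponential eventually absorbs |σ|; the other half bounds the speed from below.
  have hexp : Tendsto (fun t => Q₀ / 2 * Real.exp (R * (t - t₀))) atTop atTop :=
    (Real.tendsto_exp_atTop.comp ((tendsto_atTop_add_const_right _ (-t₀) tendsto_id).const_mul_atTop
      hR0)).const_mul_atTop (half_pos hQ₀pos)
  obtain ⟨t₁, ht₁⟩ := eventually_atTop.1 ((hexp.eventually_ge_atTop |σ|).and (eventually_ge_atTop t₀))
  refine not_integrableOn_of_growth (y := y) (t₁ := t₁) (R := R)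
    (κ := Q₀ / 2 * Real.exp (-(R * t₀)) / (ε * R)) ?_ (by positivity) (fun t ht => ?_)
    (h.int_speed.mono_set (Ioi_subset_Ioi (ht₀.le.trans (ht₁ t₁ le_rfl).2)))
  · rw [hR, div_le_iff₀ hε]
    have : 2 * (1 / ε - r) * ε = 2 - 2 * ε * r := by field_simp
    linarith
  · obtain ⟨h1, h2⟩ := ht₁ t ht
    have h3 := hlow t h2
    rw [div_mul_eq_mul_div, div_le_iff₀ hRpos, mul_assoc, ← Real.exp_add]
    have e : -(R * t₀) + R * t = R * (t - t₀) := by ring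
    rw [e]
    linarith

/-- The slope bound over [s,t] multiplied by the length covered there, rewritten with the first
integral. The speed is evaluated at the right endpoint, so s may be fixed and t varied in an upper
barrier. -/
theorem sq_speed_sub_le (h : RegularMinimizer φ lam ε c u y) {r : ℝ} (hr : 0 ≤ r)
    (hr1 : 2 * ε * r ≤ 1) (hr2 : -lam ≤ r - ε * r ^ 2) {s t : ℝ} (hs : 0 < s) (hst : s ≤ t) :
    ε / 2 * (y t ^ 2 - y s ^ 2) ≤ -lam / 2 * (arcLength y t - arcLength y s) ^ 2 -
      (1 - ε * r) * (y t * (arcLength y t - arcLength y s)) +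
        (sqIntegral y t - sqIntegral y s) := by
  have hε := h.eps_pos
  have hlam := h.lam_neg
  have hA := h.sqIntegral_mono hs.le (hs.le.trans hst) hst
  rcases hst.eq_or_lt with rfl | hlt
  · simp
  rcases (h.nonneg t).eq_or_lt with hy | hy
  · rw [← hy]
    have h1 : 0 ≤ ε / 2 * y s ^ 2 := by positivity
    have h2 : 0 ≤ -lam / 2 * (arcLength y t - arcLength y s) ^ 2 :=
      mul_nonneg (by linarith) (sq_nonneg _)
    linarith
  have hδ := sub_pos.2 (h.arcLength_lt hs hlt (right_mem_Icc.2 hst) hy)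
  set σ := (((φ (u t)).toReal - lam / 2 * arcLength y t ^ 2) -
    ((φ (u s)).toReal - lam / 2 * arcLength y s ^ 2)) / (arcLength y t - arcLength y s) with hσ
  have hσ' := div_mul_cancel₀ (((φ (u t)).toReal - lam / 2 * arcLength y t ^ 2) -
    ((φ (u s)).toReal - lam / 2 * arcLength y s ^ 2)) hδ.ne'
  have h1 := mul_le_mul_of_nonneg_right (h.slope_le hr hr1 hr2 hs hlt hy hσ') hδ.le
  rw [← hσ] at hσ' h1
  have e1 := h.first_integral s hs
  have e2 := h.first_integral t (hs.trans hlt)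
  nlinarith

/-- The preceding estimate touches y² from above at x with slope (2/ε)(y² - (1 - εr)y²) = 2ry²,
exactly compensated by the exponential factor. -/
theorem antitoneOn_exp_mul_sq_speed (h : RegularMinimizer φ lam ε c u y) {r : ℝ} (hr : 0 ≤ r)
    (hr1 : 2 * ε * r ≤ 1) (hr2 : -lam ≤ r - ε * r ^ 2) :
    AntitoneOn (fun t => Real.exp (-(2 * r * t)) * y t ^ 2) (Ioi 0) := by
  intro a ha b _ hab
  have ha' : (0 : ℝ) < a := ha
  have hε := h.eps_pos
  set l := arcLength y with hl
  set A := sqIntegral y with hA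
  refine le_of_touching_above (f := fun t => Real.exp (-(2 * r * t)) * y t ^ 2) hab
    ((by fun_prop : Continuous fun t => Real.exp (-(2 * r * t))).continuousOn.mul
      ((h.cont.mono fun t ht => ha'.trans_le ht.1).pow 2)) fun x hx => ?_
  have hx0 : 0 < x := ha'.trans_le hx.1
  have hld : HasDerivAt (fun z => l z - l x) (y x) x := (h.hasDerivAt_arcLength hx0).sub_const _
  have hAd : HasDerivAt (fun z => A z - A x) (y x ^ 2) x :=
    (h.hasDerivAt_sqIntegral hx0).sub_const _
  have hed : HasDerivAt (fun t => Real.exp (-(2 * r * t)))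
      (Real.exp (-(2 * r * x)) * -(2 * r)) x := by
    simpa using (((hasDerivAt_id x).const_mul (2 * r)).neg).exp
  have hyl := hasDerivAt_mul_of_continuousAt (h.continuousAt_speed hx0) hld (sub_self _)
  have hp : HasDerivAt (fun z => y x ^ 2 + 2 / ε * (-lam / 2 * (l z - l x) ^ 2 -
      (1 - ε * r) * (y z * (l z - l x)) + (A z - A x))) (2 * r * y x ^ 2) x := by
    refine (((((hld.pow 2).const_mul (-lam / 2)).sub (hyl.const_mul (1 - ε * r))).add
      hAd).const_mul (2 / ε) |>.const_add (y x ^ 2)).congr_deriv ?_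
    simp only [sub_self]
    field_simp
    ring
  refine ⟨_, _, ?_, hed.mul hp, ?_, fun z hz => ?_⟩
  · simp only [sub_self]
    refine le_of_eq ?_
    ring
  · simp
  · refine mul_le_mul_of_nonneg_left ?_ (Real.exp_pos _).le
    have h1 := mul_le_mul_of_nonneg_left (h.sq_speed_sub_le hr hr1 hr2 hx0 hz.1)
      (by positivity : 0 ≤ 2 / ε)
    have h2 : 2 / ε * (ε / 2 * (y z ^ 2 - y x ^ 2)) = y z ^ 2 - y x ^ 2 := by field_simp
    rw [h2] at h1
    linarith

/-- The first integral turns the same estimate into an upper barrier for the energy with slope -(1 -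
εr)y² ≤ 0 at x. -/
theorem antitoneOn_toReal_energy (h : RegularMinimizer φ lam ε c u y) {r : ℝ} (hr : 0 ≤ r)
    (hr1 : 2 * ε * r ≤ 1) (hr2 : -lam ≤ r - ε * r ^ 2) :
    AntitoneOn (fun t => (φ (u t)).toReal) (Ioi 0) := by
  intro a ha b _ hab
  have ha' : (0 : ℝ) < a := ha
  set l := arcLength y with hl
  refine le_of_touching_above (f := fun t => (φ (u t)).toReal) hab
    (h.continuousOn_energy.mono fun t ht => ha'.trans_le ht.1) fun x hx => ?_
  have hx0 : 0 < x := ha'.trans_le hx.1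
  have hld : HasDerivAt (fun z => l z - l x) (y x) x := (h.hasDerivAt_arcLength hx0).sub_const _
  have hyl := hasDerivAt_mul_of_continuousAt (h.continuousAt_speed hx0) hld (sub_self _)
  have hp := ((((hld.pow 2).const_mul (-lam / 2)).sub (hyl.const_mul (1 - ε * r))).const_add
    (φ (u x)).toReal)
  refine ⟨_, _, ?_, hp, ?_, fun z hz => ?_⟩
  · have : 0 ≤ (1 - ε * r) * (y x * y x) := mul_nonneg (by linarith) (mul_self_nonneg _)
    simp only [sub_self]
    norm_num
    exact this
  · simp
  · have h1 := h.sq_speed_sub_le hr hr1 hr2 hx0 hz.1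
    have e1 := h.first_integral x hx0
    have e2 := h.first_integral z (hx0.trans_le hz.1)
    simp only [Pi.sub_apply, Pi.pow_apply]
    linarith

/-- Right-continuity at 0 includes the initial time, even with infinite initial energy. -/
theorem antitoneOn_energy (h : RegularMinimizer φ lam ε c u y) {r : ℝ} (hr : 0 ≤ r)
    (hr1 : 2 * ε * r ≤ 1) (hr2 : -lam ≤ r - ε * r ^ 2) :
    AntitoneOn (fun t => φ (u t)) (Ici 0) := by
  have hpos : ∀ s t, 0 < s → s ≤ t → φ (u t) ≤ φ (u s) := fun s t hs hst => by
    have h1 := h.antitoneOn_toReal_energy hr hr1 hr2 hs (hs.trans_le hst) hst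
    rw [← EReal.coe_toReal (h.lt_top t (hs.trans_le hst)).ne (h.ne_bot _),
      ← EReal.coe_toReal (h.lt_top s hs).ne (h.ne_bot _)]
    exact EReal.coe_le_coe_iff.2 h1
  intro s hs t _ hst
  rcases (show (0 : ℝ) ≤ s from hs).eq_or_lt with rfl | hs
  · rcases hst.eq_or_lt with rfl | ht
    · exact le_rfl
    have h1 := (h.continuousWithinAt_energy_zero h.lam_neg h.conv).mono_left
      (nhdsWithin_mono (0 : ℝ) Ioi_subset_Ici_self)
    refine ge_of_tendsto h1 ?_
    filter_upwards [Ioc_mem_nhdsGT ht] with s hs using hpos s t hs.1 hs.2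
  · exact hpos s t hs hst

end RegularMinimizer

end WED

/-! ### From the continuous speed back to the metric derivative and distributions -/

namespace WED

variable {X : Type*} [MetricSpace X] {φ : X → EReal} {lam ε c : ℝ} {u : ℝ → X} {y : ℝ → ℝ}

namespace RegularMinimizer

theorem halfSpeedSq_ae_eq (h : RegularMinimizer φ lam ε c u y) :
    ∀ᵐ t ∂(volume.restrict (Ioi (0 : ℝ))), halfSpeedSq u t = 1 / 2 * y t ^ 2 := by
  filter_upwards [h.ae_eq] with t ht
  rw [halfSpeedSq, ht]

theorem accumulated_eq (h : RegularMinimizer φ lam ε c u y) {t : ℝ} (ht : 0 ≤ t) :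
    accumulated u t = sqIntegral y t / 2 := by
  have h1 : accumulated u t = ∫ s in (0 : ℝ)..t, 1 / 2 * y s ^ 2 := by
    unfold accumulated
    rw [intervalIntegral.integral_of_le ht, intervalIntegral.integral_of_le ht]
    exact integral_congr_ae
      (ae_restrict_of_ae_restrict_of_subset Ioc_subset_Ioi_self h.halfSpeedSq_ae_eq)
  rw [h1, intervalIntegral.integral_const_mul, sqIntegral]
  ring

theorem locallyLipschitzOn_half_sq_speed (h : RegularMinimizer φ lam ε c u y) :
    LocallyLipschitzOn (Ioi 0) fun t => 1 / 2 * y t ^ 2 := by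
  intro x hx
  obtain ⟨K, s, hs, hK⟩ := h.locallyLipschitzOn_sq_speed hx
  exact ⟨_, s, hs, ((lipschitzWith_smul (1 / 2 : ℝ)).comp_lipschitzOnWith hK)⟩

theorem pairing_halfSpeedSq (h : RegularMinimizer φ lam ε c u y) (ξ : ℝ → ℝ) :
    pairing (halfSpeedSq u) ξ = 1 / 2 * ∫ t in Ioi 0, y t ^ 2 * ξ t := by
  rw [pairing, ← integral_const_mul]
  refine integral_congr_ae ?_
  filter_upwards [h.halfSpeedSq_ae_eq] with t ht
  rw [ht]; ring

theorem pairing_metricDeriv_sq (h : RegularMinimizer φ lam ε c u y) (ξ : ℝ → ℝ) :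
    pairing (fun t => metricDeriv u t ^ 2) ξ = ∫ t in Ioi 0, y t ^ 2 * ξ t := by
  refine integral_congr_ae ?_
  filter_upwards [h.ae_eq] with t ht
  rw [ht]

/-- Stationarity tested with ξ', that is, one further derivative of the first integral. -/
theorem differential_identity (h : RegularMinimizer φ lam ε c u y) {ξ : ℝ → ℝ} (hξ : IsTest ξ) :
    -ε * pairingDeriv2 (halfSpeedSq u) ξ + pairingDeriv (halfSpeedSq u) ξ
      = -pairingDeriv2 (fun t => (φ (u t)).toReal) ξ - pairingDeriv (halfSpeedSq u) ξ := by
  have h1 := h.stationary h.lt_top hξ.deriv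
  have i1 := hξ.deriv.deriv.integrableOn_mul h.locallyIntegrableOn_energy
  have i2 := hξ.deriv.deriv.integrableOn_mul h.locallyIntegrableOn_sq
  have i3 := hξ.deriv.integrableOn_mul h.locallyIntegrableOn_sq
  have h2 : ∀ s, ((φ (u s)).toReal - ε / 2 * y s ^ 2) * deriv (deriv ξ) s - y s ^ 2 * deriv ξ s =
      (φ (u s)).toReal * deriv (deriv ξ) s - ε / 2 * (y s ^ 2 * deriv (deriv ξ) s) -
        y s ^ 2 * deriv ξ s := fun s => by ring
  simp_rw [h2] at h1
  have i4 : IntegrableOn (fun s => (φ (u s)).toReal * deriv (deriv ξ) s -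
      ε / 2 * (y s ^ 2 * deriv (deriv ξ) s)) (Ioi 0) := i1.sub (i2.const_mul _)
  rw [integral_sub i4 i3, integral_sub i1 (i2.const_mul _),
    integral_const_mul] at h1
  simp only [pairingDeriv2, pairingDeriv, h.pairing_halfSpeedSq]
  simp only [pairing]
  linarith

theorem differential_inequality (h : RegularMinimizer φ lam ε c u y) {ξ : ℝ → ℝ} (hξ : IsTest ξ)
    (hξ0 : ∀ t, 0 ≤ ξ t) :
    -ε * pairingDeriv2 (halfSpeedSq u) ξ + pairingDeriv (halfSpeedSq u) ξ
      ≤ -lam * pairing (fun t => metricDeriv u t ^ 2) ξ := by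
  rw [h.differential_identity hξ, h.pairing_metricDeriv_sq]
  simp only [pairingDeriv2, pairingDeriv, h.pairing_halfSpeedSq]
  have h1 := h.integral_sq_mul_le hξ hξ0
  simp_rw [mul_assoc lam] at h1
  rw [integral_const_mul] at h1
  simp only [pairing]
  linarith

end RegularMinimizer

end WED

/-! ### Assembly of the theorem -/

theorem theorem6p7 {X : Type*} [MetricSpace X] [CompleteSpace X]
    (σ : TopologicalSpace X) (hσ : WED.Compatible σ)
    (φ : X → EReal) (hφ : WED.LSCC σ φ)
    (lam : ℝ) (hlam : lam < 0) (hconv : WED.GeodConvex lam φ) :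
    (∀ ε : ℝ, 0 < ε → ∀ x : X, ∀ u ∈ WED.minimizers φ ε x,
      -- `φ ∘ u` is locally Lipschitz on `(0,∞)` and right-continuous at `0`
      ((∀ t : ℝ, 0 < t → φ (u t) < ⊤) ∧
        LocallyLipschitzOn (Ioi 0) (fun t => (φ (u t)).toReal) ∧
        ContinuousWithinAt (fun t => φ (u t)) (Ici 0) 0) ∧
      -- `½ |u'|²` has a locally Lipschitz representative
      (∃ w : ℝ → ℝ, WED.IsLocLipRep w (WED.halfSpeedSq u)) ∧
      -- the differential identity and inequality in the sense of distributions
      (∀ ξ : ℝ → ℝ, WED.IsTest ξ →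
        -ε * WED.pairingDeriv2 (WED.halfSpeedSq u) ξ + WED.pairingDeriv (WED.halfSpeedSq u) ξ
          = -WED.pairingDeriv2 (fun t => (φ (u t)).toReal) ξ
              - WED.pairingDeriv (WED.halfSpeedSq u) ξ ∧
        ((∀ t, 0 ≤ ξ t) →
          -ε * WED.pairingDeriv2 (WED.halfSpeedSq u) ξ + WED.pairingDeriv (WED.halfSpeedSq u) ξ
            ≤ -lam * WED.pairing (fun t => WED.metricDeriv u t ^ 2) ξ)) ∧
      -- `φ ∘ u` is nonincreasing, for `ε` small
      (8 * ε * |lam| ≤ 1 → AntitoneOn (fun t => φ (u t)) (Ici 0)) ∧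
      -- `φ ∘ u + 𝒰` is `lam * C`-convex on `[a,b]` (the modulus `lam * C` is negative)
      (∀ a b : ℝ, 0 < a → a < b → ∃ C : ℝ, 0 < C ∧
        StrongConvexOn (Icc a b) (lam * C)
          (fun t => (φ (u t)).toReal + WED.accumulated u t))) ∧
    -- `e^{2 lam' t} |u'|²(t)` is nonincreasing for `ε` small
    (∀ lam' : ℝ, lam' < lam → ∃ ε' : ℝ, 0 < ε' ∧
      ∀ ε : ℝ, 0 < ε → ε < ε' → ∀ x : X, ∀ u ∈ WED.minimizers φ ε x,
        ∃ g : ℝ → ℝ, WED.IsLocLipRep g (fun t => WED.metricDeriv u t ^ 2) ∧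
          AntitoneOn (fun t => Real.exp (2 * lam' * t) * g t) (Ioi 0)) := by
  have hreg : ∀ ε : ℝ, 0 < ε → ∀ x : X, ∀ u ∈ WED.minimizers φ ε x,
      ∃ (c : ℝ) (y : ℝ → ℝ), WED.RegularMinimizer φ lam ε c u y := by
    intro ε hε x u hu
    obtain ⟨y, hy⟩ := WED.exists_wedMinimizer (hφ.lowerSemicontinuous hσ) hφ.ne_bot hφ.coercivity
      hε hu
    exact hy.exists_regularMinimizer hlam hconv
  refine ⟨fun ε hε x u hu => ?_, fun lam' hlam' => ?_⟩
  · obtain ⟨c, y, h⟩ := hreg ε hε x u hu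
    refine ⟨⟨h.lt_top, h.locallyLipschitzOn_energy,
        h.continuousWithinAt_energy_zero hlam hconv⟩,
      ⟨fun t => 1 / 2 * y t ^ 2, ?_, ?_⟩, fun ξ hξ => ⟨h.differential_identity hξ,
        fun hξ0 => h.differential_inequality hξ hξ0⟩, fun hsmall => ?_, fun a b ha hab => ?_⟩
    · exact h.locallyLipschitzOn_half_sq_speed
    · filter_upwards [h.halfSpeedSq_ae_eq] with t ht using ht.symm
    · rw [abs_of_neg hlam] at hsmall
      -- With 8ε|λ| ≤ 1, r = 2|λ| gives 2εr ≤ 1/2 and r - εr² = 2|λ| - 4ελ² ≥ |λ|.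
      refine h.antitoneOn_energy (r := 2 * -lam) (by linarith) (by nlinarith) ?_
      nlinarith [mul_le_mul_of_nonneg_right hsmall (by linarith : 0 ≤ -lam)]
    · obtain ⟨C, hC, hconv'⟩ := h.strongConvexOn (b := b) ha
      refine ⟨C, hC, hconv'.1, fun s hs t ht p q hp hq hpq => ?_⟩
      have hmem := hconv'.1 hs ht hp hq hpq
      simp only
      rw [h.accumulated_eq (ha.le.trans hs.1), h.accumulated_eq (ha.le.trans ht.1),
        h.accumulated_eq (ha.le.trans hmem.1)]
      exact hconv'.2 hs ht hp hq hpq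
  · have hr : 0 < -lam' := by linarith
    have hne : lam' ≠ 0 := by intro h0; linarith
    -- For r = -λ' the two bounds are exactly -λ ≤ r - εr² and 2εr ≤ 1.
    refine ⟨min ((lam - lam') / lam' ^ 2) (1 / (2 * -lam')), lt_min ?_ (by positivity),
      fun ε hε hε' x u hu => ?_⟩
    · exact div_pos (by linarith) (by positivity)
    obtain ⟨c, y, h⟩ := hreg ε hε x u hu
    have h1 := hε'.trans_le (min_le_left _ _)
    have h2 := hε'.trans_le (min_le_right _ _)
    rw [lt_div_iff₀ (by nlinarith)] at h1
    rw [lt_div_iff₀ (by linarith)] at h2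
    refine ⟨fun t => y t ^ 2, ⟨h.locallyLipschitzOn_sq_speed, ?_⟩, ?_⟩
    · filter_upwards [h.ae_eq] with t ht
      rw [ht]
    · have h3 := h.antitoneOn_exp_mul_sq_speed hr.le (by linarith) (by nlinarith)
      have e : ∀ t, -(2 * -lam' * t) = 2 * lam' * t := fun t => by ring
      simpa only [e] using h3
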